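/- Let $d,k\ge 1$ be integers. For points $z^{(1)},\dots,z^{(N)}$ of the unit cube $[0,1]^d$ with $N>k$, let $\epsilon_{i,j}$ be twice the largest distance $|z^{(l)}_j-z^{(i)}_j|$ over the $k$ nearest neighbours $z^{(l)}$ ($l\ne i$) of $z^{(i)}$ in the maximum norm, let $\zeta_{i,j}=\min\{z^{(i)}_j+\epsilon_{i,j}/2,1\}-\max\{z^{(i)}_j-\epsilon_{i,j}/2,0\}$, and, with $\psi=\Gamma'/\Gamma$, let $$\widehat H_{\mathrm{tKSG}}(Z)=-\psi(k)+\psi(N)+\frac{d-1}{k}+\frac1N\sum_{i=1}^N\sum_{j=1}^d\log\zeta_{i,j}.$$ A uniformizing map (UM) is a differentiable bijection $f:\mathbb R^d\to(0,1)^d$ with differentiable inverse and differentiable Jacobian $|\det f'|$. The UM-tKSG estimator of a sample $x^{(1)},\dots,x^{(N)}$, with $z^{(i)}=f(x^{(i)})$, is $$\widehat H_{\mathrm{UM\text{-}tKSG}}(X)=\widehat H_{\mathrm{tKSG}}(Z)+\frac1N\sum_{i=1}^N\log\left|\det\frac{\partial f^{-1}(z^{(i)})}{\partial z}\right| .$$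 Let $p$ be a differentiable probability density on $\mathbb R^d$ with finite entropy $H(X)=-\int p\log p$, that is, $p\log p$ is integrable. For every $N$ let $f=f_S$ be a UM constructed from a set $S$ of $N$ i.i.d. samples with density $p$ (with $(S,x)\mapsto f_S(x)$ measurable), and let $\widehat H_{\mathrm{UM\text{-}tKSG}}(X)$ be computed with $f_S$ from $N$ further i.i.d. samples with density $p$, independent of $S$. Let $p_z^S(z)=p(f_S^{-1}(z))/|\det f_S'(f_S^{-1}(z))|$ be the density of $f_S(X)$ given $S$, and let $C_2^N=\sup_{z\in(0,1)^d}\|\nabla p_z^S(z)\|_1$. Assume that $C_2^N\to0$ in probability as $N\to\infty$, and that there are an integer $M\ge1$ and a real $\bar C\in(0,1)$ such that $C_2^N\le\bar C$ almost surely for every $N>M$. Put $$C_{\mathrm{UM\text{-}tKSG}}=C\,\frac{(1+\bar C)\big((1+\bar C)^d+1\big)}{(1-\bar C)^{k+1}},$$ where $C>0$ is a constant that depends only on $d$ and $k$. Then, for a suitable such $C$ and every $N>\max(M,k)$, the estimator is integrable and $$\big|\mathbb E[\widehat H_{\mathrm{UM\text{-}tKSG}}(X)]-H(X)\big|\le C_{\mathrm{UM\text{-}tKSG}}\,\frac{(\log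 N)^{k+2}}{N^{1/d}} .$$ If moreover $\int p\,(\log p)^2<\infty$, then there is a constant $C_2>0$, depending only on $d,k,p,\bar C$, such that for every $N>\max(M,k)$ the mean squared error is finite and $$\mathbb E\big[(\widehat H_{\mathrm{UM\text{-}tKSG}}(X)-H(X))^2\big]\le C_2\,\frac{(\log N)^{k+2}}{N}+C_{\mathrm{UM\text{-}tKSG}}^2\,\frac{(\log N)^{2(k+2)}}{N^{2/d}} .$$ -/

import Mathlib

open MeasureTheory ProbabilityTheory Filter Topology
open scoped ENNReal NNReal

noncomputable section

/-- `ℝ^d`; its norm is the maximum norm and its `volume` is Lebesgue measure. -/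
abbrev Vec (d : ℕ) : Type := Fin d → ℝ

/-- The interior `(0,1)^d` of the unit cube. -/
def openCube (d : ℕ) : Set (Vec d) := {z | ∀ j, 0 < z j ∧ z j < 1}

/-- `p` is a probability density on `ℝ^d` with respect to Lebesgue measure. -/
structure IsProbDensity {d : ℕ} (p : Vec d → ℝ) : Prop where
  measurable : Measurable p
  nonneg : ∀ x, 0 ≤ p x
  integrable : Integrable p
  integral_eq_one : ∫ x, p x = 1

/-- The probability measure with density `p`. -/
def densityMeasure {d : ℕ} (p : Vec d → ℝ) : Measure (Vec d) :=
  (volume : Measure (Vec d)).withDensity (fun x => ENNReal.ofReal (p x))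

/-- Differential entropy `-∫ log(p(x)) p(x) dx`. -/
def diffEntropy {d : ℕ} (p : Vec d → ℝ) : ℝ := -∫ x, Real.log (p x) * p x

/-- The digamma function `ψ = Γ'/Γ`. -/
def psi (x : ℝ) : ℝ := deriv Real.Gamma x / Real.Gamma x

/-- Indices of the `k` nearest neighbours (maximum norm) of the point `x i` among the other points:
those `l ≠ i` for which fewer than `k` points other than `x i` lie strictly closer to `x i`.
In the absence of ties this set has exactly `min k (N-1)` elements. -/
def kNearest {d N : ℕ} (k : ℕ) (x : Fin N → Vec d) (i : Fin N) : Finset (Fin N) :=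
  {l | l ≠ i ∧
    (({m | m ≠ i ∧ dist (x m) (x i) < dist (x l) (x i)} : Finset (Fin N)).card < k)}

/-- `ε_{i,j}`: twice the largest distance, along coordinate `j`, from `x i` to one of its `k` nearest
neighbours. -/
def epsRect {d N : ℕ} (k : ℕ) (x : Fin N → Vec d) (i : Fin N) (j : Fin d) : ℝ :=
  2 * ((kNearest k x i).sup (fun l => ‖x l j - x i j‖₊) : ℝ≥0)

/-- `ζ_{i,j}`: the side length of the rectangular cell after truncation to the unit cube. -/
def zetaRect {d N : ℕ} (k : ℕ) (x : Fin N → Vec d) (i : Fin N) (j : Fin d) : ℝ :=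
  min (x i j + epsRect k x i j / 2) 1 - max (x i j - epsRect k x i j / 2) 0

/-- The truncated KSG entropy estimator. -/
def tKSG {d N : ℕ} (k : ℕ) (x : Fin N → Vec d) : ℝ :=
  -psi k + psi N + ((d : ℝ) - 1) / k
    + (1 / (N : ℝ)) * ∑ i, ∑ j, Real.log (zetaRect k x i j)

/-- A uniformizing map: a differentiable bijection `f` from `ℝ^d` onto the open unit cube with
differentiable inverse, whose Jacobian `|det f'|` is differentiable. -/
structure UniformizingMap (d : ℕ) where
  /-- the map `f` -/
  toFun : Vec d → Vec d
  /-- the inverse map, on the open cube -/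
  inv : Vec d → Vec d
  mapsTo : ∀ x, toFun x ∈ openCube d
  left_inv : ∀ x, inv (toFun x) = x
  right_inv : ∀ z ∈ openCube d, toFun (inv z) = z
  differentiable : Differentiable ℝ toFun
  differentiableOn_inv : DifferentiableOn ℝ inv (openCube d)
  differentiable_jac : Differentiable ℝ (fun x => |(fderiv ℝ toFun x).det|)

/-- The density of `Z = f(X)` on the open cube when `X` has density `p`, by change of variables:
`p_z(z) = p(f⁻¹(z)) / |det f'(f⁻¹(z))|`. -/
def UniformizingMap.density {d : ℕ} (f : UniformizingMap d) (p : Vec d → ℝ) (z : Vec d) : ℝ :=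
  p (f.inv z) / |(fderiv ℝ f.toFun (f.inv z)).det|

/-- `sup_{z ∈ (0,1)^d} ‖∇q(z)‖₁`, in `[0,∞]`. -/
def gradSup {d : ℕ} (q : Vec d → ℝ) : ℝ≥0∞ :=
  ⨆ z ∈ openCube d, ENNReal.ofReal (∑ j, |fderiv ℝ q z (Pi.single j 1)|)

/-- The UM-tKSG estimator for the uniformizing map `f` and the sample `x`:
`Ĥ_tKSG(z) + (1/N) ∑ log |det ∂f⁻¹(z⁽ⁱ⁾)/∂z|` with `z⁽ⁱ⁾ = f(x⁽ⁱ⁾)`. -/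
def umTKSG {d N : ℕ} (k : ℕ) (f : UniformizingMap d) (x : Fin N → Vec d) : ℝ :=
  tKSG k (fun i => f.toFun (x i))
    + (1 / (N : ℝ)) * ∑ i, Real.log |(fderiv ℝ f.inv (f.toFun (x i))).det|

/-- The factor `(1+c)((1+c)^d+1)/(1-c)^{k+1}`. -/
def umFactor (d k : ℕ) (c : ℝ) : ℝ :=
  (1 + c) * ((1 + c) ^ d + 1) / (1 - c) ^ (k + 1)

end

noncomputable section

/-! Write `N = n + 1` and fix the training sample first. If the gradient of the density `q` of `Z =
f(X)` is bounded by `c` in the 1-norm, then `q` is `c`-Lipschitz for the maximum norm on a cube of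
volume 1 and diameter 1. As `q` has mean 1, its values lie in `[1 - c, 1 + c]`
(`UniformizingMap.nearUniform`). Change of variables gives `H(X) = E g(Z) - E log q(Z)`, where `g`
is the log-Jacobian of the inverse map. So the Jacobian correction is unbiased, and the bias is `E
tKSG(Z) + E log q(Z)`.

Bias. Fix one sample point `z` and let `ρ` be the distance to its `k`-th neighbour among the other
`n` points. The mass of the ball of radius `ρ` is distributed like the `k`-th smallest of `n`
uniform variables, whatever the density is, so its logarithm has mean `ψ(k) - ψ(N)`
(`map_ballMass_knnRadius`, `integral_log_ballMass`). What remains is the mean of `localError`, which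
is split at a radius `D` for which the ball around `z` stays inside the cube. If `ρ ≤ D`, nothing is
truncated. The log-mass is `log q(z) + d log(2ρ)` up to `ρ / (1 - c)`, and the log-volume of the
cell is `d log(2ρ)` minus the log-ratio of cube to rectangle. Under Lebesgue measure this log-ratio
has mean `(d - 1)/k` on every ball, hence against every function of the radius
(`lintegral_logRatio_mul`); freezing the density at `z` costs a multiple of `ρ`. The mean of `ρ` is
of order `1/b`, where `b = ((1 - c) N)^(1/d)`. If `ρ > D`, a second moment bounds the probability by
a multiple of `(1 + (bD)^2)⁻¹`, and the logarithms are at most of order `s` plus `exp(-s/2)` times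
integrable inverse square roots. Taking `D` to be half the distance from `z` to the boundary, the
probability averages over `z` to order `1/b`; `s = 4 log N` makes the singular part negligible and
leaves one factor `log N`.

Variance. Efron–Stein is applied with the statistic from which one sample point has been deleted
(`efronStein`). Deleting a point changes only the cells of those points that have it among their `k`
nearest neighbours, and there are at most `k 2^d` of these, by a cone argument with orthants
(`card_reverse_nearest_le`). Second moments of the log-cells are of order `(log N)^2`, so the
variance is of order `(log N)^2 / N`.

Random map. Training and estimation samples are independent, so all bounds hold conditionally on
almost every training sample with constants that do not depend on the map, and Fubini averages them.
-/

/-- Indices in `J` of the `k` points `x l` nearest to `z`. -/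
def nearest {ι : Type*} {d : ℕ} (k : ℕ) (J : Finset ι) (x : ι → Vec d) (z : Vec d) : Finset ι :=
  J.filter fun l => (J.filter fun m => dist (x m) z < dist (x l) z).card < k

/-- The largest distance from `z` to one of its `k` nearest neighbours in `J`. -/
def knnRadius {ι : Type*} {d : ℕ} (k : ℕ) (J : Finset ι) (x : ι → Vec d) (z : Vec d) : ℝ≥0 :=
  (nearest k J x z).sup fun l => nndist (x l) z

/-- The largest distance along coordinate `j` from `z` to one of its `k` nearest neighbours. -/
def halfWidth {ι : Type*} {d : ℕ} (k : ℕ) (J : Finset ι) (x : ι → Vec d) (z : Vec d)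
    (j : Fin d) : ℝ≥0 :=
  (nearest k J x z).sup fun l => ‖x l j - z j‖₊

/-- The length of `[a - m, a + m] ∩ [0, 1]`. -/
def truncatedLength (a m : ℝ) : ℝ := min (a + m) 1 - max (a - m) 0

/-- The logarithmic volume of the truncated rectangular cell around `z`. -/
def logCell {ι : Type*} {d : ℕ} (k : ℕ) (J : Finset ι) (x : ι → Vec d) (z : Vec d) : ℝ :=
  ∑ j, Real.log (truncatedLength (z j) (halfWidth k J x z j))

/-! ### Combinatorics of nearest neighbours -/

section Combinatorics

variable {ι : Type*} {d k : ℕ} {J : Finset ι} {x : ι → Vec d} {z : Vec d}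

lemma mem_nearest {l : ι} : l ∈ nearest k J x z ↔
    l ∈ J ∧ (J.filter fun m => dist (x m) z < dist (x l) z).card < k := by
  simp [nearest]

lemma kNearest_eq_nearest {N : ℕ} (k : ℕ) (x : Fin N → Vec d) (i : Fin N) :
    kNearest k x i = nearest k (Finset.univ.erase i) x (x i) := by
  ext l
  simp only [kNearest, mem_nearest, Finset.mem_filter, Finset.mem_univ, true_and,
    Finset.mem_erase, and_true]
  have : (Finset.univ.filter fun m => m ≠ i ∧ dist (x m) (x i) < dist (x l) (x i))
      = (Finset.univ.erase i).filter fun m => dist (x m) (x i) < dist (x l) (x i) := by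
    ext m; simp
  rw [this]

lemma log_zetaRect_sum {N : ℕ} (k : ℕ) (x : Fin N → Vec d) (i : Fin N) :
    ∑ j, Real.log (zetaRect k x i j) = logCell k (Finset.univ.erase i) x (x i) := by
  refine Finset.sum_congr rfl fun j _ => ?_
  have h : epsRect k x i j / 2 = halfWidth k (Finset.univ.erase i) x (x i) j := by
    rw [epsRect, halfWidth, kNearest_eq_nearest]
    ring
  rw [zetaRect, truncatedLength, h]

lemma nearest_map {ι' : Type*} (e : ι' ↪ ι) (J : Finset ι') :
    nearest k (J.map e) x z = (nearest k J (x ∘ e) z).map e := by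
  classical
  ext l
  simp only [mem_nearest, Finset.mem_map]
  have key : ∀ a : ι', ((J.map e).filter fun m => dist (x m) z < dist (x (e a)) z).card
      = (J.filter fun m => dist ((x ∘ e) m) z < dist ((x ∘ e) a) z).card := by
    intro a
    rw [Finset.filter_map, Finset.card_map]
    rfl
  constructor
  · rintro ⟨⟨a, ha, rfl⟩, h⟩
    exact ⟨a, ⟨ha, key a ▸ h⟩, rfl⟩
  · rintro ⟨a, ⟨ha, h⟩, rfl⟩
    exact ⟨⟨a, ha, rfl⟩, (key a).symm ▸ h⟩

lemma halfWidth_map {ι' : Type*} (e : ι' ↪ ι) (J : Finset ι') (j : Fin d) :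
    halfWidth k (J.map e) x z j = halfWidth k J (x ∘ e) z j := by
  rw [halfWidth, nearest_map, Finset.sup_map]; rfl

lemma logCell_map {ι' : Type*} (e : ι' ↪ ι) (J : Finset ι') :
    logCell k (J.map e) x z = logCell k J (x ∘ e) z := by
  simp [logCell, halfWidth_map]

/-- A member of `A` is preceded only by other members of `A`, hence by fewer than `k` points, while
an index outside `A` is preceded by all `k` of them. -/
lemma nearest_eq_of_separated {A : Finset ι} (hAJ : A ⊆ J) (hA : A.card = k)
    (h : ∀ l ∈ J, l ∉ A → ∀ m ∈ A, dist (x m) z < dist (x l) z) : nearest k J x z = A := by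
  classical
  ext l
  rw [mem_nearest]
  constructor
  · rintro ⟨hl, hc⟩
    by_contra hlA
    have : A ⊆ J.filter fun m => dist (x m) z < dist (x l) z := fun m hm =>
      Finset.mem_filter.2 ⟨hAJ hm, h l hl hlA m hm⟩
    exact absurd (Finset.card_le_card this) (by omega)
  · intro hl
    refine ⟨hAJ hl, ?_⟩
    have : (J.filter fun m => dist (x m) z < dist (x l) z) ⊆ A.erase l := by
      intro m hm
      obtain ⟨hmJ, hm⟩ := Finset.mem_filter.1 hm
      refine Finset.mem_erase.2 ⟨fun e => by simp [e] at hm, ?_⟩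
      by_contra hmA
      exact absurd (h m hmJ hmA l hl) (not_lt.2 hm.le)
    have h1 := Finset.card_le_card this
    rw [Finset.card_erase_of_mem hl] at h1
    have := Finset.card_pos.2 ⟨l, hl⟩
    omega

/-- An index `l` outside the nearest set has at least `k` points strictly closer than itself.
Whenever `l` counts against some `a`, those `k` points count against `a` too, so `a` is excluded
with or without `l`. Ties do no harm. -/
lemma nearest_erase [DecidableEq ι] {l : ι} (hl : l ∉ nearest k J x z) :
    nearest k (J.erase l) x z = nearest k J x z := by
  by_cases hlJ : l ∈ J
  swap
  · rw [Finset.erase_eq_of_notMem hlJ]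
  have hcl : k ≤ (J.filter fun m => dist (x m) z < dist (x l) z).card := by
    by_contra hlt
    exact hl (mem_nearest.2 ⟨hlJ, not_le.1 hlt⟩)
  ext a
  rw [mem_nearest, mem_nearest]
  have hsub : ((J.erase l).filter fun m => dist (x m) z < dist (x a) z)
      ⊆ J.filter fun m => dist (x m) z < dist (x a) z :=
    Finset.filter_subset_filter _ (Finset.erase_subset _ _)
  constructor
  · rintro ⟨haJ, hc⟩
    refine ⟨Finset.mem_of_mem_erase haJ, ?_⟩
    by_cases hla : dist (x l) z < dist (x a) z
    · have : (J.filter fun m => dist (x m) z < dist (x l) z)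
          ⊆ (J.erase l).filter fun m => dist (x m) z < dist (x a) z := by
        intro m hm
        obtain ⟨hmJ, hm⟩ := Finset.mem_filter.1 hm
        exact Finset.mem_filter.2
          ⟨Finset.mem_erase.2 ⟨fun e => by simp [e] at hm, hmJ⟩, hm.trans hla⟩
      have := Finset.card_le_card this
      omega
    · have : (J.filter fun m => dist (x m) z < dist (x a) z)
          ⊆ (J.erase l).filter fun m => dist (x m) z < dist (x a) z := by
        intro m hm
        obtain ⟨hmJ, hm⟩ := Finset.mem_filter.1 hm
        exact Finset.mem_filter.2
          ⟨Finset.mem_erase.2 ⟨fun e => hla (e ▸ hm), hmJ⟩, hm⟩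
      exact (Finset.card_le_card this).trans_lt hc
  · rintro ⟨haJ, hc⟩
    have hal : a ≠ l := by
      rintro rfl
      omega
    exact ⟨Finset.mem_erase.2 ⟨hal, haJ⟩, (Finset.card_le_card hsub).trans_lt hc⟩

lemma logCell_erase [DecidableEq ι] {l : ι} (hl : l ∉ nearest k J x z) :
    logCell k (J.erase l) x z = logCell k J x z := by
  simp [logCell, halfWidth, nearest_erase hl]

end Combinatorics

/-! ### Conditioning on which points are nearest -/

section Splitting

variable {ι : Type*} [Fintype ι] {d : ℕ}

/-- The event that all points with index outside `A` are further from `z` than those in `A`. -/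
def separated (z : Vec d) (A : Finset ι) : Set (ι → Vec d) :=
  {y | ∀ l ∉ A, ∀ m ∈ A, dist (y m) z < dist (y l) z}

lemma measurableSet_separated (z : Vec d) (A : Finset ι) : MeasurableSet (separated z A) := by
  have : separated z A
      = ⋂ l : ι, ⋂ (_ : l ∉ A), ⋂ m : ι, ⋂ (_ : m ∈ A),
          {y : ι → Vec d | dist (y m) z < dist (y l) z} := by
    ext y; simp [separated]
  rw [this]
  refine MeasurableSet.iInter fun l => MeasurableSet.iInter fun _ => MeasurableSet.iInter fun m =>
    MeasurableSet.iInter fun _ => measurableSet_lt ?_ ?_ <;> fun_prop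

lemma measurable_measure_compl_closedBall {X : Type*} [PseudoMetricSpace X] [MeasurableSpace X]
    (μ : Measure X) (z : X) :
    Measurable fun t : ℝ => μ (Metric.closedBall z t)ᶜ :=
  Antitone.measurable fun _ _ h =>
    measure_mono (Set.compl_subset_compl.2 (Metric.closedBall_subset_closedBall h))

/-- The metric on `A → Vec d` is the supremum, so `dist u fun _ => z` is the distance of the
farthest point of `u`. Given `u`, each remaining point must independently avoid the closed ball of
that radius, which by Fubini gives one factor per index outside `A`. -/
lemma lintegral_separated (μ : Measure (Vec d)) [SigmaFinite μ] (z : Vec d) (A : Finset ι)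
    (hA : A.Nonempty) {Γ : (A → Vec d) → ℝ≥0∞} (hΓ : Measurable Γ) :
    ∫⁻ y in separated z A, Γ (fun a => y a) ∂(Measure.pi fun _ : ι => μ)
      = ∫⁻ u, Γ u * μ (Metric.closedBall z (dist u fun _ => z))ᶜ ^ (Fintype.card ι - A.card)
          ∂(Measure.pi fun _ : A => μ) := by
  classical
  have : Nonempty A := hA.to_subtype
  let e := MeasurableEquiv.piEquivPiSubtypeProd (fun _ : ι => Vec d) (fun i => i ∈ A)
  have hmp : MeasurePreserving e (Measure.pi fun _ : ι => μ)
      ((Measure.pi fun _ : A => μ).prod (Measure.pi fun _ : {i // i ∉ A} => μ)) := by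
    convert measurePreserving_piEquivPiSubtypeProd (fun _ : ι => μ) (fun i => i ∈ A)
  let V : (A → Vec d) → Set ({i // i ∉ A} → Vec d) := fun u =>
    Set.univ.pi fun _ => (Metric.closedBall z (dist u fun _ => z))ᶜ
  have hV : ∀ (u : A → Vec d) (v : {i // i ∉ A} → Vec d),
      v ∈ V u ↔ ∀ l, ∀ m, dist (u m) z < dist (v l) z := by
    intro u v
    simp only [V, Set.mem_pi, Set.mem_univ, true_implies, Set.mem_compl_iff,
      Metric.mem_closedBall, not_le]
    refine forall_congr' fun l => ⟨fun h m => (dist_le_pi_dist u (fun _ => z) m).trans_lt h,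
      fun h => ?_⟩
    obtain ⟨m0⟩ := this
    exact (dist_pi_lt_iff (dist_nonneg.trans_lt (h m0))).2 h
  have hS : separated z A = e ⁻¹' {q | q.2 ∈ V q.1} := by
    ext y
    simp only [separated, Set.mem_ofPred_eq, Set.mem_preimage, hV]
    exact ⟨fun h l m => h l l.2 m m.2, fun h l hl m hm => h ⟨l, hl⟩ ⟨m, hm⟩⟩
  have hmeas : MeasurableSet {q : (A → Vec d) × ({i // i ∉ A} → Vec d) | q.2 ∈ V q.1} := by
    have := (MeasurableEquiv.measurableSet_preimage e
      (s := {q | q.2 ∈ V q.1})).1 (hS ▸ measurableSet_separated z A)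
    exact this
  have h1 : ∫⁻ y in separated z A, Γ (fun a => y a) ∂(Measure.pi fun _ : ι => μ)
      = ∫⁻ q in {q | q.2 ∈ V q.1}, Γ q.1
        ∂((Measure.pi fun _ : A => μ).prod (Measure.pi fun _ : {i // i ∉ A} => μ)) := by
    rw [hS]
    exact hmp.setLIntegral_comp_preimage hmeas (hΓ.comp measurable_fst)
  have hm : Measurable fun q : (A → Vec d) × ({i // i ∉ A} → Vec d) => Γ q.1 :=
    hΓ.comp measurable_fst
  rw [h1, ← lintegral_indicator hmeas, lintegral_prod _
    (hm.indicator hmeas).aemeasurable]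
  refine lintegral_congr fun u => ?_
  have h2 : ∀ v, Set.indicator {q : (A → Vec d) × ({i // i ∉ A} → Vec d) | q.2 ∈ V q.1}
      (fun q => Γ q.1) (u, v) = (V u).indicator (fun _ => Γ u) v := by
    intro v
    simp only [Set.indicator, Set.mem_ofPred_eq]
  simp_rw [h2]
  rw [lintegral_indicator_const]
  · rw [Measure.pi_pi]
    simp only [Finset.prod_const, Finset.card_univ]
    rw [Fintype.card_subtype_compl, Fintype.card_coe]
  · exact MeasurableSet.univ_pi fun _ => Metric.isClosed_closedBall.measurableSet.compl

end Splitting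

/-! ### The digamma function at positive integers -/

section Digamma

lemma psi_natCast_add_one (n : ℕ) :
    psi ((n : ℝ) + 1) = -Real.eulerMascheroniConstant + harmonic n := by
  have h : (n.factorial : ℝ) ≠ 0 := by positivity
  rw [psi, Real.deriv_Gamma_nat, Real.Gamma_nat_eq_factorial]
  field_simp

/-- This is a difference of harmonic numbers; the sum starts at `k` because `ψ(k)` involves the
harmonic number of index `k - 1`. -/
lemma psi_sub_psi {k n : ℕ} (hk : 1 ≤ k) (hkn : k ≤ n) :
    psi ((n : ℝ) + 1) - psi k = ∑ i ∈ Finset.Ico k (n + 1), 1 / (i : ℝ) := by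
  induction n, hkn using Nat.le_induction with
  | base =>
    obtain ⟨m, rfl⟩ := Nat.exists_eq_add_of_le' hk
    have h := psi_natCast_add_one (m + 1)
    push_cast at h ⊢
    rw [h, psi_natCast_add_one, harmonic_succ]
    simp
  | succ n hkn ih =>
    rw [Finset.sum_Ico_succ_top (by omega), ← ih]
    have h := psi_natCast_add_one (n + 1)
    push_cast at h ⊢
    rw [h, psi_natCast_add_one, harmonic_succ]
    push_cast
    ring

end Digamma

/-! ### Beta integrals and the law of a uniform order statistic -/

section BetaIntegral

lemma intervalIntegrable_log_mul_pow (a b : ℕ) :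
    IntervalIntegrable (fun u : ℝ => Real.log u * (u ^ a * (1 - u) ^ b)) volume 0 1 :=
  intervalIntegral.intervalIntegrable_log'.mul_continuousOn (by fun_prop)

lemma integral_pow_mul_one_sub_pow (a b : ℕ) :
    ∫ u in (0 : ℝ)..1, u ^ a * (1 - u) ^ b
      = (a.factorial * b.factorial : ℝ) / (a + b + 1).factorial := by
  induction b generalizing a with
  | zero =>
    simp only [pow_zero, mul_one, integral_pow, Nat.factorial_succ, add_zero]
    have : (a.factorial : ℝ) ≠ 0 := by positivity
    push_cast
    field_simp
    simp
  | succ b ih =>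
    have h : ∀ u : ℝ, u ^ a * (1 - u) ^ (b + 1) = u ^ a * (1 - u) ^ b - u ^ (a + 1) * (1 - u) ^ b :=
      fun u => by ring
    simp_rw [h]
    rw [intervalIntegral.integral_sub, ih, ih]
    · rw [show a + 1 + b + 1 = (a + b + 1) + 1 by ring, show a + (b + 1) + 1 = (a + b + 1) + 1 by ring,
        Nat.factorial_succ a, Nat.factorial_succ b, Nat.factorial_succ (a + b + 1)]
      have : ((a + b + 1).factorial : ℝ) ≠ 0 := by positivity
      push_cast
      field_simp
      ring
    all_goals exact Continuous.intervalIntegrable (by fun_prop) _ _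

lemma integral_log_mul_pow (a : ℕ) :
    ∫ u in (0 : ℝ)..1, Real.log u * u ^ a = -1 / ((a : ℝ) + 1) ^ 2 := by
  have ha : (a : ℝ) + 1 ≠ 0 := by positivity
  have hint : IntervalIntegrable (fun u : ℝ => Real.log u * u ^ a) volume 0 1 := by
    simpa using intervalIntegrable_log_mul_pow a 0
  -- The antiderivative is written with the factor `u * log u`, which is continuous at the singular
  -- endpoint 0.
  have hcont : Continuous fun u : ℝ =>
      (u ^ a * (u * Real.log u)) / (a + 1) - u ^ (a + 1) / ((a : ℝ) + 1) ^ 2 := by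
    have := Real.continuous_mul_log
    fun_prop
  rw [intervalIntegral.integral_eq_sub_of_hasDerivAt_of_le zero_le_one hcont.continuousOn
    (fun x hx => ?_) hint]
  · simp
    ring
  · have hx0 : x ≠ 0 := hx.1.ne'
    have h1 := ((hasDerivAt_pow (a + 1) x).mul (Real.hasDerivAt_log hx0)).div_const ((a : ℝ) + 1)
    have h2 := (hasDerivAt_pow (a + 1) x).div_const (((a : ℝ) + 1) ^ 2)
    have h3 := h1.sub h2
    have hfun : (fun u : ℝ =>
        (u ^ a * (u * Real.log u)) / (a + 1) - u ^ (a + 1) / ((a : ℝ) + 1) ^ 2)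
        = fun u => (u ^ (a + 1) * Real.log u) / (a + 1) - u ^ (a + 1) / ((a : ℝ) + 1) ^ 2 := by
      ext u
      ring
    rw [hfun]
    refine HasDerivAt.congr_deriv (h1.sub h2) ?_
    simp only [Nat.add_sub_cancel]
    push_cast
    field_simp
    ring

/-- Induction on `b` with one factor `1 - u` split off, as for the Beta integral. The two harmonic
sums of the induction step differ only in one term at each end. -/
lemma integral_log_mul_pow_mul_one_sub_pow (a b : ℕ) :
    ∫ u in (0 : ℝ)..1, Real.log u * (u ^ a * (1 - u) ^ b)
      = -((a.factorial * b.factorial : ℝ) / (a + b + 1).factorial)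
        * ∑ i ∈ Finset.Ico (a + 1) (a + b + 2), 1 / (i : ℝ) := by
  induction b generalizing a with
  | zero =>
    simp only [pow_zero, mul_one, integral_log_mul_pow, Nat.factorial_succ, add_zero]
    have : (a.factorial : ℝ) ≠ 0 := by positivity
    rw [show a + 2 = (a + 1) + 1 by rfl, Nat.Ico_succ_singleton]
    simp only [Finset.sum_singleton]
    push_cast
    field_simp
    simp
  | succ b ih =>
    have h : ∀ u : ℝ, Real.log u * (u ^ a * (1 - u) ^ (b + 1))
        = Real.log u * (u ^ a * (1 - u) ^ b) - Real.log u * (u ^ (a + 1) * (1 - u) ^ b) :=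
      fun u => by ring
    simp_rw [h]
    rw [intervalIntegral.integral_sub (intervalIntegrable_log_mul_pow _ _)
      (intervalIntegrable_log_mul_pow _ _), ih, ih]
    rw [show a + 1 + b + 1 = (a + b + 1) + 1 by ring, show a + (b + 1) + 1 = (a + b + 1) + 1 by ring,
      show a + 1 + b + 2 = (a + b + 2) + 1 by ring, show a + (b + 1) + 2 = (a + b + 2) + 1 by ring,
      Nat.factorial_succ a, Nat.factorial_succ b, Nat.factorial_succ (a + b + 1)]
    rw [Finset.sum_Ico_succ_top (by omega : a + 1 + 1 ≤ a + b + 2),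
      Finset.sum_Ico_succ_top (by omega : a + 1 ≤ a + b + 2),
      Finset.sum_eq_sum_Ico_succ_bot (by omega : a + 1 < a + b + 2)]
    set S := ∑ i ∈ Finset.Ico (a + 1 + 1) (a + b + 2), 1 / (i : ℝ)
    have h1 : ((a + b + 1).factorial : ℝ) ≠ 0 := by positivity
    have h2 : (a : ℝ) + b + 2 ≠ 0 := by positivity
    have h3 : (a : ℝ) + 1 ≠ 0 := by positivity
    have h4 : (a : ℝ) + b + 1 + 1 ≠ 0 := by positivity
    push_cast
    field_simp
    ring

/-- The law of the `k`-th smallest of `n` independent uniform variables. -/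
def orderStatLaw (k n : ℕ) : Measure ℝ :=
  (volume.restrict (Set.Ioc 0 1)).withDensity fun x =>
    ENNReal.ofReal (k * n.choose k * (x ^ (k - 1) * (1 - x) ^ (n - k)))

variable {k n : ℕ}

lemma orderStat_factorial (hk : 1 ≤ k) (hkn : k ≤ n) :
    (k * n.choose k : ℝ) * (((k - 1).factorial * (n - k).factorial : ℝ) / n.factorial) = 1 := by
  have h := Nat.choose_mul_factorial_mul_factorial hkn
  obtain ⟨m, rfl⟩ := Nat.exists_eq_add_of_le' hk
  rw [Nat.factorial_succ] at h
  have h' : ((n.choose (m + 1) : ℝ) * ((m + 1) * m.factorial) * (n - (m + 1)).factorial)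
      = n.factorial := by exact_mod_cast h
  have : (n.factorial : ℝ) ≠ 0 := by positivity
  simp only [Nat.add_sub_cancel]
  field_simp
  push_cast
  linarith

lemma integral_orderStatLaw (f : ℝ → ℝ) :
    ∫ x, f x ∂orderStatLaw k n
      = k * n.choose k * ∫ x in (0 : ℝ)..1, f x * (x ^ (k - 1) * (1 - x) ^ (n - k)) := by
  rw [orderStatLaw, integral_withDensity_eq_integral_toReal_smul (by fun_prop) (by simp),
    intervalIntegral.integral_of_le zero_le_one, ← integral_const_mul]
  refine setIntegral_congr_fun measurableSet_Ioc fun x hx => ?_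
  have : 0 ≤ 1 - x := sub_nonneg.2 hx.2
  have := hx.1.le
  simp only [smul_eq_mul]
  rw [ENNReal.toReal_ofReal (by positivity)]
  ring

lemma integrable_orderStatLaw {f : ℝ → ℝ}
    (hf : IntervalIntegrable (fun x => f x * (x ^ (k - 1) * (1 - x) ^ (n - k))) volume 0 1) :
    Integrable f (orderStatLaw k n) := by
  rw [orderStatLaw, integrable_withDensity_iff_integrable_smul' (by fun_prop) (by simp)]
  rw [intervalIntegrable_iff_integrableOn_Ioc_of_le zero_le_one] at hf
  refine (hf.const_mul (k * n.choose k : ℝ)).congr ?_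
  filter_upwards [ae_restrict_mem measurableSet_Ioc] with x hx
  have : 0 ≤ 1 - x := sub_nonneg.2 hx.2
  have := hx.1.le
  simp only [smul_eq_mul]
  rw [ENNReal.toReal_ofReal (by positivity)]
  ring

lemma integral_log_orderStatLaw (hk : 1 ≤ k) (hkn : k ≤ n) :
    Integrable Real.log (orderStatLaw k n) ∧
      ∫ x, Real.log x ∂orderStatLaw k n = psi k - psi ((n : ℝ) + 1) := by
  refine ⟨integrable_orderStatLaw (intervalIntegrable_log_mul_pow _ _), ?_⟩
  rw [integral_orderStatLaw, integral_log_mul_pow_mul_one_sub_pow,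
    show k - 1 + (n - k) + 1 = n by omega, show k - 1 + 1 = k by omega,
    show k - 1 + (n - k) + 2 = n + 1 by omega]
  have h1 := psi_sub_psi hk hkn
  have h2 := orderStat_factorial hk hkn
  rw [← h1]
  linear_combination (psi k - psi ((n : ℝ) + 1)) * h2

lemma integral_pow_orderStatLaw (m : ℕ) (hk : 1 ≤ k) (hkn : k ≤ n) :
    Integrable (fun x => x ^ m) (orderStatLaw k n) ∧
      ∫ x, x ^ m ∂orderStatLaw k n
        = (k * n.choose k) * (((m + (k - 1)).factorial * (n - k).factorial : ℝ)
          / (m + n).factorial) := by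
  refine ⟨integrable_orderStatLaw (Continuous.intervalIntegrable (by fun_prop) _ _), ?_⟩
  rw [integral_orderStatLaw]
  simp_rw [← mul_assoc, ← pow_add]
  rw [integral_pow_mul_one_sub_pow, show m + (k - 1) + (n - k) + 1 = m + n by omega]

lemma orderStatLaw_univ (hk : 1 ≤ k) (hkn : k ≤ n) : orderStatLaw k n Set.univ = 1 := by
  have h := (integral_pow_orderStatLaw 0 hk hkn)
  have h2 := orderStat_factorial hk hkn
  simp only [pow_zero, zero_add] at h
  rw [h2] at h
  have := (integrable_const_iff (c := (1 : ℝ))).1 h.1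
  simp only [one_ne_zero, false_or] at this
  rw [integral_const, smul_eq_mul, mul_one] at h
  rw [← ENNReal.toReal_eq_one_iff]
  exact h.2

lemma integral_id_orderStatLaw (hk : 1 ≤ k) (hkn : k ≤ n) :
    ∫ x, x ^ 1 ∂orderStatLaw k n = k / (n + 1) := by
  rw [(integral_pow_orderStatLaw 1 hk hkn).2]
  have h2 := orderStat_factorial hk hkn
  obtain ⟨m, rfl⟩ := Nat.exists_eq_add_of_le' hk
  simp only [Nat.add_sub_cancel] at h2 ⊢
  rw [add_comm 1 m, add_comm 1 n, Nat.factorial_succ, Nat.factorial_succ]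
  have : (n.factorial : ℝ) ≠ 0 := by positivity
  push_cast at h2 ⊢
  field_simp at h2 ⊢
  linear_combination h2

lemma integral_sq_orderStatLaw (hk : 1 ≤ k) (hkn : k ≤ n) :
    ∫ x, x ^ 2 ∂orderStatLaw k n = k * (k + 1) / ((n + 1) * (n + 2)) := by
  rw [(integral_pow_orderStatLaw 2 hk hkn).2]
  have h2 := orderStat_factorial hk hkn
  obtain ⟨m, rfl⟩ := Nat.exists_eq_add_of_le' hk
  simp only [Nat.add_sub_cancel] at h2 ⊢
  rw [add_comm 2 m, add_comm 2 n, Nat.factorial_succ, Nat.factorial_succ, Nat.factorial_succ,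
    Nat.factorial_succ]
  have : (n.factorial : ℝ) ≠ 0 := by positivity
  calc _ = ((m + 1 : ℕ) : ℝ) * (n.choose (m + 1))
          * ((m.factorial * (n - (m + 1)).factorial : ℝ) / n.factorial)
        * (((m + 1 : ℕ) : ℝ) * (((m + 1 : ℕ) : ℝ) + 1) / (((n : ℝ) + 1) * (n + 2))) := by
        push_cast
        field_simp
        ring
    _ = _ := by rw [h2, one_mul]

lemma orderStatLaw_self_Iic (hk : 1 ≤ k) {x : ℝ} (hx : x ∈ Set.Icc (0 : ℝ) 1) :
    orderStatLaw k k (Set.Iic x) = ENNReal.ofReal (x ^ k) := by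
  rw [orderStatLaw, withDensity_apply _ measurableSet_Iic, Measure.restrict_restrict measurableSet_Iic,
    show Set.Iic x ∩ Set.Ioc 0 1 = Set.Ioc 0 x by
      ext y; simp only [Set.mem_inter_iff, Set.mem_Iic, Set.mem_Ioc]
      exact ⟨fun h => ⟨h.2.1, h.1⟩, fun h => ⟨h.2, h.1, h.2.trans hx.2⟩⟩]
  simp only [Nat.choose_self, Nat.cast_one, mul_one, Nat.sub_self, pow_zero]
  rw [← ofReal_integral_eq_lintegral_ofReal, ← intervalIntegral.integral_of_le hx.1,
    intervalIntegral.integral_const_mul, integral_pow]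
  · obtain ⟨m, rfl⟩ := Nat.exists_eq_add_of_le' hk
    congr 1
    simp only [Nat.add_sub_cancel]
    push_cast
    field_simp
    simp
  · exact (Continuous.integrableOn_Ioc (by fun_prop))
  · filter_upwards [ae_restrict_mem measurableSet_Ioc] with y hy
    have := hy.1.le
    positivity

/-- A probability measure with distribution function `x ^ k` on `[0, 1]`. -/
lemma eq_orderStatLaw_self (hk : 1 ≤ k) (ν : Measure ℝ) [IsProbabilityMeasure ν]
    (h : ∀ x ∈ Set.Ico (0 : ℝ) 1, ν (Set.Iic x) = ENNReal.ofReal (x ^ k))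
    (h1 : ν (Set.Iic 1) = 1) :
    ν = orderStatLaw k k := by
  have : IsProbabilityMeasure (orderStatLaw k k) := ⟨orderStatLaw_univ hk le_rfl⟩
  refine Measure.ext_of_Iic _ _ fun x => ?_
  have hs : ∀ y ∈ Set.Icc (0 : ℝ) 1, ν (Set.Iic y) = orderStatLaw k k (Set.Iic y) := by
    intro y hy
    rw [orderStatLaw_self_Iic hk hy]
    rcases hy.2.eq_or_lt with rfl | hlt
    · simp [h1]
    · exact h y ⟨hy.1, hlt⟩
  rcases lt_or_ge x 0 with hx | hx
  · have hz := hs 0 ⟨le_rfl, zero_le_one⟩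
    have hz' := orderStatLaw_self_Iic hk (x := 0) ⟨le_rfl, zero_le_one⟩
    rw [zero_pow (by omega), ENNReal.ofReal_zero] at hz'
    rw [measure_mono_null (Set.Iic_subset_Iic.2 hx.le) hz',
      measure_mono_null (Set.Iic_subset_Iic.2 hx.le) (hz.trans hz')]
  · rcases le_or_gt x 1 with hx1 | hx1
    · exact hs x ⟨hx, hx1⟩
    · have e1 : (1 : ℝ≥0∞) ≤ ν (Set.Iic x) := h1 ▸ measure_mono (Set.Iic_subset_Iic.2 hx1.le)
      have e2 : (1 : ℝ≥0∞) ≤ orderStatLaw k k (Set.Iic x) := by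
        rw [← h1, hs 1 ⟨zero_le_one, le_rfl⟩]
        exact measure_mono (Set.Iic_subset_Iic.2 hx1.le)
      rw [le_antisymm prob_le_one e1, le_antisymm prob_le_one e2]

end BetaIntegral

/-! ### Measurability of neighbours and cells -/

section Measurability

variable {Ω ι : Type*} [MeasurableSpace Ω] {d : ℕ} {X : Ω → ι → Vec d} {Z : Ω → Vec d}

lemma measurableSet_mem_nearest (k : ℕ) (J : Finset ι) (hX : Measurable X) (hZ : Measurable Z)
    (l : ι) : MeasurableSet {ω | l ∈ nearest k J (X ω) (Z ω)} := by
  have hlt : ∀ m, MeasurableSet {ω | dist (X ω m) (Z ω) < dist (X ω l) (Z ω)} := fun m =>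
    measurableSet_lt (((measurable_pi_apply m).comp hX).dist hZ)
      (((measurable_pi_apply l).comp hX).dist hZ)
  have hcard : Measurable fun ω =>
      (J.filter fun m => dist (X ω m) (Z ω) < dist (X ω l) (Z ω)).card := by
    simp_rw [Finset.card_filter]
    exact Finset.measurable_sum _ fun m _ => Measurable.ite (hlt m) measurable_const measurable_const
  have : {ω | l ∈ nearest k J (X ω) (Z ω)} = {_ω | l ∈ J} ∩
      {ω | (J.filter fun m => dist (X ω m) (Z ω) < dist (X ω l) (Z ω)).card < k} := by
    ext ω
    simp [mem_nearest]
  rw [this]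
  exact (MeasurableSet.const _).inter (measurableSet_lt hcard measurable_const)

lemma measurable_finset_sup (J : Finset ι) {g : ι → Ω → ℝ≥0} (hg : ∀ l, Measurable (g l)) :
    Measurable fun ω => J.sup fun l => g l ω := by
  classical
  induction J using Finset.induction_on with
  | empty => simp
  | insert a s _ ih =>
    simp only [Finset.sup_insert]
    exact (hg a).sup ih

lemma measurable_sup_nearest (k : ℕ) (J : Finset ι) (hX : Measurable X) (hZ : Measurable Z)
    {f : ι → Ω → ℝ≥0} (hf : ∀ l, Measurable (f l)) :
    Measurable fun ω => (nearest k J (X ω) (Z ω)).sup fun l => f l ω := by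
  classical
  have : (fun ω => (nearest k J (X ω) (Z ω)).sup fun l => f l ω)
      = fun ω => J.sup fun l => if l ∈ nearest k J (X ω) (Z ω) then f l ω else 0 := by
    ext ω
    congr 1
    refine le_antisymm (Finset.sup_le fun l hl => ?_) (Finset.sup_le fun l hl => ?_)
    · have := Finset.le_sup (f := fun l => if l ∈ nearest k J (X ω) (Z ω) then f l ω else 0)
        (mem_nearest.1 hl).1
      simpa [hl] using this
    · split_ifs with h
      · exact Finset.le_sup (f := fun l => f l ω) h
      · exact zero_le
  rw [this]
  exact measurable_finset_sup J fun l =>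
    Measurable.ite (measurableSet_mem_nearest k J hX hZ l) (hf l) measurable_const

lemma measurable_knnRadius (k : ℕ) (J : Finset ι) (hX : Measurable X) (hZ : Measurable Z) :
    Measurable fun ω => knnRadius k J (X ω) (Z ω) :=
  measurable_sup_nearest k J hX hZ fun l => ((measurable_pi_apply l).comp hX).nndist hZ

lemma measurable_halfWidth (k : ℕ) (J : Finset ι) (hX : Measurable X) (hZ : Measurable Z)
    (j : Fin d) : Measurable fun ω => halfWidth k J (X ω) (Z ω) j :=
  measurable_sup_nearest k J hX hZ fun l =>
    (((measurable_pi_apply j).comp ((measurable_pi_apply l).comp hX)).sub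
      ((measurable_pi_apply j).comp hZ)).nnnorm

lemma measurable_logCell (k : ℕ) (J : Finset ι) (hX : Measurable X) (hZ : Measurable Z) :
    Measurable fun ω => logCell k J (X ω) (Z ω) := by
  refine Finset.measurable_sum _ fun j _ => Real.measurable_log.comp ?_
  have h1 : Measurable fun ω => Z ω j := (measurable_pi_apply j).comp hZ
  have h2 : Measurable fun ω => (halfWidth k J (X ω) (Z ω) j : ℝ) :=
    (measurable_halfWidth k J hX hZ j).coe_nnreal_real
  exact ((h1.add h2).min measurable_const).sub ((h1.sub h2).max measurable_const)

end Measurability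

/-! ### Geometry of the unit cube -/

section Cube

variable {d : ℕ}

lemma openCube_eq_pi (d : ℕ) : openCube d = Set.univ.pi fun _ => Set.Ioo (0 : ℝ) 1 := by
  ext z; simp [openCube]

lemma isOpen_openCube (d : ℕ) : IsOpen (openCube d) := by
  rw [openCube_eq_pi]
  exact isOpen_set_pi Set.finite_univ fun _ _ => isOpen_Ioo

lemma measurableSet_openCube (d : ℕ) : MeasurableSet (openCube d) :=
  (isOpen_openCube d).measurableSet

lemma convex_openCube (d : ℕ) : Convex ℝ (openCube d) := by
  rw [openCube_eq_pi]
  exact convex_pi fun _ _ => convex_Ioo 0 1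

lemma volume_openCube (d : ℕ) : volume (openCube d) = 1 := by
  rw [openCube_eq_pi, volume_pi_pi]
  simp

instance isProbabilityMeasure_restrict_openCube (d : ℕ) :
    IsProbabilityMeasure (volume.restrict (openCube d)) :=
  ⟨by rw [Measure.restrict_apply_univ, volume_openCube]⟩

lemma abs_sub_lt_one_of_mem_openCube {z w : Vec d} (hz : z ∈ openCube d) (hw : w ∈ openCube d)
    (j : Fin d) : |w j - z j| < 1 := by
  have := hz j
  have := hw j
  rw [abs_lt]
  constructor <;> linarith

lemma dist_le_one_of_mem_openCube {z w : Vec d} (hz : z ∈ openCube d) (hw : w ∈ openCube d) :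
    dist w z ≤ 1 :=
  (dist_pi_le_iff zero_le_one).2 fun j => by
    rw [Real.dist_eq]
    exact (abs_sub_lt_one_of_mem_openCube hz hw j).le

/-- Along each axis the window of radius `t ≤ 1` keeps length at least `t` inside the unit interval,
however close `z` is to a face. This is why the bound is `t ^ d` and not `(2 * t) ^ d`. -/
lemma le_volume_closedBall_inter_openCube {z : Vec d} (hz : z ∈ openCube d) {t : ℝ}
    (ht0 : 0 ≤ t) (ht1 : t ≤ 1) :
    ENNReal.ofReal (t ^ d) ≤ volume (Metric.closedBall z t ∩ openCube d) := by
  have hsub : (Set.univ.pi fun j => Set.Ioo (max (z j - t) 0) (min (z j + t) 1))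
      ⊆ Metric.closedBall z t ∩ openCube d := by
    intro w hw
    simp only [Set.mem_pi, Set.mem_univ, true_implies, Set.mem_Ioo, max_lt_iff, lt_min_iff] at hw
    refine ⟨(dist_pi_le_iff ht0).2 fun j => ?_, fun j => ⟨(hw j).1.2, (hw j).2.2⟩⟩
    rw [Real.dist_eq, abs_le]
    constructor <;> linarith [(hw j).1.1, (hw j).2.1]
  refine le_trans ?_ (measure_mono hsub)
  rw [volume_pi_pi]
  simp only [Real.volume_Ioo]
  calc ENNReal.ofReal (t ^ d) = ∏ _j : Fin d, ENNReal.ofReal t := by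
        rw [Finset.prod_const, Finset.card_univ, Fintype.card_fin, ENNReal.ofReal_pow ht0]
    _ ≤ _ := by
        refine Finset.prod_le_prod' fun j _ => ENNReal.ofReal_le_ofReal ?_
        have := hz j
        rcases min_cases (z j + t) 1 with h | h <;> rcases max_cases (z j - t) 0 with h' | h' <;>
          rw [h.1, h'.1] <;> linarith

end Cube

/-! ### Nearly uniform laws on the cube -/

/-- `μ` has a `c`-Lipschitz density `q` on the open unit cube with values in `[1 - c, 1 + c]`. -/
structure NearUniform {d : ℕ} (c : ℝ) (q : Vec d → ℝ) (μ : Measure (Vec d)) : Prop where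
  nonneg : 0 ≤ c
  lt_one : c < 1
  measurable : Measurable q
  isProb : IsProbabilityMeasure μ
  eq_withDensity : μ = (volume.restrict (openCube d)).withDensity fun z => ENNReal.ofReal (q z)
  lipschitz : ∀ z ∈ openCube d, ∀ w ∈ openCube d, |q z - q w| ≤ c * dist z w
  lower : ∀ z ∈ openCube d, 1 - c ≤ q z
  upper : ∀ z ∈ openCube d, q z ≤ 1 + c

namespace NearUniform

variable {d : ℕ} {c : ℝ} {q : Vec d → ℝ} {μ : Measure (Vec d)} (h : NearUniform c q μ)
include h

lemma apply {s : Set (Vec d)} (hs : MeasurableSet s) :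
    μ s = ∫⁻ z in s ∩ openCube d, ENNReal.ofReal (q z) := by
  rw [h.eq_withDensity, withDensity_apply _ hs, Measure.restrict_restrict hs]

lemma le_apply {s : Set (Vec d)} (hs : MeasurableSet s) {a : ℝ}
    (ha : ∀ z ∈ s ∩ openCube d, a ≤ q z) :
    ENNReal.ofReal a * volume (s ∩ openCube d) ≤ μ s := by
  rw [h.apply hs, ← setLIntegral_const]
  exact setLIntegral_mono' (hs.inter (measurableSet_openCube d)) fun z hz =>
    ENNReal.ofReal_le_ofReal (ha z hz)

lemma apply_le {s : Set (Vec d)} (hs : MeasurableSet s) {a : ℝ}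
    (ha : ∀ z ∈ s ∩ openCube d, q z ≤ a) :
    μ s ≤ ENNReal.ofReal a * volume (s ∩ openCube d) := by
  rw [h.apply hs, ← setLIntegral_const]
  exact setLIntegral_mono' (hs.inter (measurableSet_openCube d)) fun z hz =>
    ENNReal.ofReal_le_ofReal (ha z hz)

lemma upper_two {z : Vec d} (hz : z ∈ openCube d) : q z ≤ 2 := by
  linarith [h.upper z hz, h.lt_one]

lemma pos {z : Vec d} (hz : z ∈ openCube d) : 0 < q z := by
  linarith [h.lower z hz, h.lt_one]

lemma le_two_smul : μ ≤ (2 : ℝ≥0∞) • volume.restrict (openCube d) := by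
  refine Measure.le_intro fun s hs _ => ?_
  refine (h.apply_le hs fun z hz => h.upper_two hz.2).trans ?_
  simp [Measure.restrict_apply hs]

lemma absolutelyContinuous : μ ≪ volume :=
  (Measure.absolutelyContinuous_of_le_smul h.le_two_smul).trans
    Measure.restrict_le_self.absolutelyContinuous

lemma ae_mem : ∀ᵐ z ∂μ, z ∈ openCube d :=
  (Measure.absolutelyContinuous_of_le_smul h.le_two_smul).ae_le
    (ae_restrict_mem (measurableSet_openCube d))

lemma lintegral_le (f : Vec d → ℝ≥0∞) :
    ∫⁻ z, f z ∂μ ≤ 2 * ∫⁻ z in openCube d, f z := by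
  refine (lintegral_mono' h.le_two_smul le_rfl).trans ?_
  rw [lintegral_smul_measure, smul_eq_mul]

end NearUniform

/-! ### The mass of balls and its uniform distribution -/

/-- The mass of the closed ball of radius `t`. -/
def ballMass {d : ℕ} (μ : Measure (Vec d)) (z : Vec d) (t : ℝ) : ℝ := μ.real (Metric.closedBall z t)

section BallMass

variable {d : ℕ} {c : ℝ} {q : Vec d → ℝ} {μ : Measure (Vec d)} {z : Vec d}

lemma ballMass_mono (μ : Measure (Vec d)) [IsFiniteMeasure μ] (z : Vec d) :
    Monotone (ballMass μ z) := fun _ _ h =>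
  measureReal_mono (Metric.closedBall_subset_closedBall h)

lemma ballMass_nonneg (t : ℝ) : 0 ≤ ballMass μ z t := measureReal_nonneg

lemma ballMass_le_one [IsProbabilityMeasure μ] (t : ℝ) : ballMass μ z t ≤ 1 := measureReal_le_one

lemma measure_compl_closedBall [IsProbabilityMeasure μ] (t : ℝ) :
    μ (Metric.closedBall z t)ᶜ = ENNReal.ofReal (1 - ballMass μ z t) := by
  rw [ballMass, ← probReal_compl_eq_one_sub Metric.isClosed_closedBall.measurableSet,
    ofReal_measureReal]

namespace NearUniform

lemma ballMass_one (h : NearUniform c q μ) (hz : z ∈ openCube d) : ballMass μ z 1 = 1 := by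
  have := h.isProb
  have h1 : μ (Metric.closedBall z 1) = 1 :=
    (prob_compl_eq_zero_iff Metric.isClosed_closedBall.measurableSet).1 <| by
      refine measure_eq_zero_iff_ae_notMem.2 ?_
      filter_upwards [h.ae_mem] with w hw hw'
      exact hw' (dist_le_one_of_mem_openCube hz hw)
  simp [ballMass, measureReal_def, h1]

lemma ballMass_zero (h : NearUniform c q μ) (hd : 1 ≤ d) : ballMass μ z 0 = 0 := by
  have : NeZero d := ⟨by omega⟩
  have h1 : μ {z} = 0 := h.absolutelyContinuous (measure_singleton z)
  simp [ballMass, measureReal_def, h1]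

lemma pow_le_ballMass (h : NearUniform c q μ) (hz : z ∈ openCube d) {t : ℝ} (ht0 : 0 ≤ t)
    (ht1 : t ≤ 1) : (1 - c) * t ^ d ≤ ballMass μ z t := by
  have := h.isProb
  have h1 := h.le_apply (s := Metric.closedBall z t) Metric.isClosed_closedBall.measurableSet
    fun w hw => h.lower w hw.2
  have h2 := le_volume_closedBall_inter_openCube hz ht0 ht1
  rw [ballMass, measureReal_def, ← ENNReal.ofReal_le_iff_le_toReal (measure_ne_top _ _),
    ENNReal.ofReal_mul (by linarith [h.lt_one])]
  exact le_trans (by gcongr) h1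

/-- On a ball contained in the cube the density differs from its central value by at most `c * t`,
and no volume is lost to truncation. -/
lemma abs_ballMass_sub_le (h : NearUniform c q μ) {t : ℝ} (ht0 : 0 ≤ t)
    (hzt : Metric.closedBall z t ⊆ openCube d) :
    |ballMass μ z t - q z * (2 * t) ^ d| ≤ c * t * (2 * t) ^ d := by
  have := h.isProb
  have hz : z ∈ openCube d := hzt (Metric.mem_closedBall_self ht0)
  have hm : MeasurableSet (Metric.closedBall z t) := Metric.isClosed_closedBall.measurableSet
  have hV : 0 ≤ (2 * t) ^ d := by positivity
  have hl : ∀ w ∈ Metric.closedBall z t ∩ openCube d, |q w - q z| ≤ c * t := fun w hw =>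
    (h.lipschitz w hw.2 z hz).trans (mul_le_mul_of_nonneg_left hw.1 h.nonneg)
  have h1 := h.le_apply hm (a := q z - c * t) fun w hw => by
    linarith [(abs_le.1 (hl w hw)).1]
  have h2 := h.apply_le hm (a := q z + c * t) fun w hw => by
    linarith [(abs_le.1 (hl w hw)).2]
  rw [Set.inter_eq_left.2 hzt, Real.volume_pi_closedBall _ ht0, Fintype.card_fin,
    ← ENNReal.ofReal_mul' hV] at h1 h2
  have h3 := (ENNReal.ofReal_le_iff_le_toReal (measure_ne_top _ _)).1 h1
  have h4 := ENNReal.toReal_le_of_le_ofReal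
    (mul_nonneg (by nlinarith [h.pos hz, h.nonneg]) hV) h2
  rw [ballMass, measureReal_def, abs_le]
  constructor <;> linarith

lemma abs_ballMass_sub_ballMass_le (h : NearUniform c q μ) {s t : ℝ} (hs : 0 ≤ s) (hst : s ≤ t) :
    |ballMass μ z t - ballMass μ z s| ≤ 2 * ((2 * t) ^ d - (2 * s) ^ d) := by
  have := h.isProb
  have hsub := Metric.closedBall_subset_closedBall (x := z) hst
  have hm : MeasurableSet (Metric.closedBall z s) := Metric.isClosed_closedBall.measurableSet
  have hm' : MeasurableSet (Metric.closedBall z t) := Metric.isClosed_closedBall.measurableSet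
  have hpow : (2 * s) ^ d ≤ (2 * t) ^ d := by gcongr
  rw [abs_of_nonneg (sub_nonneg.2 (ballMass_mono μ z hst)), ballMass, ballMass,
    ← measureReal_sdiff hsub hm, measureReal_def]
  refine ENNReal.toReal_le_of_le_ofReal (by linarith) ?_
  refine (h.apply_le (hm'.diff hm) fun w hw => h.upper_two hw.2).trans ?_
  rw [ENNReal.ofReal_mul zero_le_two]
  gcongr
  refine (measure_mono Set.inter_subset_left).trans ?_
  rw [measure_sdiff hsub hm.nullMeasurableSet (by rw [Real.volume_pi_closedBall _ hs]; simp),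
    Real.volume_pi_closedBall _ hs, Real.volume_pi_closedBall _ (hs.trans hst),
    ENNReal.ofReal_sub _ (by positivity), Fintype.card_fin]

/-- Continuity of the mass in the radius is what the probability integral transform below needs:
every level in `[0, 1)` is attained. -/
lemma continuousOn_ballMass (h : NearUniform c q μ) :
    ContinuousOn (ballMass μ z) (Set.Ici 0) := by
  have hb : ∀ s ∈ Set.Ici (0 : ℝ), ∀ t ∈ Set.Ici (0 : ℝ),
      |ballMass μ z t - ballMass μ z s| ≤ 2 * |(2 * t) ^ d - (2 * s) ^ d| := by
    intro s hs t ht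
    rcases le_total s t with hst | hst
    · exact (h.abs_ballMass_sub_ballMass_le hs hst).trans
        (mul_le_mul_of_nonneg_left (le_abs_self _) zero_le_two)
    · rw [abs_sub_comm, abs_sub_comm ((2 * t) ^ d)]
      exact (h.abs_ballMass_sub_ballMass_le ht hst).trans
        (mul_le_mul_of_nonneg_left (le_abs_self _) zero_le_two)
  intro s hs
  rw [ContinuousWithinAt, tendsto_iff_dist_tendsto_zero]
  have hg : Tendsto (fun t : ℝ => 2 * |(2 * t) ^ d - (2 * s) ^ d|) (𝓝[Set.Ici 0] s) (𝓝 0) := by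
    have : Continuous fun t : ℝ => 2 * |(2 * t) ^ d - (2 * s) ^ d| := by fun_prop
    simpa using (this.tendsto s).mono_left nhdsWithin_le_nhds
  refine squeeze_zero' (Eventually.of_forall fun _ => dist_nonneg) ?_ hg
  filter_upwards [self_mem_nhdsWithin] with t ht
  rw [Real.dist_eq]
  exact hb s hs t ht

/-- The mass of the ball reaching the farthest of independent points is distributed like the
maximum of independent uniform variables. -/
lemma map_ballMass_dist {ι : Type*} [Fintype ι] [Nonempty ι] (h : NearUniform c q μ) (hd : 1 ≤ d)
    (hz : z ∈ openCube d) :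
    (Measure.pi fun _ : ι => μ).map (fun u => ballMass μ z (dist u fun _ => z))
      = orderStatLaw (Fintype.card ι) (Fintype.card ι) := by
  have := h.isProb
  have hmeas : Measurable fun u : ι → Vec d => ballMass μ z (dist u fun _ => z) :=
    (ballMass_mono μ z).measurable.comp (by fun_prop)
  have hP : IsProbabilityMeasure
      ((Measure.pi fun _ : ι => μ).map (fun u => ballMass μ z (dist u fun _ => z))) :=
    Measure.isProbabilityMeasure_map hmeas.aemeasurable
  refine eq_orderStatLaw_self Fintype.card_pos _ (fun x hx => ?_) ?_
  · rw [Measure.map_apply hmeas measurableSet_Iic]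
    -- The quantile is the largest radius in `[0, 1]` whose ball has mass at most `x`. With this
    -- choice no strict monotonicity of the mass is needed, and the event becomes that all points
    -- lie in one fixed closed ball.
    have hclosed : IsCompact {t | t ∈ Set.Icc (0 : ℝ) 1 ∧ ballMass μ z t ≤ x} := by
      refine isCompact_Icc.of_isClosed_subset ?_ fun t ht => ht.1
      exact ((h.continuousOn_ballMass (z := z)).mono
        Set.Icc_subset_Ici_self).preimage_isClosed_of_isClosed isClosed_Icc isClosed_Iic
    obtain ⟨t, ⟨ht, htx⟩, hmax⟩ := hclosed.exists_isGreatest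
      ⟨0, ⟨le_rfl, zero_le_one⟩, (h.ballMass_zero hd).trans_le hx.1⟩
    -- If the mass at `t` were below `x`, the intermediate value theorem would produce an admissible
    -- radius beyond the largest one.
    have hFt : ballMass μ z t = x := by
      refine htx.eq_of_not_lt fun hlt => ?_
      obtain ⟨s, hs, hsx⟩ := intermediate_value_Icc ht.2
        ((h.continuousOn_ballMass (z := z)).mono fun s hs => ht.1.trans hs.1)
        ⟨htx, hx.2.le.trans (h.ballMass_one hz).ge⟩
      have := hmax ⟨⟨ht.1.trans hs.1, hs.2⟩, hsx.le⟩
      exact absurd hsx ((ballMass_mono μ z this).trans_lt hlt).ne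
    have hset : (fun u : ι → Vec d => ballMass μ z (dist u fun _ => z)) ⁻¹' Set.Iic x
        = Set.univ.pi fun _ => Metric.closedBall z t := by
      ext u
      simp only [Set.mem_preimage, Set.mem_Iic, Set.mem_pi, Set.mem_univ, true_implies,
        Metric.mem_closedBall]
      rw [← dist_pi_le_iff ht.1 (g := fun _ => z)]
      constructor
      · intro hu
        refine hmax ⟨⟨dist_nonneg, ?_⟩, hu⟩
        by_contra! hlt
        have := ballMass_mono μ z hlt.le
        rw [h.ballMass_one hz] at this
        linarith [hx.2]
      · intro hu
        exact (ballMass_mono μ z hu).trans htx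
    rw [hset, Measure.pi_pi, Finset.prod_const, Finset.card_univ, ← hFt, ballMass,
      ENNReal.ofReal_pow measureReal_nonneg, ofReal_measureReal]
  · rw [Measure.map_apply hmeas measurableSet_Iic]
    have : (fun u : ι → Vec d => ballMass μ z (dist u fun _ => z)) ⁻¹' Set.Iic 1 = Set.univ :=
      Set.eq_univ_of_forall fun u => ballMass_le_one _
    rw [this, measure_univ]

end NearUniform

end BallMass

/-! ### The law of the mass within the neighbour distance -/

section Separated

variable {ι : Type*} [Fintype ι] {d k : ℕ} {z : Vec d} {A : Finset ι} {y : ι → Vec d}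

lemma nearest_of_separated (hA : A.card = k) (hy : y ∈ separated z A) :
    nearest k Finset.univ y z = A :=
  nearest_eq_of_separated (Finset.subset_univ A) hA fun l _ => hy l

lemma knnRadius_of_separated (hA : A.card = k) (hy : y ∈ separated z A) :
    (knnRadius k Finset.univ y z : ℝ) = dist (fun a : A => y a) fun _ => z := by
  rw [knnRadius, nearest_of_separated hA hy, dist_nndist, nndist_pi_def, ← Finset.sup_attach]
  rfl

lemma halfWidth_of_separated (hA : A.card = k) (hy : y ∈ separated z A) (j : Fin d) :
    (halfWidth k Finset.univ y z j : ℝ) = ‖fun a : A => y a j - z j‖ := by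
  rw [halfWidth, nearest_of_separated hA hy, ← coe_nnnorm, Pi.nnnorm_def, ← Finset.sup_attach]
  rfl

lemma pairwiseDisjoint_separated (k : ℕ) (z : Vec d) :
    Set.PairwiseDisjoint (↑(Finset.univ.powersetCard k : Finset (Finset ι)) : Set (Finset ι))
      (separated z) := by
  intro A hA B hB hne
  refine Set.disjoint_left.2 fun y hyA hyB => hne ?_
  rw [← nearest_of_separated (Finset.mem_powersetCard_univ.1 hA) hyA,
    nearest_of_separated (Finset.mem_powersetCard_univ.1 hB) hyB]

/-- The maximum of `k` uniform variables has density `k x^(k-1)`. Weighting it with the chance that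
the other `n - k` variables exceed `x`, and with the number of choices of the `k` smallest, gives
the order statistic density. -/
lemma lintegral_orderStatLaw_self {n : ℕ} (f : ℝ → ℝ≥0∞) :
    n.choose k * ∫⁻ x, f x * ENNReal.ofReal (1 - x) ^ (n - k) ∂orderStatLaw k k
      = ∫⁻ x, f x ∂orderStatLaw k n := by
  rw [orderStatLaw, orderStatLaw, lintegral_withDensity_eq_lintegral_mul_non_measurable _
    (by fun_prop) (Eventually.of_forall fun _ => ENNReal.ofReal_lt_top),
    lintegral_withDensity_eq_lintegral_mul_non_measurable _
    (by fun_prop) (Eventually.of_forall fun _ => ENNReal.ofReal_lt_top), ← lintegral_const_mul' _ _ (by simp)]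
  refine setLIntegral_congr_fun measurableSet_Ioc fun x hx => ?_
  have h0 := hx.1.le
  have h1 : 0 ≤ 1 - x := sub_nonneg.2 hx.2
  simp only [Nat.choose_self, Nat.cast_one, mul_one, Nat.sub_self, pow_zero, Pi.mul_apply]
  rw [← ENNReal.ofReal_pow h1, ← ENNReal.ofReal_natCast (n.choose k)]
  calc _ = ENNReal.ofReal (n.choose k) * ENNReal.ofReal (k * x ^ (k - 1))
        * ENNReal.ofReal ((1 - x) ^ (n - k)) * f x := by ring
    _ = ENNReal.ofReal (k * n.choose k * (x ^ (k - 1) * (1 - x) ^ (n - k))) * f x := by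
        rw [← ENNReal.ofReal_mul (by positivity), ← ENNReal.ofReal_mul (by positivity)]
        congr 2
        ring

variable {c : ℝ} {q : Vec d → ℝ} {μ : Measure (Vec d)}

namespace NearUniform

lemma lintegral_separated_ballMass (h : NearUniform c q μ) (hd : 1 ≤ d) (hk : 1 ≤ k)
    (hz : z ∈ openCube d) (hA : A.card = k) {φ : ℝ → ℝ≥0∞} (hφ : Measurable φ) :
    ∫⁻ y in separated z A, φ (ballMass μ z (knnRadius k Finset.univ y z))
        ∂(Measure.pi fun _ : ι => μ)
      = ∫⁻ x, φ x * ENNReal.ofReal (1 - x) ^ (Fintype.card ι - k) ∂orderStatLaw k k := by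
  have := h.isProb
  have hne : A.Nonempty := Finset.card_pos.1 (by omega)
  have : Nonempty A := hne.to_subtype
  have hm : Measurable fun u : A → Vec d => ballMass μ z (dist u fun _ => z) :=
    (ballMass_mono μ z).measurable.comp (by fun_prop)
  rw [setLIntegral_congr_fun (g := fun y =>
    φ (ballMass μ z (dist (fun a : A => y a) fun _ => z))) (measurableSet_separated z A)
    fun y hy => by simp only [knnRadius_of_separated hA hy]]
  rw [lintegral_separated μ z A hne (Γ := fun u => φ (ballMass μ z (dist u fun _ => z)))
    (hφ.comp hm)]
  simp_rw [measure_compl_closedBall]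
  have hlaw := h.map_ballMass_dist (ι := A) hd hz
  rw [Fintype.card_coe, hA] at hlaw
  rw [← hlaw, lintegral_map (by fun_prop) hm, hA]

lemma sum_lintegral_separated_ballMass (h : NearUniform c q μ) (hd : 1 ≤ d) (hk : 1 ≤ k)
    (hz : z ∈ openCube d) {φ : ℝ → ℝ≥0∞} (hφ : Measurable φ) :
    ∑ A ∈ (Finset.univ.powersetCard k : Finset (Finset ι)),
      ∫⁻ y in separated z A, φ (ballMass μ z (knnRadius k Finset.univ y z))
        ∂(Measure.pi fun _ : ι => μ)
      = ∫⁻ x, φ x ∂orderStatLaw k (Fintype.card ι) := by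
  rw [Finset.sum_congr rfl fun A hA => h.lintegral_separated_ballMass hd hk hz
    (Finset.mem_powersetCard_univ.1 hA) hφ]
  rw [Finset.sum_const, Finset.card_powersetCard, Finset.card_univ, nsmul_eq_mul,
    lintegral_orderStatLaw_self]

variable (h : NearUniform c q μ) (hd : 1 ≤ d) (hk : 1 ≤ k) (hkn : k ≤ Fintype.card ι)
  (hz : z ∈ openCube d)
include h hd hk hkn hz

/-- Ties need no separate argument: the separation events are disjoint, and their probabilities add
up to the total mass of the order statistic law, which is 1. -/
lemma ae_exists_separated :
    ∀ᵐ y ∂(Measure.pi fun _ : ι => μ),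
      y ∈ ⋃ A ∈ (Finset.univ.powersetCard k : Finset (Finset ι)), separated z A := by
  have := h.isProb
  have h1 := h.sum_lintegral_separated_ballMass (ι := ι) hd hk hz (φ := fun _ => 1)
    measurable_const
  simp only [lintegral_const, one_mul, Measure.restrict_apply_univ,
    orderStatLaw_univ hk hkn] at h1
  rw [← measure_biUnion_finset (pairwiseDisjoint_separated k z)
    fun A _ => measurableSet_separated z A] at h1
  have hm : MeasurableSet (⋃ A ∈ (Finset.univ.powersetCard k : Finset (Finset ι)),
      separated z A) := Finset.measurableSet_biUnion _ fun A _ => measurableSet_separated z A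
  exact (prob_compl_eq_zero_iff hm).2 h1

lemma lintegral_eq_sum_separated (f : (ι → Vec d) → ℝ≥0∞) :
    ∫⁻ y, f y ∂(Measure.pi fun _ : ι => μ)
      = ∑ A ∈ (Finset.univ.powersetCard k : Finset (Finset ι)),
        ∫⁻ y in separated z A, f y ∂(Measure.pi fun _ : ι => μ) := by
  have hr := Measure.restrict_eq_self_of_ae_mem (h.ae_exists_separated (ι := ι) hd hk hkn hz)
  conv_lhs => rw [← hr]
  exact lintegral_biUnion_finset (pairwiseDisjoint_separated k z)
    (fun A _ => measurableSet_separated z A) f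

lemma integral_eq_sum_separated {f : (ι → Vec d) → ℝ}
    (hf : Integrable f (Measure.pi fun _ : ι => μ)) :
    ∫ y, f y ∂(Measure.pi fun _ : ι => μ)
      = ∑ A ∈ (Finset.univ.powersetCard k : Finset (Finset ι)),
        ∫ y in separated z A, f y ∂(Measure.pi fun _ : ι => μ) := by
  have hr := Measure.restrict_eq_self_of_ae_mem (h.ae_exists_separated (ι := ι) hd hk hkn hz)
  conv_lhs => rw [← hr]
  exact integral_biUnion_finset _ (fun A _ => measurableSet_separated z A)
    (pairwiseDisjoint_separated k z) fun A _ => hf.integrableOn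

lemma ae_card_nearest :
    ∀ᵐ y ∂(Measure.pi fun _ : ι => μ), (nearest k Finset.univ y z).card = k := by
  filter_upwards [h.ae_exists_separated (ι := ι) hd hk hkn hz] with y hy
  simp only [Set.mem_iUnion] at hy
  obtain ⟨A, hA, hy⟩ := hy
  have hA' := Finset.mem_powersetCard_univ.1 hA
  rw [nearest_of_separated hA' hy, hA']

/-- On the event that `A` is the nearest set, the mass is that of the ball reaching the farthest
point of `A`. Summing over the choices of `A` turns the law of a maximum into that of the `k`-th
order statistic. -/
lemma map_ballMass_knnRadius :
    (Measure.pi fun _ : ι => μ).map (fun y => ballMass μ z (knnRadius k Finset.univ y z))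
      = orderStatLaw k (Fintype.card ι) := by
  have := h.isProb
  have hm : Measurable fun y : ι → Vec d => ballMass μ z (knnRadius k Finset.univ y z) :=
    (ballMass_mono μ z).measurable.comp
      (measurable_knnRadius k _ measurable_id measurable_const).coe_nnreal_real
  ext s hs
  have h1 := h.sum_lintegral_separated_ballMass (ι := ι) hd hk hz (φ := s.indicator 1)
    (measurable_one.indicator hs)
  rw [← h.lintegral_eq_sum_separated (ι := ι) hd hk hkn hz] at h1
  rw [lintegral_indicator_one hs, ← lintegral_map (measurable_one.indicator hs) hm,
    lintegral_indicator_one hs] at h1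
  exact h1

/-- The source of the digamma terms of the estimator. Here `card ι` counts the points other than the
centre, so `card ι + 1` is the sample size. -/
lemma integral_log_ballMass :
    Integrable (fun y => Real.log (ballMass μ z (knnRadius k Finset.univ y z)))
      (Measure.pi fun _ : ι => μ) ∧
    ∫ y, Real.log (ballMass μ z (knnRadius k Finset.univ y z)) ∂(Measure.pi fun _ : ι => μ)
      = psi k - psi ((Fintype.card ι : ℝ) + 1) := by
  have := h.isProb
  have hm : Measurable fun y : ι → Vec d => ballMass μ z (knnRadius k Finset.univ y z) :=
    (ballMass_mono μ z).measurable.comp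
      (measurable_knnRadius k _ measurable_id measurable_const).coe_nnreal_real
  have hlaw := h.map_ballMass_knnRadius (ι := ι) hd hk hkn hz
  have h1 := integral_log_orderStatLaw hk hkn
  rw [← hlaw] at h1
  rw [integral_map hm.aemeasurable (by fun_prop)] at h1
  exact ⟨h1.1.comp_measurable hm, h1.2⟩

lemma integral_pow_ballMass (m : ℕ) :
    Integrable (fun y => ballMass μ z (knnRadius k Finset.univ y z) ^ m)
      (Measure.pi fun _ : ι => μ) ∧
    ∫ y, ballMass μ z (knnRadius k Finset.univ y z) ^ m ∂(Measure.pi fun _ : ι => μ)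
      = ∫ x, x ^ m ∂orderStatLaw k (Fintype.card ι) := by
  have := h.isProb
  have hm : Measurable fun y : ι → Vec d => ballMass μ z (knnRadius k Finset.univ y z) :=
    (ballMass_mono μ z).measurable.comp
      (measurable_knnRadius k _ measurable_id measurable_const).coe_nnreal_real
  have hlaw := h.map_ballMass_knnRadius (ι := ι) hd hk hkn hz
  have h1 := (integral_pow_orderStatLaw m hk hkn).1
  rw [← hlaw] at h1 ⊢
  refine ⟨h1.comp_measurable hm, ?_⟩
  rw [integral_map hm.aemeasurable (by fun_prop)]

end NearUniform

end Separated

/-! ### The mean log-ratio between cube and rectangle -/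

section LogRatio

lemma lintegral_exp_neg_mul {a : ℝ} (ha : 0 < a) :
    ∫⁻ s in Set.Ioi (0 : ℝ), ENNReal.ofReal (Real.exp (-a * s)) = ENNReal.ofReal (1 / a) := by
  rw [← ofReal_integral_eq_lintegral_ofReal (integrableOn_exp_mul_Ioi (neg_neg_of_pos ha) 0)
    (Eventually.of_forall fun _ => (Real.exp_pos _).le),
    integral_exp_mul_Ioi (neg_neg_of_pos ha) 0]
  simp

lemma ae_pos_of_measure_le {α : Type*} [MeasurableSpace α] {ν : Measure α} {R : α → ℝ} {V : ℝ≥0∞}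
    (hV : V ≠ ∞) {a t : ℝ} (ha : 0 < a) (ht : 0 < t)
    (hcdf : ∀ s, 0 ≤ s → ν {u | R u ≤ t * Real.exp (-s)} = V * ENNReal.ofReal (Real.exp (-a * s))) :
    ∀ᵐ u ∂ν, 0 < R u := by
  have hlim : Tendsto (fun s : ℝ => V * ENNReal.ofReal (Real.exp (-a * s))) atTop (𝓝 0) := by
    have h1 : Tendsto (fun s : ℝ => Real.exp (-a * s)) atTop (𝓝 0) :=
      Real.tendsto_exp_atBot.comp (tendsto_id.const_mul_atTop_of_neg (neg_neg_of_pos ha))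
    have h2 := ENNReal.tendsto_ofReal h1
    rw [ENNReal.ofReal_zero] at h2
    have h3 := ENNReal.Tendsto.const_mul (a := V) h2 (Or.inr hV)
    rwa [mul_zero] at h3
  rw [ae_iff]
  refine le_antisymm (ge_of_tendsto hlim ?_) zero_le
  filter_upwards [eventually_ge_atTop 0] with s hs
  rw [← hcdf s hs]
  exact measure_mono fun u hu => (not_lt.1 hu).trans (by positivity)

/-- The hypothesis says that `log (t / R)` is exponentially distributed with rate `a` and total mass
`V`; the layer-cake formula integrates its tail. -/
lemma lintegral_log_div_of_measure_le {α : Type*} [MeasurableSpace α] {ν : Measure α} {R : α → ℝ}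
    (hR : Measurable R) {V : ℝ≥0∞} (hV : V ≠ ∞) {a t : ℝ} (ha : 0 < a) (ht : 0 < t)
    (hRt : ∀ᵐ u ∂ν, R u ≤ t)
    (hcdf : ∀ s, 0 ≤ s → ν {u | R u ≤ t * Real.exp (-s)} = V * ENNReal.ofReal (Real.exp (-a * s))) :
    ∫⁻ u, ENNReal.ofReal (Real.log (t / R u)) ∂ν = V * ENNReal.ofReal (1 / a) := by
  have hpos := ae_pos_of_measure_le hV ha ht hcdf
  rw [lintegral_eq_lintegral_meas_le ν ?_ (by fun_prop), ← lintegral_exp_neg_mul ha,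
    ← lintegral_const_mul' _ _ hV]
  · refine setLIntegral_congr_fun measurableSet_Ioi fun s hs => ?_
    rw [← hcdf s (le_of_lt hs)]
    refine measure_congr ?_
    filter_upwards [hpos] with u hu
    refine propext ?_
    change s ≤ Real.log (t / R u) ↔ R u ≤ t * Real.exp (-s)
    rw [Real.le_log_iff_exp_le (by positivity), le_div_iff₀ hu, Real.exp_neg, ← div_eq_mul_inv,
      le_div_iff₀ (Real.exp_pos s), mul_comm]
  · filter_upwards [hpos, hRt] with u hu hut
    exact Real.log_nonneg ((one_le_div hu).2 hut)

variable {ι : Type*} [Fintype ι] {d : ℕ}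

/-- The largest offset along coordinate `j` of the points `u` from `z`. -/
def coordRadius (z : Vec d) (u : ι → Vec d) (j : Fin d) : ℝ := ‖fun a => u a j - z j‖

/-- The logarithmic ratio between the cube and the rectangle spanned by the points `u`. -/
def logRatio (z : Vec d) (u : ι → Vec d) : ℝ :=
  ∑ j, Real.log (dist u (fun _ => z) / coordRadius z u j)

lemma coordRadius_nonneg (z : Vec d) (u : ι → Vec d) (j : Fin d) : 0 ≤ coordRadius z u j :=
  norm_nonneg _

lemma measurable_coordRadius (z : Vec d) (j : Fin d) :
    Measurable fun u : ι → Vec d => coordRadius z u j := by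
  unfold coordRadius
  fun_prop

lemma measurable_logRatio (z : Vec d) : Measurable fun u : ι → Vec d => logRatio z u := by
  refine Finset.measurable_sum _ fun j _ => Real.measurable_log.comp ?_
  exact Measurable.div (by fun_prop) (measurable_coordRadius z j)

lemma coordRadius_le_dist (z : Vec d) (u : ι → Vec d) (j : Fin d) :
    coordRadius z u j ≤ dist u fun _ => z :=
  (pi_norm_le_iff_of_nonneg dist_nonneg).2 fun a =>
    ((dist_le_pi_dist (u a) z j).trans (dist_le_pi_dist u (fun _ => z) a))

lemma logRatio_nonneg (z : Vec d) (u : ι → Vec d) : 0 ≤ logRatio z u := by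
  refine Finset.sum_nonneg fun j _ => ?_
  rcases (coordRadius_nonneg z u j).eq_or_lt with h | h
  · simp [← h]
  · exact Real.log_nonneg ((one_le_div h).2 (coordRadius_le_dist z u j))

lemma volume_closedBall_pi (z : Vec d) {t : ℝ} (ht : 0 ≤ t) :
    volume (Metric.closedBall (fun _ : ι => z) t)
      = ENNReal.ofReal ((2 * t) ^ (Fintype.card ι * d)) := by
  rw [volume_pi_closedBall _ ht]
  simp only [Real.volume_pi_closedBall _ ht, Fintype.card_fin, Finset.prod_const, Finset.card_univ]
  rw [← ENNReal.ofReal_pow (by positivity), ← pow_mul, mul_comm d]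

/-- All coordinates of all points shrink by the factor `exp (-s)`, so the exponential rate is `card
ι * d`. -/
lemma volume_restrict_dist_le (z : Vec d) {t s : ℝ} (ht : 0 < t) (hs : 0 ≤ s) :
    volume.restrict (Metric.closedBall (fun _ : ι => z) t)
        {u | dist u (fun _ => z) ≤ t * Real.exp (-s)}
      = ENNReal.ofReal ((2 * t) ^ (Fintype.card ι * d))
        * ENNReal.ofReal (Real.exp (-(Fintype.card ι * d : ℝ) * s)) := by
  have hst : t * Real.exp (-s) ≤ t :=
    mul_le_of_le_one_right ht.le (Real.exp_le_one_iff.2 (by linarith))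
  have hset : {u : ι → Vec d | dist u (fun _ => z) ≤ t * Real.exp (-s)}
      = Metric.closedBall (fun _ : ι => z) (t * Real.exp (-s)) := rfl
  rw [hset, Measure.restrict_apply Metric.isClosed_closedBall.measurableSet,
    Set.inter_eq_left.2 (Metric.closedBall_subset_closedBall hst),
    volume_closedBall_pi z (by positivity), ← ENNReal.ofReal_mul (by positivity), ← mul_assoc,
    mul_pow, ← Real.exp_nat_mul]
  push_cast
  ring_nf

/-- Only the `j`-th coordinate of each point is constrained further, so the exponential rate is
`card ι`, without the factor `d`. -/
lemma volume_restrict_coordRadius_le (z : Vec d) (j : Fin d) {t s : ℝ} (ht : 0 < t) (hs : 0 ≤ s) :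
    volume.restrict (Metric.closedBall (fun _ : ι => z) t)
        {u | coordRadius z u j ≤ t * Real.exp (-s)}
      = ENNReal.ofReal ((2 * t) ^ (Fintype.card ι * d))
        * ENNReal.ofReal (Real.exp (-(Fintype.card ι : ℝ) * s)) := by
  have hst : t * Real.exp (-s) ≤ t :=
    mul_le_of_le_one_right ht.le (Real.exp_le_one_iff.2 (by linarith))
  have hs0 : 0 ≤ t * Real.exp (-s) := by positivity
  rw [Measure.restrict_apply (measurableSet_le (measurable_coordRadius z j) measurable_const)]
  have hset : {u : ι → Vec d | coordRadius z u j ≤ t * Real.exp (-s)}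
        ∩ Metric.closedBall (fun _ : ι => z) t
      = Set.univ.pi fun _ : ι => Set.univ.pi fun i : Fin d =>
          Metric.closedBall (z i) (if i = j then t * Real.exp (-s) else t) := by
    ext u
    simp only [Set.mem_inter_iff, Set.mem_ofPred_eq, Metric.mem_closedBall, Set.mem_pi,
      Set.mem_univ, true_implies, dist_pi_le_iff ht.le, coordRadius,
      pi_norm_le_iff_of_nonneg hs0]
    constructor
    · rintro ⟨h1, h2⟩ a i
      split_ifs with hij
      · subst hij
        exact h1 a
      · exact h2 a i
    · intro h
      refine ⟨fun a => by simpa [Real.dist_eq] using h a j, fun a i => (h a i).trans ?_⟩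
      split_ifs
      · exact hst
      · exact le_rfl
  rw [hset, volume_pi_pi]
  simp only [volume_pi_pi, Real.volume_closedBall, Finset.prod_const, Finset.card_univ]
  have hprod : ∏ i : Fin d, ENNReal.ofReal (2 * if i = j then t * Real.exp (-s) else t)
      = ENNReal.ofReal ((2 * t) ^ d * Real.exp (-s)) := by
    rw [← ENNReal.ofReal_prod_of_nonneg fun i _ => by split_ifs <;> positivity]
    congr 1
    have : ∀ i : Fin d, (2 * if i = j then t * Real.exp (-s) else t)
        = (2 * t) * if i = j then Real.exp (-s) else 1 := fun i => by split_ifs <;> ring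
    simp_rw [this]
    rw [Finset.prod_mul_distrib, Finset.prod_const, Finset.card_univ, Fintype.card_fin,
      Finset.prod_ite_eq' Finset.univ j, if_pos (Finset.mem_univ j)]
  rw [hprod, ← ENNReal.ofReal_pow (by positivity), ← ENNReal.ofReal_mul (by positivity), mul_pow,
    ← pow_mul, mul_comm d, ← Real.exp_nat_mul]
  ring_nf

variable [Nonempty ι]

/-- With `k = card ι`, the logarithm of `t` over a coordinate radius has mean `1/k`, and that of `t`
over the distance has mean `1/(k d)`. Summing the former over `d` coordinates and removing `d` times
the latter leaves `d/k - 1/k`. This accounts for the correction `(d - 1)/k` in the estimator. -/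
lemma lintegral_logRatio_closedBall (hd : 1 ≤ d) (z : Vec d) {t : ℝ} (ht : 0 ≤ t) :
    ∫⁻ u in Metric.closedBall (fun _ : ι => z) t, ENNReal.ofReal (logRatio z u)
      = ENNReal.ofReal (((d : ℝ) - 1) / Fintype.card ι)
        * volume (Metric.closedBall (fun _ : ι => z) t) := by
  have hk : 0 < (Fintype.card ι : ℝ) := by exact_mod_cast Fintype.card_pos
  have hd' : 0 < (d : ℝ) := by exact_mod_cast hd
  have hd1 : (0 : ℝ) ≤ (d : ℝ) - 1 := by
    have : (1 : ℝ) ≤ d := by exact_mod_cast hd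
    linarith
  rcases ht.eq_or_lt with rfl | ht
  · have h0 : volume (Metric.closedBall (fun _ : ι => z) 0) = 0 := by
      have : Fintype.card ι * d ≠ 0 := mul_ne_zero Fintype.card_ne_zero (by omega)
      rw [volume_closedBall_pi z le_rfl]
      simp [this]
    rw [Measure.restrict_eq_zero.2 h0, h0, lintegral_zero_measure, mul_zero]
  set ν := volume.restrict (Metric.closedBall (fun _ : ι => z) t)
  set V := ENNReal.ofReal ((2 * t) ^ (Fintype.card ι * d)) with hVdef
  have hV : V ≠ ∞ := ENNReal.ofReal_ne_top
  have hmem : ∀ᵐ u ∂ν, dist u (fun _ => z) ≤ t :=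
    ae_restrict_mem Metric.isClosed_closedBall.measurableSet
  have hD := lintegral_log_div_of_measure_le (ν := ν) (R := fun u => dist u fun _ => z)
    (by fun_prop) hV (mul_pos hk hd') ht hmem
    fun s hs => volume_restrict_dist_le z ht hs
  have hC := fun j => lintegral_log_div_of_measure_le (ν := ν) (measurable_coordRadius z j) hV hk ht
    (hmem.mono fun u hu => (coordRadius_le_dist z u j).trans hu)
    fun s hs => volume_restrict_coordRadius_le z j ht hs
  have hpos : ∀ᵐ u ∂ν, ∀ j, 0 < coordRadius z u j := ae_all_iff.2 fun j =>
    ae_pos_of_measure_le hV hk ht fun s hs => volume_restrict_coordRadius_le z j ht hs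
  -- The term to be removed is added on the other side, because subtraction in `ℝ≥0∞` truncates; it
  -- is finite and is cancelled at the end.
  have hsum : ∫⁻ u, (ENNReal.ofReal (logRatio z u)
        + d * ENNReal.ofReal (Real.log (t / dist u fun _ => z))) ∂ν
      = ∫⁻ u, ∑ j, ENNReal.ofReal (Real.log (t / coordRadius z u j)) ∂ν := by
    refine lintegral_congr_ae ?_
    filter_upwards [hmem, hpos] with u hu hp
    have hdist : 0 < dist u fun _ => z := (hp ⟨0, hd⟩).trans_le (coordRadius_le_dist z u _)
    rw [← ENNReal.ofReal_sum_of_nonneg fun j _ => Real.log_nonneg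
      ((one_le_div (hp j)).2 ((coordRadius_le_dist z u j).trans hu)), ← ENNReal.ofReal_natCast d,
      ← ENNReal.ofReal_mul hd'.le, ← ENNReal.ofReal_add (logRatio_nonneg z u)
        (mul_nonneg hd'.le (Real.log_nonneg ((one_le_div hdist).2 hu)))]
    congr 1
    have : (d : ℝ) * Real.log (t / dist u fun _ => z)
        = ∑ _j : Fin d, Real.log (t / dist u fun _ => z) := by simp
    rw [this, logRatio, ← Finset.sum_add_distrib]
    refine Finset.sum_congr rfl fun j _ => ?_
    rw [Real.log_div hdist.ne' (hp j).ne', Real.log_div ht.ne' hdist.ne',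
      Real.log_div ht.ne' (hp j).ne']
    ring
  have hmeas : Measurable fun u : ι → Vec d => ENNReal.ofReal (logRatio z u) :=
    (measurable_logRatio z).ennreal_ofReal
  have hmeas' : ∀ j, Measurable fun u : ι → Vec d =>
      ENNReal.ofReal (Real.log (t / coordRadius z u j)) := fun j =>
    (Real.measurable_log.comp (measurable_const.div (measurable_coordRadius z j))).ennreal_ofReal
  rw [lintegral_add_left hmeas, lintegral_const_mul _ (by fun_prop), hD,
    lintegral_finsetSum _ fun j _ => hmeas' j] at hsum
  simp only [hC, Finset.sum_const, Finset.card_univ, Fintype.card_fin, nsmul_eq_mul] at hsum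
  rw [volume_closedBall_pi z ht.le, ← hVdef]
  have hfin : (d : ℝ≥0∞) * (V * ENNReal.ofReal (1 / (Fintype.card ι * d : ℝ))) ≠ ∞ :=
    ENNReal.mul_ne_top (ENNReal.natCast_ne_top d) (ENNReal.mul_ne_top hV ENNReal.ofReal_ne_top)
  refine (ENNReal.add_left_inj hfin).1 (hsum.trans ?_)
  rw [← ENNReal.ofReal_natCast d, hVdef]
  rw [← ENNReal.ofReal_mul (by positivity), ← ENNReal.ofReal_mul (by positivity),
    ← ENNReal.ofReal_mul (by positivity), ← ENNReal.ofReal_mul (by positivity),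
    ← ENNReal.ofReal_mul (by positivity), ← ENNReal.ofReal_add (by positivity) (by positivity)]
  congr 1
  field_simp
  ring

/-- Under Lebesgue measure the logarithmic ratio is uncorrelated with every function of the
radius. -/
lemma lintegral_logRatio_mul (hd : 1 ≤ d) (z : Vec d) {D : ℝ} (hD : 0 ≤ D) {W : ℝ → ℝ≥0∞}
    (hW : Measurable W) :
    ∫⁻ u in Metric.closedBall (fun _ : ι => z) D,
        ENNReal.ofReal (logRatio z u) * W (dist u fun _ => z)
      = ENNReal.ofReal (((d : ℝ) - 1) / Fintype.card ι)
        * ∫⁻ u in Metric.closedBall (fun _ : ι => z) D, W (dist u fun _ => z) := by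
  set ν := volume.restrict (Metric.closedBall (fun _ : ι => z) D)
  set r : (ι → Vec d) → ℝ := fun u => dist u fun _ => z
  have hr : Measurable r := by fun_prop
  have hmeas : Measurable fun u : ι → Vec d => ENNReal.ofReal (logRatio z u) :=
    (measurable_logRatio z).ennreal_ofReal
  have hνfin : IsFiniteMeasure ν := ⟨by
    rw [Measure.restrict_apply_univ, volume_closedBall_pi z hD]
    exact ENNReal.ofReal_lt_top⟩
  set κ₁ := (ν.withDensity fun u => ENNReal.ofReal (logRatio z u)).map r
  set κ₂ := ENNReal.ofReal (((d : ℝ) - 1) / Fintype.card ι) • ν.map r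
  -- Preimages of half-lines under the radius are closed balls, and the mean over a closed ball is
  -- known for every radius. So the two laws of the radius agree on a generating class.
  have hκ : κ₁ = κ₂ := by
    have : IsFiniteMeasure (ν.withDensity fun u => ENNReal.ofReal (logRatio z u)) :=
      isFiniteMeasure_withDensity (by
        rw [lintegral_logRatio_closedBall hd z hD, volume_closedBall_pi z hD]
        exact ENNReal.mul_ne_top ENNReal.ofReal_ne_top ENNReal.ofReal_ne_top)
    have : IsFiniteMeasure κ₂ := Measure.smul_finite _ ENNReal.ofReal_ne_top
    refine Measure.ext_of_Iic _ _ fun x => ?_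
    have hpre : r ⁻¹' Set.Iic x = Metric.closedBall (fun _ : ι => z) x := rfl
    have hmx : MeasurableSet (Metric.closedBall (fun _ : ι => z) x) :=
      Metric.isClosed_closedBall.measurableSet
    rw [Measure.smul_apply, Measure.map_apply hr measurableSet_Iic,
      Measure.map_apply hr measurableSet_Iic, hpre, withDensity_apply _ hmx,
      Measure.restrict_restrict hmx, Measure.restrict_apply hmx, smul_eq_mul]
    rcases lt_or_ge x 0 with hx | hx
    · rw [Metric.closedBall_eq_empty.2 hx]
      simp
    · have hint : Metric.closedBall (fun _ : ι => z) x ∩ Metric.closedBall (fun _ : ι => z) D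
          = Metric.closedBall (fun _ : ι => z) (min x D) := by
        ext u; simp
      rw [hint]
      exact lintegral_logRatio_closedBall hd z (le_min hx hD)
  have h1 : ∫⁻ u, ENNReal.ofReal (logRatio z u) * W (r u) ∂ν = ∫⁻ x, W x ∂κ₁ := by
    rw [lintegral_map hW hr, lintegral_withDensity_eq_lintegral_mul _ hmeas (g := fun u => W (r u))
      (hW.comp hr)]
    rfl
  have h2 : ∫⁻ x, W x ∂κ₂
      = ENNReal.ofReal (((d : ℝ) - 1) / Fintype.card ι) * ∫⁻ u, W (r u) ∂ν := by
    rw [lintegral_smul_measure, lintegral_map hW hr, smul_eq_mul]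
  rw [h1, hκ, h2]

end LogRatio

/-! ### Passing from Lebesgue measure to the product density -/

lemma abs_prod_sub_pow_card_le {ι : Type*} (s : Finset ι) (a : ι → ℝ) {b δ : ℝ}
    (ha : ∀ i ∈ s, 0 ≤ a i ∧ a i ≤ 2) (hb : 0 ≤ b ∧ b ≤ 2) (hδ : ∀ i ∈ s, |a i - b| ≤ δ) :
    |∏ i ∈ s, a i - b ^ s.card| ≤ s.card * 2 ^ s.card * δ := by
  classical
  induction s using Finset.induction_on with
  | empty => simp
  | insert i s hi ih =>
    have h1 := ih (fun j hj => ha j (Finset.mem_insert_of_mem hj))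
      fun j hj => hδ j (Finset.mem_insert_of_mem hj)
    have h2 := hδ i (Finset.mem_insert_self _ _)
    have h3 := ha i (Finset.mem_insert_self _ _)
    rw [Finset.prod_insert hi, Finset.card_insert_of_notMem hi]
    have hpow : b ^ s.card ≤ 2 ^ s.card := pow_le_pow_left₀ hb.1 hb.2 _
    have hpow0 : 0 ≤ b ^ s.card := pow_nonneg hb.1 _
    have e : a i * ∏ j ∈ s, a j - b ^ (s.card + 1)
        = a i * (∏ j ∈ s, a j - b ^ s.card) + (a i - b) * b ^ s.card := by ring
    have hδ0 : 0 ≤ δ := (abs_nonneg _).trans h2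
    calc |a i * ∏ j ∈ s, a j - b ^ (s.card + 1)|
        ≤ a i * |∏ j ∈ s, a j - b ^ s.card| + |a i - b| * b ^ s.card := by
          rw [e]
          refine (abs_add_le _ _).trans ?_
          rw [abs_mul, abs_mul, abs_of_nonneg h3.1, abs_of_nonneg hpow0]
      _ ≤ 2 * (s.card * 2 ^ s.card * δ) + δ * 2 ^ s.card := by
          gcongr
          exact h3.2
      _ ≤ ((s.card + 1 : ℕ) : ℝ) * 2 ^ (s.card + 1) * δ := by
          have : 0 ≤ δ * 2 ^ s.card := by positivity
          push_cast
          rw [pow_succ]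
          nlinarith

section PiDensity

variable {ι : Type*} [Fintype ι] {d : ℕ}

/-- It suffices to compare on boxes. There the indicator times the product density is a product of
functions of single coordinates, whose integral factors by independence. -/
lemma pi_withDensity {X : Type*} [MeasurableSpace X] (ν : Measure X) [IsProbabilityMeasure ν]
    {f : X → ℝ≥0∞} (hf : Measurable f) [SigmaFinite (ν.withDensity f)] :
    Measure.pi (fun _ : ι => ν.withDensity f)
      = (Measure.pi fun _ : ι => ν).withDensity fun u => ∏ i, f (u i) := by
  refine Measure.pi_eq fun s hs => ?_
  rw [withDensity_apply _ (MeasurableSet.univ_pi hs),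
    ← lintegral_indicator (MeasurableSet.univ_pi hs)]
  have h1 : ∀ u : ι → X, (Set.univ.pi s).indicator (fun u => ∏ i, f (u i)) u
      = ∏ i, (s i).indicator f (u i) := by
    intro u
    by_cases hu : u ∈ Set.univ.pi s
    · rw [Set.indicator_of_mem hu]
      exact Finset.prod_congr rfl fun i _ => (Set.indicator_of_mem (hu i (Set.mem_univ i)) f).symm
    · rw [Set.indicator_of_notMem hu]
      simp only [Set.mem_pi, Set.mem_univ, true_implies, not_forall] at hu
      obtain ⟨i, hi⟩ := hu
      exact (Finset.prod_eq_zero (Finset.mem_univ i) (Set.indicator_of_notMem hi f)).symm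
  simp_rw [h1]
  have hm : ∀ i, Measurable ((s i).indicator f) := fun i => hf.indicator (hs i)
  rw [lintegral_prod_eq_prod_lintegral_of_indepFun Finset.univ
    (fun (i : ι) (u : ι → X) => (s i).indicator f (u i))
    (iIndepFun_pi fun i => (hm i).aemeasurable) fun i => (hm i).comp (measurable_pi_apply i)]
  refine Finset.prod_congr rfl fun i _ => ?_
  rw [withDensity_apply _ (hs i), ← lintegral_indicator (hs i)]
  exact (measurePreserving_eval (fun _ : ι => ν) i).lintegral_comp (hm i)

variable {c : ℝ} {q : Vec d → ℝ} {μ : Measure (Vec d)}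

namespace NearUniform

lemma pi_restrict (h : NearUniform c q μ) {B : Set (ι → Vec d)} (hB : MeasurableSet B)
    (hBc : ∀ u ∈ B, ∀ i, u i ∈ openCube d) :
    (Measure.pi fun _ : ι => μ).restrict B
      = (volume.restrict B).withDensity fun u => ∏ i, ENNReal.ofReal (q (u i)) := by
  have hprob := h.isProb
  have hsf : SigmaFinite ((volume.restrict (openCube d)).withDensity
      fun z => ENNReal.ofReal (q z)) := by
    rw [← h.eq_withDensity]; infer_instance
  have hq : Measurable fun z => ENNReal.ofReal (q z) := h.measurable.ennreal_ofReal
  have hpi : (Measure.pi fun _ : ι => μ)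
      = (Measure.pi fun _ : ι => volume.restrict (openCube d)).withDensity
        fun u => ∏ i, ENNReal.ofReal (q (u i)) := by
    rw [← pi_withDensity _ hq, ← h.eq_withDensity]
  rw [hpi, restrict_withDensity hB]
  congr 1
  rw [← Measure.restrict_pi_pi, Measure.restrict_restrict hB, ← volume_pi]
  congr 1
  exact Set.inter_eq_left.2 fun u hu i _ => hBc u hu i

lemma setIntegral_pi (h : NearUniform c q μ) {B : Set (ι → Vec d)} (hB : MeasurableSet B)
    (hBc : ∀ u ∈ B, ∀ i, u i ∈ openCube d) (f : (ι → Vec d) → ℝ) :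
    ∫ u in B, f u ∂(Measure.pi fun _ : ι => μ) = ∫ u in B, (∏ i, q (u i)) * f u := by
  rw [h.pi_restrict hB hBc, integral_withDensity_eq_integral_toReal_smul]
  · refine setIntegral_congr_fun hB fun u hu => ?_
    simp only [smul_eq_mul, ENNReal.toReal_prod]
    congr 1
    exact Finset.prod_congr rfl fun i _ => ENNReal.toReal_ofReal (h.pos (hBc u hu i)).le
  · have := h.measurable
    fun_prop
  · exact Eventually.of_forall fun u => ENNReal.prod_lt_top fun i _ => ENNReal.ofReal_lt_top

end NearUniform

lemma integral_logRatio_mul [Nonempty ι] (hd : 1 ≤ d) (z : Vec d) {D C : ℝ} (hD : 0 ≤ D)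
    {w : ℝ → ℝ} (hw : Measurable w) (hw0 : ∀ t ∈ Set.Icc 0 D, 0 ≤ w t)
    (hwC : ∀ t ∈ Set.Icc 0 D, w t ≤ C) :
    IntegrableOn (fun u => logRatio z u * w (dist u fun _ => z))
        (Metric.closedBall (fun _ : ι => z) D) ∧
      IntegrableOn (fun u => w (dist u fun _ => z)) (Metric.closedBall (fun _ : ι => z) D) ∧
      ∫ u in Metric.closedBall (fun _ : ι => z) D, logRatio z u * w (dist u fun _ => z)
        = ((d : ℝ) - 1) / Fintype.card ι
          * ∫ u in Metric.closedBall (fun _ : ι => z) D, w (dist u fun _ => z) := by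
  set B := Metric.closedBall (fun _ : ι => z) D with hBdef
  have hB : MeasurableSet B := Metric.isClosed_closedBall.measurableSet
  have hk : 0 < (Fintype.card ι : ℝ) := by exact_mod_cast Fintype.card_pos
  have hd1 : (0 : ℝ) ≤ (d : ℝ) - 1 := by
    have : (1 : ℝ) ≤ d := by exact_mod_cast hd
    linarith
  have hfin : volume B ≠ ∞ := by
    rw [hBdef, volume_closedBall_pi z hD]
    exact ENNReal.ofReal_ne_top
  have hmem : ∀ u ∈ B, dist u (fun _ => z) ∈ Set.Icc 0 D := fun u hu => ⟨dist_nonneg, hu⟩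
  have hwm : Measurable fun u : ι → Vec d => w (dist u fun _ => z) := hw.comp (by fun_prop)
  have hwint : IntegrableOn (fun u => w (dist u fun _ => z)) B := by
    refine Measure.integrableOn_of_bounded (M := C) hfin hwm.aestronglyMeasurable ?_
    filter_upwards [ae_restrict_mem hB] with u hu
    rw [Real.norm_of_nonneg (hw0 _ (hmem u hu))]
    exact hwC _ (hmem u hu)
  have hkey := lintegral_logRatio_mul (ι := ι) hd z hD hw.ennreal_ofReal
  have hcongr : ∫⁻ u in B, ENNReal.ofReal (logRatio z u * w (dist u fun _ => z))
      = ENNReal.ofReal (((d : ℝ) - 1) / Fintype.card ι)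
        * ∫⁻ u in B, ENNReal.ofReal (w (dist u fun _ => z)) := by
    rw [← hkey]
    exact lintegral_congr fun u => ENNReal.ofReal_mul (logRatio_nonneg z u)
  have hw0' : 0 ≤ᵐ[volume.restrict B] fun u => w (dist u fun _ => z) := by
    filter_upwards [ae_restrict_mem hB] with u hu using hw0 _ (hmem u hu)
  have hl0' : 0 ≤ᵐ[volume.restrict B] fun u => logRatio z u * w (dist u fun _ => z) := by
    filter_upwards [hw0'] with u hu using mul_nonneg (logRatio_nonneg z u) hu
  have hlm : Measurable fun u : ι → Vec d => logRatio z u * w (dist u fun _ => z) :=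
    (measurable_logRatio z).mul hwm
  have hwl : ENNReal.ofReal (∫ u in B, w (dist u fun _ => z))
      = ∫⁻ u in B, ENNReal.ofReal (w (dist u fun _ => z)) :=
    ofReal_integral_eq_lintegral_ofReal hwint hw0'
  refine ⟨⟨hlm.aestronglyMeasurable, ?_⟩, hwint, ?_⟩
  · rw [hasFiniteIntegral_iff_ofReal hl0', hcongr, ← hwl, ← ENNReal.ofReal_mul (by positivity)]
    exact ENNReal.ofReal_lt_top
  · rw [integral_eq_lintegral_of_nonneg_ae hl0' hlm.aestronglyMeasurable, hcongr, ← hwl,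
      ← ENNReal.ofReal_mul (by positivity), ENNReal.toReal_ofReal]
    exact mul_nonneg (by positivity) (integral_nonneg_of_ae hw0')

namespace NearUniform

/-- Replacing the density by its value at the centre costs a term proportional to the radius. -/
lemma abs_setIntegral_logRatio_sub_le [Nonempty ι] (h : NearUniform c q μ) (hd : 1 ≤ d)
    {z : Vec d} {D : ℝ} (hD : 0 ≤ D) (hzD : Metric.closedBall z D ⊆ openCube d)
    {w : ℝ → ℝ} (hw : Measurable w) (hw0 : ∀ t, 0 ≤ w t) (hw1 : ∀ t, w t ≤ 1) :
    |∫ u in Metric.closedBall (fun _ : ι => z) D,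
        (logRatio z u - ((d : ℝ) - 1) / Fintype.card ι) * w (dist u fun _ => z)
          ∂(Measure.pi fun _ : ι => μ)|
      ≤ 2 ^ (Fintype.card ι + 1) * d / (1 - c) ^ Fintype.card ι
        * ∫ u in Metric.closedBall (fun _ : ι => z) D, dist u (fun _ => z) * w (dist u fun _ => z)
          ∂(Measure.pi fun _ : ι => μ) := by
  set B := Metric.closedBall (fun _ : ι => z) D with hBdef
  set k := Fintype.card ι with hkdef
  set hbar := ((d : ℝ) - 1) / k with hbardef
  have hB : MeasurableSet B := Metric.isClosed_closedBall.measurableSet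
  have hk : 0 < (k : ℝ) := by exact_mod_cast Fintype.card_pos
  have hd1 : (0 : ℝ) ≤ (d : ℝ) - 1 := by
    have : (1 : ℝ) ≤ d := by exact_mod_cast hd
    linarith
  have hbar0 : 0 ≤ hbar := by positivity
  have hc1 : 0 < 1 - c := sub_pos.2 h.lt_one
  have hz : z ∈ openCube d := hzD (Metric.mem_closedBall_self hD)
  have hBball : ∀ u ∈ B, ∀ i, u i ∈ Metric.closedBall z D := fun u hu i =>
    (dist_le_pi_dist u (fun _ => z) i).trans hu
  have hBc : ∀ u ∈ B, ∀ i, u i ∈ openCube d := fun u hu i => hzD (hBball u hu i)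
  set Q : (ι → Vec d) → ℝ := fun u => ∏ i, q (u i) with hQdef
  have hQm : Measurable Q := by
    have := h.measurable
    fun_prop
  have hQlow : ∀ u ∈ B, (1 - c) ^ k ≤ Q u := fun u hu => by
    calc (1 - c) ^ k = ∏ _i : ι, (1 - c) := by rw [Finset.prod_const, Finset.card_univ]
      _ ≤ Q u := Finset.prod_le_prod (fun _ _ => hc1.le) fun i _ => h.lower _ (hBc u hu i)
  have hQdiff : ∀ u ∈ B, |Q u - q z ^ k| ≤ k * 2 ^ k * dist u fun _ => z := fun u hu => by
    have := abs_prod_sub_pow_card_le (Finset.univ : Finset ι) (fun i => q (u i)) (b := q z)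
      (δ := dist u fun _ => z)
      (fun i _ => ⟨(h.pos (hBc u hu i)).le, h.upper_two (hBc u hu i)⟩)
      ⟨(h.pos hz).le, h.upper_two hz⟩ fun i _ => by
        refine (h.lipschitz _ (hBc u hu i) z hz).trans ?_
        calc c * dist (u i) z ≤ 1 * dist (u i) z := by gcongr; exact h.lt_one.le
          _ ≤ _ := by rw [one_mul]; exact dist_le_pi_dist u (fun _ => z) i
    simpa [Finset.card_univ] using this
  obtain ⟨i1, i2, e1⟩ := integral_logRatio_mul (ι := ι) hd z hD hw (fun t _ => hw0 t)
    fun t _ => hw1 t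
  -- The same identity for the weight `t * w t`: the error of freezing the density is of this form,
  -- with one extra factor of the radius.
  obtain ⟨i3, i4, e2⟩ := integral_logRatio_mul (ι := ι) hd z hD (w := fun t => t * w t)
    (measurable_id.mul hw) (fun t ht => mul_nonneg ht.1 (hw0 t)) (C := D)
    fun t ht => (mul_le_of_le_one_right ht.1 (hw1 t)).trans ht.2
  set ρ : (ι → Vec d) → ℝ := fun u => dist u fun _ => z with hρdef
  have i5 : IntegrableOn (fun u => (logRatio z u - hbar) * w (ρ u)) B := by
    refine (i1.sub (i2.const_mul hbar)).congr ?_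
    exact Eventually.of_forall fun u => by simp only [Pi.sub_apply]; ring
  -- With the density frozen at the centre the centred log-ratio integrates to zero exactly, so only
  -- the deviation of the density contributes.
  have hzero : ∫ u in B, q z ^ k * ((logRatio z u - hbar) * w (ρ u)) = 0 := by
    have : ∀ u, (logRatio z u - hbar) * w (ρ u)
        = logRatio z u * w (ρ u) - hbar * w (ρ u) := fun u => by ring
    rw [integral_const_mul]
    simp_rw [this]
    rw [integral_sub i1 (i2.const_mul hbar), integral_const_mul, e1]
    ring
  have hbound : ∀ u ∈ B, |(Q u - q z ^ k) * ((logRatio z u - hbar) * w (ρ u))|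
      ≤ k * 2 ^ k * (logRatio z u * (ρ u * w (ρ u)) + hbar * (ρ u * w (ρ u))) := fun u hu => by
    have h1 : |logRatio z u - hbar| ≤ logRatio z u + hbar := by
      rw [abs_le]
      constructor <;> linarith [logRatio_nonneg z u]
    have := hw0 (ρ u)
    have h2 : 0 ≤ logRatio z u := logRatio_nonneg z u
    have h3 : 0 ≤ ρ u := dist_nonneg
    rw [abs_mul, abs_mul, abs_of_nonneg (hw0 _)]
    calc |Q u - q z ^ k| * (|logRatio z u - hbar| * w (ρ u))
        ≤ (k * 2 ^ k * ρ u) * ((logRatio z u + hbar) * w (ρ u)) := by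
          gcongr
          exact hQdiff u hu
      _ = _ := by ring
  have i6 : IntegrableOn
      (fun u => k * 2 ^ k * (logRatio z u * (ρ u * w (ρ u)) + hbar * (ρ u * w (ρ u)))) B :=
    (i3.add (i4.const_mul hbar)).const_mul _
  have hwm : Measurable fun u : ι → Vec d => w (ρ u) := hw.comp (by fun_prop)
  have hm : Measurable fun u : ι → Vec d => (logRatio z u - hbar) * w (ρ u) :=
    ((measurable_logRatio z).sub measurable_const).mul hwm
  have i7 : IntegrableOn (fun u => (Q u - q z ^ k) * ((logRatio z u - hbar) * w (ρ u))) B := by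
    refine Integrable.mono' i6 ((hQm.sub measurable_const).mul hm).aestronglyMeasurable ?_
    filter_upwards [ae_restrict_mem hB] with u hu using hbound u hu
  rw [h.setIntegral_pi hB hBc, h.setIntegral_pi hB hBc]
  have hsplit : ∫ u in B, Q u * ((logRatio z u - hbar) * w (ρ u))
      = ∫ u in B, (Q u - q z ^ k) * ((logRatio z u - hbar) * w (ρ u)) := by
    have : ∀ u, Q u * ((logRatio z u - hbar) * w (ρ u))
        = (Q u - q z ^ k) * ((logRatio z u - hbar) * w (ρ u))
          + q z ^ k * ((logRatio z u - hbar) * w (ρ u)) := fun u => by ring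
    simp_rw [this]
    rw [integral_add i7 (i5.const_mul _), hzero, add_zero]
  have i8 : IntegrableOn (fun u => Q u * (ρ u * w (ρ u))) B := by
    refine Integrable.mono' (i4.const_mul (2 ^ k : ℝ))
      (hQm.mul ((by fun_prop : Measurable ρ).mul hwm)).aestronglyMeasurable ?_
    filter_upwards [ae_restrict_mem hB] with u hu
    have h3 : 0 ≤ ρ u * w (ρ u) := mul_nonneg dist_nonneg (hw0 _)
    have h4 : Q u ≤ 2 ^ k := by
      calc Q u ≤ ∏ _i : ι, (2 : ℝ) :=
            Finset.prod_le_prod (fun i _ => (h.pos (hBc u hu i)).le)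
              fun i _ => h.upper_two (hBc u hu i)
        _ = 2 ^ k := by rw [Finset.prod_const, Finset.card_univ]
    have h5 : 0 ≤ Q u := (by positivity : (0 : ℝ) ≤ (1 - c) ^ k).trans (hQlow u hu)
    rw [Real.norm_of_nonneg (mul_nonneg h5 h3)]
    gcongr
  calc |∫ u in B, Q u * ((logRatio z u - hbar) * w (ρ u))|
      = |∫ u in B, (Q u - q z ^ k) * ((logRatio z u - hbar) * w (ρ u))| := by rw [hsplit]
    _ ≤ ∫ u in B, |(Q u - q z ^ k) * ((logRatio z u - hbar) * w (ρ u))| :=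
        abs_integral_le_integral_abs
    _ ≤ ∫ u in B, k * 2 ^ k * (logRatio z u * (ρ u * w (ρ u)) + hbar * (ρ u * w (ρ u))) :=
        setIntegral_mono_on i7.abs i6 hB hbound
    _ = k * 2 ^ k * (2 * hbar) * ∫ u in B, ρ u * w (ρ u) := by
        rw [integral_const_mul, integral_add i3 (i4.const_mul hbar), integral_const_mul, e2]
        ring
    _ ≤ (2 ^ (k + 1) * d) * ∫ u in B, ρ u * w (ρ u) := by
        refine mul_le_mul_of_nonneg_right ?_
          (integral_nonneg fun u => mul_nonneg dist_nonneg (hw0 _))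
        rw [hbardef, pow_succ]
        field_simp
        linarith
    -- Returning from Lebesgue measure to the product law costs the lower bound `(1 - c) ^ k` of the
    -- product density.
    _ ≤ (2 ^ (k + 1) * d) * ∫ u in B, ((1 - c) ^ k)⁻¹ * (Q u * (ρ u * w (ρ u))) := by
        refine mul_le_mul_of_nonneg_left ?_ (by positivity)
        refine setIntegral_mono_on i4 (i8.const_mul _) hB fun u hu => ?_
        have h3 : 0 ≤ ρ u * w (ρ u) := mul_nonneg dist_nonneg (hw0 _)
        rw [← mul_assoc]
        refine le_mul_of_one_le_left h3 ?_
        rw [inv_mul_eq_div, one_le_div (by positivity)]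
        exact hQlow u hu
    _ = _ := by
        rw [integral_const_mul]
        ring

end NearUniform

end PiDensity

/-! ### The log-ratio for the nearest neighbours -/

section CellRatio

variable {ι : Type*} [Fintype ι] {d k : ℕ} {z : Vec d}

/-- The logarithmic ratio between the cube and the rectangle spanned by the nearest neighbours. -/
def cellRatio (k : ℕ) (y : ι → Vec d) (z : Vec d) : ℝ :=
  ∑ j, Real.log (knnRadius k Finset.univ y z / halfWidth k Finset.univ y z j)

lemma cellRatio_of_separated {A : Finset ι} {y : ι → Vec d} (hA : A.card = k)
    (hy : y ∈ separated z A) : cellRatio k y z = logRatio z fun a : A => y a := by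
  simp only [cellRatio, logRatio, coordRadius, knnRadius_of_separated hA hy,
    halfWidth_of_separated hA hy]

variable {c : ℝ} {q : Vec d → ℝ} {μ : Measure (Vec d)}

/-- Real-valued form of `lintegral_separated`: the law restricted to the separation event, projected
to the coordinates in `A`, has a density that depends on the radius alone. -/
lemma setIntegral_separated [IsProbabilityMeasure μ] (z : Vec d) (A : Finset ι)
    (hA : A.Nonempty) {f : (A → Vec d) → ℝ} (hf : Measurable f) :
    ∫ y in separated z A, f (fun a => y a) ∂(Measure.pi fun _ : ι => μ)
      = ∫ u, f u * (1 - ballMass μ z (dist u fun _ => z)) ^ (Fintype.card ι - A.card)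
          ∂(Measure.pi fun _ : A => μ) := by
  set n := Fintype.card ι - A.card with hn
  have hr : Measurable fun (y : ι → Vec d) (a : A) => y a := by fun_prop
  have hwm : Measurable fun u : A → Vec d =>
      μ (Metric.closedBall z (dist u fun _ => z))ᶜ ^ n :=
    ((measurable_measure_compl_closedBall μ z).comp (by fun_prop)).pow_const _
  have hmap : ((Measure.pi fun _ : ι => μ).restrict (separated z A)).map
        (fun (y : ι → Vec d) (a : A) => y a)
      = (Measure.pi fun _ : A => μ).withDensity fun u =>
        μ (Metric.closedBall z (dist u fun _ => z))ᶜ ^ n := by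
    ext s hs
    rw [← lintegral_indicator_one hs, lintegral_map (measurable_one.indicator hs) hr,
      lintegral_separated μ z A hA (measurable_one.indicator hs), withDensity_apply _ hs,
      ← lintegral_indicator hs]
    refine lintegral_congr fun u => ?_
    by_cases hu : u ∈ s <;> simp [hu, hn]
  rw [← integral_map (φ := fun (y : ι → Vec d) (a : A) => y a) hr.aemeasurable
    hf.aestronglyMeasurable, hmap, integral_withDensity_eq_integral_toReal_smul hwm]
  · refine integral_congr_ae (Eventually.of_forall fun u => ?_)
    simp only [smul_eq_mul, ENNReal.toReal_pow]
    rw [measure_compl_closedBall, ENNReal.toReal_ofReal (sub_nonneg.2 (ballMass_le_one _)),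
      mul_comm]
  · exact Eventually.of_forall fun u => ENNReal.pow_lt_top (measure_lt_top _ _)

namespace NearUniform

/-- For each choice `A` of the nearest set, the points outside `A` contribute the weight `(1 - mass)
^ (n - k)`, with `n = card ι`. It is a function of the radius with values in `[0, 1]`, so the bound
for `k` points applies to every `A` and is summed. -/
lemma abs_setIntegral_cellRatio_sub_le (h : NearUniform c q μ) (hd : 1 ≤ d) (hk : 1 ≤ k)
    (hkn : k ≤ Fintype.card ι) {D : ℝ} (hD : 0 ≤ D)
    (hzD : Metric.closedBall z D ⊆ openCube d)
    (hint : IntegrableOn (fun y => cellRatio k y z - ((d : ℝ) - 1) / k)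
      {y : ι → Vec d | (knnRadius k Finset.univ y z : ℝ) ≤ D} (Measure.pi fun _ : ι => μ)) :
    |∫ y in {y : ι → Vec d | (knnRadius k Finset.univ y z : ℝ) ≤ D},
        (cellRatio k y z - ((d : ℝ) - 1) / k) ∂(Measure.pi fun _ : ι => μ)|
      ≤ 2 ^ (k + 1) * d / (1 - c) ^ k
        * ∫ y in {y : ι → Vec d | (knnRadius k Finset.univ y z : ℝ) ≤ D},
          (knnRadius k Finset.univ y z : ℝ) ∂(Measure.pi fun _ : ι => μ) := by
  classical
  have hprob := h.isProb
  have hz : z ∈ openCube d := hzD (Metric.mem_closedBall_self hD)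
  set S := {y : ι → Vec d | (knnRadius k Finset.univ y z : ℝ) ≤ D} with hSdef
  have hρm : Measurable fun y : ι → Vec d => (knnRadius k Finset.univ y z : ℝ) :=
    (measurable_knnRadius k _ measurable_id measurable_const).coe_nnreal_real
  have hS : MeasurableSet S := measurableSet_le hρm measurable_const
  have hρint : IntegrableOn (fun y : ι → Vec d => (knnRadius k Finset.univ y z : ℝ)) S
      (Measure.pi fun _ : ι => μ) := by
    refine Measure.integrableOn_of_bounded (M := D) (measure_ne_top _ _)
      hρm.aestronglyMeasurable ?_
    filter_upwards [ae_restrict_mem hS] with y hy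
    rw [Real.norm_of_nonneg NNReal.zero_le_coe]
    exact hy
  rw [← integral_indicator hS, ← integral_indicator hS,
    h.integral_eq_sum_separated hd hk hkn hz (hint.integrable_indicator hS),
    h.integral_eq_sum_separated hd hk hkn hz (hρint.integrable_indicator hS), Finset.mul_sum]
  refine (Finset.abs_sum_le_sum_abs _ _).trans (Finset.sum_le_sum fun A hA => ?_)
  have hAk : A.card = k := Finset.mem_powersetCard_univ.1 hA
  have hAne : A.Nonempty := Finset.card_pos.1 (by omega)
  have : Nonempty A := hAne.to_subtype
  set B := Metric.closedBall (fun _ : A => z) D with hBdef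
  have hB : MeasurableSet B := Metric.isClosed_closedBall.measurableSet
  have hSB : ∀ y ∈ separated z A, (y ∈ S ↔ (fun a : A => y a) ∈ B) := fun y hy => by
    rw [hSdef, Set.mem_ofPred_eq, knnRadius_of_separated hAk hy]
    rfl
  have e1 : ∫ y in separated z A, S.indicator (fun y => cellRatio k y z - ((d : ℝ) - 1) / k) y
        ∂(Measure.pi fun _ : ι => μ)
      = ∫ u in B, (logRatio z u - ((d : ℝ) - 1) / k)
          * (1 - ballMass μ z (dist u fun _ => z)) ^ (Fintype.card ι - k)
          ∂(Measure.pi fun _ : A => μ) := by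
    rw [setIntegral_congr_fun (g := fun y =>
      B.indicator (fun u => logRatio z u - ((d : ℝ) - 1) / k) fun a : A => y a)
      (measurableSet_separated z A) fun y hy => by
        by_cases hyS : y ∈ S
        · simp only [Set.indicator_of_mem hyS, Set.indicator_of_mem ((hSB y hy).1 hyS)]
          rw [cellRatio_of_separated hAk hy]
        · simp only [Set.indicator_of_notMem hyS,
            Set.indicator_of_notMem (fun hn => hyS ((hSB y hy).2 hn))]]
    have hlm : Measurable fun u : A → Vec d => logRatio z u - ((d : ℝ) - 1) / k :=
      (measurable_logRatio z).sub measurable_const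
    rw [setIntegral_separated z A hAne (hlm.indicator hB), ← integral_indicator hB, hAk]
    refine integral_congr_ae (Eventually.of_forall fun u => ?_)
    by_cases hu : u ∈ B <;> simp [hu]
  have e2 : ∫ y in separated z A, S.indicator (fun y => (knnRadius k Finset.univ y z : ℝ)) y
        ∂(Measure.pi fun _ : ι => μ)
      = ∫ u in B, dist u (fun _ => z)
          * (1 - ballMass μ z (dist u fun _ => z)) ^ (Fintype.card ι - k)
          ∂(Measure.pi fun _ : A => μ) := by
    rw [setIntegral_congr_fun (g := fun y =>
      B.indicator (fun u => dist u fun _ => z) fun a : A => y a)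
      (measurableSet_separated z A) fun y hy => by
        by_cases hyS : y ∈ S
        · simp only [Set.indicator_of_mem hyS, Set.indicator_of_mem ((hSB y hy).1 hyS)]
          rw [knnRadius_of_separated hAk hy]
        · simp only [Set.indicator_of_notMem hyS,
            Set.indicator_of_notMem (fun hn => hyS ((hSB y hy).2 hn))]]
    rw [setIntegral_separated z A hAne
      ((by fun_prop : Measurable fun u : A → Vec d => dist u fun _ => z).indicator hB),
      ← integral_indicator hB, hAk]
    refine integral_congr_ae (Eventually.of_forall fun u => ?_)
    by_cases hu : u ∈ B <;> simp [hu]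
  rw [e1, e2]
  have hfin := h.abs_setIntegral_logRatio_sub_le (ι := A) hd hD hzD
    (w := fun t => (1 - ballMass μ z t) ^ (Fintype.card ι - k))
    ((measurable_const.sub (ballMass_mono μ z).measurable).pow_const _)
    (fun t => pow_nonneg (sub_nonneg.2 (ballMass_le_one _)) _)
    fun t => pow_le_one₀ (sub_nonneg.2 (ballMass_le_one _))
      (sub_le_self _ (ballMass_nonneg _))
  rwa [Fintype.card_coe, hAk] at hfin

end NearUniform

end CellRatio

/-! ### Integrable majorants of the logarithms -/

section Envelope

/-- With `L = -log x`, the inequality `y + 1 ≤ exp y` at `y = (L - s)/2` gives the bound. A larger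
`s` enlarges the constant and damps the singular term. At `x = 0` both `log` and the power have the
default value 0. -/
lemma abs_log_le_of_le_one {x s : ℝ} (hx0 : 0 ≤ x) (hx1 : x ≤ 1) (hs : 0 ≤ s) :
    |Real.log x| ≤ s + 2 * Real.exp (-s / 2) * x ^ (-(1 / 2) : ℝ) := by
  rcases hx0.eq_or_lt with rfl | hx
  · simp only [Real.log_zero, abs_zero]
    positivity
  · rw [abs_of_nonpos (Real.log_nonpos hx0 hx1), Real.rpow_def_of_pos hx, mul_assoc,
      ← Real.exp_add]
    have := Real.add_one_le_exp (-s / 2 + Real.log x * -(1 / 2))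
    linarith

/-- For `L = -log x ≥ s`, one has `L^2 ≤ 2 s^2 + 2 (L - s)^2` and `(L - s)/4 ≤ exp ((L - s)/4)`;
squaring the latter gives the factor `2 * 16 = 32`. -/
lemma sq_log_le_of_le_one {x s : ℝ} (hx0 : 0 ≤ x) (hx1 : x ≤ 1) (hs : 0 ≤ s) :
    Real.log x ^ 2 ≤ 2 * s ^ 2 + 32 * Real.exp (-s / 2) * x ^ (-(1 / 2) : ℝ) := by
  rcases hx0.eq_or_lt with rfl | hx
  · rw [Real.log_zero, zero_pow two_ne_zero]
    positivity
  · rw [Real.rpow_def_of_pos hx, mul_assoc, ← Real.exp_add]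
    set L := -Real.log x with hL
    have hL0 : 0 ≤ L := neg_nonneg.2 (Real.log_nonpos hx0 hx1)
    have e : -s / 2 + Real.log x * -(1 / 2) = (L - s) / 4 + (L - s) / 4 := by rw [hL]; ring
    have h1 := Real.add_one_le_exp ((L - s) / 4)
    have h0 := Real.exp_pos ((L - s) / 4)
    rw [e, Real.exp_add, show Real.log x ^ 2 = L ^ 2 by rw [hL]; ring]
    rcases le_total L s with hLs | hLs
    · nlinarith [mul_pos h0 h0]
    · have h2 : (L - s) / 4 ≤ Real.exp ((L - s) / 4) := by linarith
      have h3 : ((L - s) / 4) ^ 2 ≤ Real.exp ((L - s) / 4) ^ 2 :=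
        pow_le_pow_left₀ (by linarith) h2 2
      nlinarith [sq_nonneg (L - 2 * s)]

/-- The centre is inside the unit interval. Either one half of the window survives whole, or both
ends are cut and the length is 1. -/
lemma truncatedLength_mem {a m : ℝ} (ha : 0 < a ∧ a < 1) (hm0 : 0 ≤ m) (hm1 : m ≤ 1) :
    m ≤ truncatedLength a m ∧ truncatedLength a m ≤ 1 := by
  unfold truncatedLength
  rcases min_cases (a + m) 1 with h | h <;> rcases max_cases (a - m) 0 with h' | h' <;>
    rw [h.1, h'.1] <;> constructor <;> linarith [ha.1, ha.2]

lemma abs_log_truncatedLength_le {a m : ℝ} (ha : 0 < a ∧ a < 1) (hm0 : 0 ≤ m) (hm1 : m ≤ 1) :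
    |Real.log (truncatedLength a m)| ≤ |Real.log m| := by
  obtain ⟨h1, h2⟩ := truncatedLength_mem ha hm0 hm1
  rcases hm0.eq_or_lt with rfl | hm
  · have : truncatedLength a 0 = 0 := by
      simp [truncatedLength, ha.1.le, ha.2.le]
    rw [this]
  · rw [abs_of_nonpos (Real.log_nonpos (hm.le.trans h1) h2), abs_of_nonpos (Real.log_nonpos hm0 hm1)]
    exact neg_le_neg (Real.log_le_log hm h1)

variable {ι : Type*} {d k : ℕ} {J : Finset ι} {x : ι → Vec d} {z : Vec d}

/-- A majorant of the logarithmic singularities. -/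
def invSqrtSum (J : Finset ι) (x : ι → Vec d) (z : Vec d) : ℝ :=
  ∑ j, ∑ l ∈ J, |x l j - z j| ^ (-(1 / 2) : ℝ)

lemma invSqrtSum_nonneg : 0 ≤ invSqrtSum J x z :=
  Finset.sum_nonneg fun _ _ => Finset.sum_nonneg fun _ _ => Real.rpow_nonneg (abs_nonneg _) _

lemma invSqrtSum_mono {J' : Finset ι} (hJ : J' ⊆ J) : invSqrtSum J' x z ≤ invSqrtSum J x z :=
  Finset.sum_le_sum fun _ _ => Finset.sum_le_sum_of_subset_of_nonneg hJ fun _ _ _ =>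
    Real.rpow_nonneg (abs_nonneg _) _

lemma halfWidth_eq_zero_or_exists (k : ℕ) (J : Finset ι) (x : ι → Vec d) (z : Vec d) (j : Fin d) :
    (halfWidth k J x z j : ℝ) = 0 ∨ ∃ l ∈ J, (halfWidth k J x z j : ℝ) = |x l j - z j| := by
  rcases (nearest k J x z).eq_empty_or_nonempty with he | hne
  · left
    simp [halfWidth, he]
  · right
    obtain ⟨l, hl, e⟩ := Finset.exists_mem_eq_sup _ hne fun l => ‖x l j - z j‖₊
    refine ⟨l, (mem_nearest.1 hl).1, ?_⟩
    rw [halfWidth, e]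
    rfl

lemma halfWidth_le_one (hz : z ∈ openCube d) (hx : ∀ l ∈ J, x l ∈ openCube d) (j : Fin d) :
    (halfWidth k J x z j : ℝ) ≤ 1 := by
  rcases halfWidth_eq_zero_or_exists k J x z j with h | ⟨l, hl, h⟩
  · rw [h]
    exact zero_le_one
  · rw [h]
    exact (abs_sub_lt_one_of_mem_openCube hz (hx l hl) j).le

lemma rpow_halfWidth_le (j : Fin d) :
    (halfWidth k J x z j : ℝ) ^ (-(1 / 2) : ℝ) ≤ ∑ l ∈ J, |x l j - z j| ^ (-(1 / 2) : ℝ) := by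
  have hnn : ∀ l ∈ J, 0 ≤ |x l j - z j| ^ (-(1 / 2) : ℝ) := fun l _ =>
    Real.rpow_nonneg (abs_nonneg _) _
  rcases halfWidth_eq_zero_or_exists k J x z j with h | ⟨l, hl, h⟩
  · rw [h, Real.zero_rpow (by norm_num)]
    exact Finset.sum_nonneg hnn
  · rw [h]
    exact Finset.single_le_sum hnn hl

/-- The half-width equals one of the offsets `|x l j - z j|` or is 0, so a sum over all offsets
dominates its inverse square root without knowing which points are nearest. The value `s = 0` yields
integrability; `s` of order `log N` yields the rates. -/
lemma abs_logCell_le (hz : z ∈ openCube d) (hx : ∀ l ∈ J, x l ∈ openCube d) {s : ℝ}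
    (hs : 0 ≤ s) :
    |logCell k J x z| ≤ d * s + 2 * Real.exp (-s / 2) * invSqrtSum J x z := by
  have h1 : ∀ j, |Real.log (truncatedLength (z j) (halfWidth k J x z j))|
      ≤ s + 2 * Real.exp (-s / 2) * ∑ l ∈ J, |x l j - z j| ^ (-(1 / 2) : ℝ) := fun j =>
    (abs_log_truncatedLength_le (hz j) NNReal.zero_le_coe (halfWidth_le_one hz hx j)).trans <|
      (abs_log_le_of_le_one NNReal.zero_le_coe (halfWidth_le_one hz hx j) hs).trans <| by
        gcongr
        exact rpow_halfWidth_le j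
  refine (Finset.abs_sum_le_sum_abs _ _).trans ((Finset.sum_le_sum fun j _ => h1 j).trans_eq ?_)
  rw [Finset.sum_add_distrib, invSqrtSum, Finset.mul_sum]
  simp

lemma sq_logCell_le (hz : z ∈ openCube d) (hx : ∀ l ∈ J, x l ∈ openCube d) {s : ℝ}
    (hs : 0 ≤ s) :
    logCell k J x z ^ 2
      ≤ d * (2 * d * s ^ 2 + 32 * Real.exp (-s / 2) * invSqrtSum J x z) := by
  have h1 : ∀ j, Real.log (truncatedLength (z j) (halfWidth k J x z j)) ^ 2
      ≤ 2 * s ^ 2 + 32 * Real.exp (-s / 2) * ∑ l ∈ J, |x l j - z j| ^ (-(1 / 2) : ℝ) := fun j =>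
    (sq_le_sq.2 (abs_log_truncatedLength_le (hz j) NNReal.zero_le_coe
      (halfWidth_le_one hz hx j))).trans <|
      (sq_log_le_of_le_one NNReal.zero_le_coe (halfWidth_le_one hz hx j) hs).trans <| by
        gcongr
        exact rpow_halfWidth_le j
  have h2 := sq_sum_le_card_mul_sum_sq (s := (Finset.univ : Finset (Fin d)))
    (f := fun j => Real.log (truncatedLength (z j) (halfWidth k J x z j)))
  rw [Finset.card_univ, Fintype.card_fin] at h2
  refine h2.trans (mul_le_mul_of_nonneg_left
    ((Finset.sum_le_sum fun j _ => h1 j).trans_eq ?_) (Nat.cast_nonneg d))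
  rw [Finset.sum_add_distrib, invSqrtSum, Finset.mul_sum]
  simp
  ring

/-- Each side of the singularity contributes at most the integral of `t ^ (-1/2)` over the unit
interval, which is 2. -/
lemma lintegral_rpow_neg_half_le (a : ℝ) (ha : 0 < a ∧ a < 1) :
    ∫⁻ t in Set.Ioo (0 : ℝ) 1, ENNReal.ofReal (|t - a| ^ (-(1 / 2) : ℝ)) ≤ 4 := by
  have hhalf : ∫⁻ t in Set.Ioo (0 : ℝ) 1, ENNReal.ofReal (t ^ (-(1 / 2) : ℝ)) = 2 := by
    have hint : IntervalIntegrable (fun t : ℝ => t ^ (-(1 / 2) : ℝ)) volume 0 1 :=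
      intervalIntegral.intervalIntegrable_rpow' (by norm_num)
    rw [intervalIntegrable_iff_integrableOn_Ioo_of_le zero_le_one] at hint
    rw [← ofReal_integral_eq_lintegral_ofReal hint, ← integral_Ioc_eq_integral_Ioo,
      ← intervalIntegral.integral_of_le zero_le_one, integral_rpow (Or.inl (by norm_num))]
    · norm_num
    · filter_upwards [ae_restrict_mem measurableSet_Ioo] with t ht
      exact Real.rpow_nonneg ht.1.le _
  have hpos : ∫⁻ t in Set.Ioo a 1, ENNReal.ofReal (|t - a| ^ (-(1 / 2) : ℝ)) ≤ 2 := by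
    rw [← hhalf, ← lintegral_indicator measurableSet_Ioo, ← lintegral_indicator measurableSet_Ioo,
      ← lintegral_sub_right_eq_self (fun t => (Set.Ioo (0 : ℝ) 1).indicator
        (fun t => ENNReal.ofReal (t ^ (-(1 / 2) : ℝ))) t) a]
    refine lintegral_mono fun t => ?_
    by_cases ht : t ∈ Set.Ioo a 1
    · have : t - a ∈ Set.Ioo (0 : ℝ) 1 := ⟨by linarith [ht.1], by linarith [ht.2, ha.1]⟩
      rw [Set.indicator_of_mem ht, Set.indicator_of_mem this, abs_of_pos this.1]
    · rw [Set.indicator_of_notMem ht]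
      exact zero_le
  have hneg : ∫⁻ t in Set.Ioo 0 a, ENNReal.ofReal (|t - a| ^ (-(1 / 2) : ℝ)) ≤ 2 := by
    rw [← hhalf, ← lintegral_indicator measurableSet_Ioo, ← lintegral_indicator measurableSet_Ioo,
      ← lintegral_sub_left_eq_self (fun t => (Set.Ioo (0 : ℝ) 1).indicator
        (fun t => ENNReal.ofReal (t ^ (-(1 / 2) : ℝ))) t) a]
    refine lintegral_mono fun t => ?_
    by_cases ht : t ∈ Set.Ioo 0 a
    · have : a - t ∈ Set.Ioo (0 : ℝ) 1 := ⟨by linarith [ht.2], by linarith [ht.1, ha.2]⟩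
      rw [Set.indicator_of_mem ht, Set.indicator_of_mem this, abs_sub_comm, abs_of_pos this.1]
    · rw [Set.indicator_of_notMem ht]
      exact zero_le
  have hsub : Set.Ioo (0 : ℝ) 1 ⊆ (Set.Ioo 0 a ∪ Set.Ioo a 1) ∪ {a} := by
    intro t ht
    rcases lt_trichotomy t a with h | h | h
    · exact Or.inl (Or.inl ⟨ht.1, h⟩)
    · exact Or.inr h
    · exact Or.inl (Or.inr ⟨h, ht.2⟩)
  calc _ ≤ ∫⁻ t in (Set.Ioo 0 a ∪ Set.Ioo a 1) ∪ {a},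
        ENNReal.ofReal (|t - a| ^ (-(1 / 2) : ℝ)) := lintegral_mono_set hsub
    _ ≤ (2 + 2) + 0 := by
        refine (lintegral_union_le _ _ _).trans
          (add_le_add ((lintegral_union_le _ _ _).trans (add_le_add hneg hpos)) ?_)
        simp
    _ = 4 := by norm_num

namespace NearUniform

variable {c : ℝ} {q : Vec d → ℝ} {μ : Measure (Vec d)}

lemma lintegral_rpow_neg_half_le (h : NearUniform c q μ) (hz : z ∈ openCube d) (j : Fin d) :
    ∫⁻ w, ENNReal.ofReal (|w j - z j| ^ (-(1 / 2) : ℝ)) ∂μ ≤ 8 := by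
  refine (h.lintegral_le _).trans ?_
  have hpi : volume.restrict (openCube d)
      = Measure.pi fun _ : Fin d => volume.restrict (Set.Ioo (0 : ℝ) 1) := by
    rw [openCube_eq_pi, volume_pi, Measure.restrict_pi_pi]
  have : IsProbabilityMeasure (volume.restrict (Set.Ioo (0 : ℝ) 1)) := ⟨by simp⟩
  rw [hpi, (measurePreserving_eval (fun _ : Fin d => volume.restrict (Set.Ioo (0 : ℝ) 1))
    j).lintegral_comp (f := fun t => ENNReal.ofReal (|t - z j| ^ (-(1 / 2) : ℝ)))
    (by fun_prop)]
  refine (mul_le_mul_right (_root_.lintegral_rpow_neg_half_le (z j) (hz j)) 2).trans ?_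
  norm_num

lemma integral_rpow_neg_half (h : NearUniform c q μ) (hz : z ∈ openCube d) (j : Fin d) :
    Integrable (fun w : Vec d => |w j - z j| ^ (-(1 / 2) : ℝ)) μ ∧
      ∫ w, |w j - z j| ^ (-(1 / 2) : ℝ) ∂μ ≤ 8 := by
  have hm : Measurable fun w : Vec d => |w j - z j| ^ (-(1 / 2) : ℝ) := by fun_prop
  have h0 : 0 ≤ᵐ[μ] fun w : Vec d => |w j - z j| ^ (-(1 / 2) : ℝ) :=
    Eventually.of_forall fun w => Real.rpow_nonneg (abs_nonneg _) _
  have h8 := h.lintegral_rpow_neg_half_le hz j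
  refine ⟨⟨hm.aestronglyMeasurable, ?_⟩, ?_⟩
  · rw [hasFiniteIntegral_iff_ofReal h0]
    exact h8.trans_lt (by norm_num)
  · rw [integral_eq_lintegral_of_nonneg_ae h0 hm.aestronglyMeasurable]
    exact ENNReal.toReal_le_of_le_ofReal (by norm_num) (by simpa using h8)

lemma integral_invSqrtSum [Fintype ι] (h : NearUniform c q μ) (hz : z ∈ openCube d) :
    Integrable (fun y : ι → Vec d => invSqrtSum Finset.univ y z) (Measure.pi fun _ : ι => μ) ∧
      ∫ y, invSqrtSum Finset.univ y z ∂(Measure.pi fun _ : ι => μ)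
        ≤ 8 * d * Fintype.card ι := by
  have := h.isProb
  have hmp := fun l : ι => measurePreserving_eval (fun _ : ι => μ) l
  have hi : ∀ (j : Fin d) (l : ι), Integrable (fun y : ι → Vec d =>
      |y l j - z j| ^ (-(1 / 2) : ℝ)) (Measure.pi fun _ : ι => μ) := fun j l =>
    (hmp l).integrable_comp_of_integrable (h.integral_rpow_neg_half hz j).1
  refine ⟨integrable_finsetSum _ fun j _ => integrable_finsetSum _ fun l _ => hi j l, ?_⟩
  unfold invSqrtSum
  rw [integral_finsetSum _ fun j _ => integrable_finsetSum _ fun l _ => hi j l]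
  have h1 : ∀ j : Fin d, ∫ y : ι → Vec d, ∑ l, |y l j - z j| ^ (-(1 / 2) : ℝ)
      ∂(Measure.pi fun _ : ι => μ) ≤ Fintype.card ι * 8 := fun j => by
    rw [integral_finsetSum _ fun l _ => hi j l, ← nsmul_eq_mul, ← Finset.card_univ]
    refine Finset.sum_le_card_nsmul _ _ _ fun l _ => ?_
    have e := integral_map (μ := Measure.pi fun _ : ι => μ) (hmp l).measurable.aemeasurable
      (f := fun w : Vec d => |w j - z j| ^ (-(1 / 2) : ℝ))
      (Measurable.aestronglyMeasurable (by fun_prop))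
    rw [(hmp l).map_eq] at e
    exact e.symm.trans_le (h.integral_rpow_neg_half hz j).2
  refine (Finset.sum_le_sum fun j _ => h1 j).trans_eq ?_
  simp
  ring

end NearUniform

end Envelope

lemma abs_log_sub_log_le {a b m : ℝ} (hm : 0 < m) (ha : m ≤ a) (hb : m ≤ b) :
    |Real.log a - Real.log b| ≤ |a - b| / m := by
  have key : ∀ x y : ℝ, m ≤ x → m ≤ y → Real.log x - Real.log y ≤ |x - y| / m := by
    intro x y hx hy
    have hx0 := hm.trans_le hx
    have hy0 := hm.trans_le hy
    rw [← Real.log_div hx0.ne' hy0.ne']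
    calc Real.log (x / y) ≤ x / y - 1 := Real.log_le_sub_one_of_pos (by positivity)
      _ = (x - y) / y := by field_simp
      _ ≤ |x - y| / y := by gcongr; exact le_abs_self _
      _ ≤ |x - y| / m := by gcongr
  rw [abs_le]
  constructor
  · have := key b a hb ha
    rw [abs_sub_comm] at this
    linarith
  · exact key a b ha hb

/-! ### The local error at one point -/

namespace NearUniform

variable {ι : Type*} [Fintype ι] {d k : ℕ} {z : Vec d}
variable {c : ℝ} {q : Vec d → ℝ} {μ : Measure (Vec d)}

lemma pow_le_ballMass_of_subset (h : NearUniform c q μ) {t : ℝ} (ht : 0 ≤ t)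
    (hzt : Metric.closedBall z t ⊆ openCube d) : (1 - c) * (2 * t) ^ d ≤ ballMass μ z t := by
  have := h.isProb
  have h1 := h.le_apply (s := Metric.closedBall z t) Metric.isClosed_closedBall.measurableSet
    fun w hw => h.lower w hw.2
  rw [Set.inter_eq_left.2 hzt, Real.volume_pi_closedBall _ ht, Fintype.card_fin,
    ← ENNReal.ofReal_mul (by linarith [h.lt_one])] at h1
  exact (ENNReal.ofReal_le_iff_le_toReal (measure_ne_top _ _)).1 h1

/-- The mean density over the ball is within `c * t` of `q z`. Both numbers are at least `1 - c`,
where `log` is Lipschitz with constant `1 / (1 - c)`. -/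
lemma abs_log_ballMass_sub_le (h : NearUniform c q μ) {t : ℝ} (ht : 0 < t)
    (hzt : Metric.closedBall z t ⊆ openCube d) :
    |Real.log (ballMass μ z t) - (Real.log (q z) + d * Real.log (2 * t))| ≤ t / (1 - c) := by
  have hz : z ∈ openCube d := hzt (Metric.mem_closedBall_self ht.le)
  have hc1 : 0 < 1 - c := sub_pos.2 h.lt_one
  have hV : 0 < (2 * t) ^ d := by positivity
  have h1 := h.pow_le_ballMass_of_subset ht.le hzt
  have h2 := h.abs_ballMass_sub_le ht.le hzt
  have hF : 0 < ballMass μ z t := (by positivity : 0 < (1 - c) * (2 * t) ^ d).trans_le h1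
  have e : Real.log (ballMass μ z t) - (Real.log (q z) + d * Real.log (2 * t))
      = Real.log (ballMass μ z t / (2 * t) ^ d) - Real.log (q z) := by
    rw [Real.log_div hF.ne' hV.ne', Real.log_pow]
    ring
  rw [e]
  refine (abs_log_sub_log_le hc1 ((le_div_iff₀ hV).2 h1) (h.lower z hz)).trans ?_
  gcongr
  have e2 : ballMass μ z t / (2 * t) ^ d - q z
      = (ballMass μ z t - q z * (2 * t) ^ d) / (2 * t) ^ d := by field_simp
  rw [e2, abs_div, abs_of_pos hV, div_le_iff₀ hV]
  refine h2.trans ?_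
  gcongr
  exact mul_le_of_le_one_left ht.le h.lt_one.le

lemma ae_forall_mem (h : NearUniform c q μ) :
    ∀ᵐ y ∂(Measure.pi fun _ : ι => μ), ∀ l, y l ∈ openCube d := by
  have := h.isProb
  exact ae_all_iff.2 fun l =>
    (measurePreserving_eval (fun _ : ι => μ) l).quasiMeasurePreserving.ae h.ae_mem

lemma ae_forall_ne (h : NearUniform c q μ) (z : Vec d) :
    ∀ᵐ y ∂(Measure.pi fun _ : ι => μ), ∀ l j, y l j ≠ z j := by
  have := h.isProb
  refine ae_all_iff.2 fun l => ae_all_iff.2 fun j =>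
    (measurePreserving_eval (fun _ : ι => μ) l).quasiMeasurePreserving.ae
      (p := fun w : Vec d => w j ≠ z j) ?_
  refine h.absolutelyContinuous.ae_le ?_
  change ∀ᵐ w : Vec d, w j ≠ z j
  rw [ae_iff, volume_pi]
  simpa using Measure.pi_hyperplane (fun _ : Fin d => (volume : Measure ℝ)) j (z j)

lemma ae_halfWidth_pos (h : NearUniform c q μ) (hd : 1 ≤ d) (hk : 1 ≤ k)
    (hkn : k ≤ Fintype.card ι) (hz : z ∈ openCube d) :
    ∀ᵐ y ∂(Measure.pi fun _ : ι => μ), (∀ l, y l ∈ openCube d) ∧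
      (∀ j, 0 < (halfWidth k Finset.univ y z j : ℝ)) ∧
      (∀ j, (halfWidth k Finset.univ y z j : ℝ) ≤ knnRadius k Finset.univ y z) ∧
      (knnRadius k Finset.univ y z : ℝ) ≤ 1 := by
  filter_upwards [h.ae_forall_mem, h.ae_forall_ne z, h.ae_card_nearest (ι := ι) hd hk hkn hz]
    with y hy hne hcard
  refine ⟨hy, fun j => ?_, fun j => ?_, ?_⟩
  · obtain ⟨l, hl⟩ : (nearest k Finset.univ y z).Nonempty := Finset.card_pos.1 (by omega)
    have h1 := Finset.le_sup (f := fun l => ‖y l j - z j‖₊) hl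
    have h2 : 0 < ‖y l j - z j‖₊ := nnnorm_pos.2 (sub_ne_zero.2 (hne l j))
    exact_mod_cast h2.trans_le h1
  · refine NNReal.coe_le_coe.2 (Finset.sup_mono_fun fun l _ => ?_)
    have := dist_le_pi_dist (y l) z j
    rw [Real.dist_eq] at this
    exact_mod_cast this
  · refine NNReal.coe_le_one.2 (Finset.sup_le fun l _ => ?_)
    exact_mod_cast dist_le_one_of_mem_openCube hz (hy l)

/-- The local error of the estimator at `z`. -/
def localError (k : ℕ) (q : Vec d → ℝ) (μ : Measure (Vec d)) (z : Vec d) (y : ι → Vec d) : ℝ :=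
  logCell k Finset.univ y z - Real.log (ballMass μ z (knnRadius k Finset.univ y z))
    + Real.log (q z) + ((d : ℝ) - 1) / k

section

variable (h : NearUniform c q μ) (hd : 1 ≤ d) (hk : 1 ≤ k) (hkn : k ≤ Fintype.card ι)
  (hz : z ∈ openCube d)
include h hz

lemma integrable_logCell :
    Integrable (fun y : ι → Vec d => logCell k Finset.univ y z) (Measure.pi fun _ : ι => μ) := by
  have := h.isProb
  have hI := (h.integral_invSqrtSum (ι := ι) hz).1
  refine Integrable.mono' (hI.const_mul 2)
    (measurable_logCell k _ measurable_id measurable_const).aestronglyMeasurable ?_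
  filter_upwards [h.ae_forall_mem] with y hy
  have := abs_logCell_le (k := k) (J := Finset.univ) hz (fun l _ => hy l) le_rfl
  simpa using this

include hd hk hkn

lemma integrable_localError :
    Integrable (localError k q μ z) (Measure.pi fun _ : ι => μ) := by
  have := h.isProb
  exact (((h.integrable_logCell hz).sub (h.integral_log_ballMass hd hk hkn hz).1).add
    (integrable_const _)).add (integrable_const _)

/-- The log-mass may be replaced by its exact mean. The right-hand side is then the mean
contribution of one summand of the estimator, constants included, plus `log (q z)`; averaged over
`z` it is the bias. -/
lemma integral_localError :
    ∫ y, localError k q μ z y ∂(Measure.pi fun _ : ι => μ)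
      = ∫ y, logCell k Finset.univ y z ∂(Measure.pi fun _ : ι => μ)
        - psi k + psi ((Fintype.card ι : ℝ) + 1) + Real.log (q z) + ((d : ℝ) - 1) / k := by
  have := h.isProb
  have h1 := h.integrable_logCell (ι := ι) (k := k) hz
  obtain ⟨h2, h3⟩ := h.integral_log_ballMass (ι := ι) hd hk hkn hz
  have h4 : Integrable (fun y : ι → Vec d => logCell k Finset.univ y z
      - Real.log (ballMass μ z (knnRadius k Finset.univ y z))) (Measure.pi fun _ : ι => μ) :=
    h1.sub h2
  unfold localError
  simp_rw [add_assoc]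
  rw [integral_add h4 (integrable_const _), integral_sub h1 h2, h3, integral_const]
  simp
  ring

/-- `b` is the inverse of the typical distance to the nearest neighbours. -/
lemma integral_knnRadius_le {b : ℝ} (hb : 0 < b)
    (hbd : b ^ d = (1 - c) * (Fintype.card ι + 1)) :
    Integrable (fun y => (knnRadius k Finset.univ y z : ℝ)) (Measure.pi fun _ : ι => μ) ∧
    ∫ y, (knnRadius k Finset.univ y z : ℝ) ∂(Measure.pi fun _ : ι => μ) ≤ (k + 1) / b := by
  have := h.isProb
  obtain ⟨h1, h2⟩ := h.integral_pow_ballMass (ι := ι) hd hk hkn hz 1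
  rw [integral_id_orderStatLaw hk hkn] at h2
  have hae := h.ae_halfWidth_pos (ι := ι) hd hk hkn hz
  have hρm : Measurable fun y : ι → Vec d => (knnRadius k Finset.univ y z : ℝ) :=
    (measurable_knnRadius k _ measurable_id measurable_const).coe_nnreal_real
  have hint : Integrable (fun y => (knnRadius k Finset.univ y z : ℝ))
      (Measure.pi fun _ : ι => μ) := by
    refine Integrable.mono' (integrable_const (1 : ℝ)) hρm.aestronglyMeasurable ?_
    filter_upwards [hae] with y hy
    rw [Real.norm_of_nonneg NNReal.zero_le_coe]
    exact hy.2.2.2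
  refine ⟨hint, ?_⟩
  have hle : ∫ y, b * (knnRadius k Finset.univ y z : ℝ) ∂(Measure.pi fun _ : ι => μ)
      ≤ ∫ y, (1 + (Fintype.card ι + 1) * ballMass μ z (knnRadius k Finset.univ y z) ^ 1)
        ∂(Measure.pi fun _ : ι => μ) := by
    refine integral_mono_ae (hint.const_mul b) ((integrable_const _).add (h1.const_mul _)) ?_
    filter_upwards [hae] with y hy
    have h0 : 0 ≤ (knnRadius k Finset.univ y z : ℝ) := NNReal.zero_le_coe
    have h3 := h.pow_le_ballMass hz h0 hy.2.2.2
    -- The elementary `x ≤ 1 + x ^ d` brings in the ball mass: with `n = card ι`, `(bρ)^d` is at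
    -- most `n + 1` times the mass, whose mean is `k / (n + 1)`. Hence the total `1 + k`.
    have h4 : b * (knnRadius k Finset.univ y z : ℝ)
        ≤ 1 + (b * (knnRadius k Finset.univ y z : ℝ)) ^ d := by
      set x := b * (knnRadius k Finset.univ y z : ℝ)
      have hx : 0 ≤ x := by positivity
      rcases le_total x 1 with hx1 | hx1
      · linarith [pow_nonneg hx d]
      · linarith [le_self_pow₀ hx1 (by omega : d ≠ 0)]
    refine h4.trans ?_
    rw [mul_pow, hbd, pow_one]
    have : (0 : ℝ) ≤ Fintype.card ι + 1 := by positivity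
    nlinarith
  rw [integral_const_mul, integral_add (integrable_const _) (h1.const_mul _), integral_const_mul,
    h2] at hle
  rw [le_div_iff₀ hb, mul_comm]
  refine hle.trans_eq ?_
  have : (Fintype.card ι : ℝ) + 1 ≠ 0 := by positivity
  simp
  field_simp
  ring

/-- If the radius exceeds `D`, the mass is at least `(1 - c) D^d`; Chebyshev with the second moment
of the order statistic gives decay `(bD)^(-2d)`, hence `(bD)^(-2)` once `bD ≥ 1`. For smaller `bD`
the bound exceeds 1. The square makes the later integral over the distance to the boundary converge
without a logarithm, even for `d = 1`. -/
lemma measure_lt_knnRadius_le {b D : ℝ} (hb : 0 < b) (hD : 0 < D)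
    (hbd : b ^ d = (1 - c) * (Fintype.card ι + 1)) :
    (Measure.pi fun _ : ι => μ).real {y | D < (knnRadius k Finset.univ y z : ℝ)}
      ≤ 2 * (1 + k * (k + 1)) * (1 + (b * D) ^ 2)⁻¹ := by
  have := h.isProb
  have hK : (0 : ℝ) ≤ k * (k + 1) := by positivity
  rcases le_total (b * D) 1 with hbD | hbD
  · have h0 : 0 ≤ b * D := by positivity
    have : (b * D) ^ 2 ≤ 1 := pow_le_one₀ h0 hbD
    refine measureReal_le_one.trans ?_
    rw [← div_eq_mul_inv, le_div_iff₀ (by positivity)]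
    nlinarith
  obtain ⟨h1, h2⟩ := h.integral_pow_ballMass (ι := ι) hd hk hkn hz 2
  rw [integral_sq_orderStatLaw hk hkn] at h2
  have hc1 : 0 < 1 - c := sub_pos.2 h.lt_one
  have hae := h.ae_halfWidth_pos (ι := ι) hd hk hkn hz
  have hcheb := mul_meas_ge_le_integral_of_nonneg
    (Eventually.of_forall fun y => sq_nonneg (ballMass μ z (knnRadius k Finset.univ y z))) h1
    (((1 - c) * D ^ d) ^ 2)
  rw [h2] at hcheb
  have hle : (Measure.pi fun _ : ι => μ).real {y | D < (knnRadius k Finset.univ y z : ℝ)}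
      ≤ (Measure.pi fun _ : ι => μ).real
        {y | ((1 - c) * D ^ d) ^ 2 ≤ ballMass μ z (knnRadius k Finset.univ y z) ^ 2} := by
    refine ENNReal.toReal_mono (measure_ne_top _ _) (measure_mono_ae ?_)
    filter_upwards [hae] with y hy hDy
    have h3 := h.pow_le_ballMass hz (t := knnRadius k Finset.univ y z) NNReal.zero_le_coe hy.2.2.2
    change ((1 - c) * D ^ d) ^ 2 ≤ ballMass μ z (knnRadius k Finset.univ y z) ^ 2
    refine pow_le_pow_left₀ (by positivity) (le_trans ?_ h3) 2
    have : D ≤ (knnRadius k Finset.univ y z : ℝ) := le_of_lt hDy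
    gcongr
  set n := (Fintype.card ι : ℝ) with hn
  have hn0 : 0 ≤ n := Nat.cast_nonneg _
  set p := (Measure.pi fun _ : ι => μ).real
    {y | ((1 - c) * D ^ d) ^ 2 ≤ ballMass μ z (knnRadius k Finset.univ y z) ^ 2}
  have hp0 : 0 ≤ p := measureReal_nonneg
  have hbDd : (b * D) ^ 2 ≤ ((b * D) ^ d) ^ 2 := by
    gcongr
    exact le_self_pow₀ hbD (by omega)
  have hpb : ((b * D) ^ d) ^ 2 * p ≤ k * (k + 1) := by
    have e : ((b * D) ^ d) ^ 2 * p = (n + 1) ^ 2 * (((1 - c) * D ^ d) ^ 2 * p) := by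
      rw [mul_pow, hbd]
      ring
    rw [e]
    calc (n + 1) ^ 2 * (((1 - c) * D ^ d) ^ 2 * p)
        ≤ (n + 1) ^ 2 * (k * (k + 1) / ((n + 1) * (n + 2))) := by gcongr
      _ = k * (k + 1) * ((n + 1) / (n + 2)) := by field_simp
      _ ≤ k * (k + 1) * 1 := by
          gcongr
          rw [div_le_one (by positivity)]
          linarith
      _ = _ := mul_one _
  refine hle.trans ?_
  rw [← div_eq_mul_inv, le_div_iff₀ (by positivity)]
  have h5 : (b * D) ^ 2 * p ≤ k * (k + 1) := (mul_le_mul_of_nonneg_right hbDd hp0).trans hpb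
  have h6 : p ≤ 1 := measureReal_le_one
  nlinarith

/-- On this event the cell lies inside the cube and the local error is minus the centred log-ratio
minus the error of the log-mass. Both integrals are bounded by multiples of the mean radius. -/
lemma setIntegral_localError_near_le {b D : ℝ} (hb : 0 < b) (hD : 0 ≤ D)
    (hzD : Metric.closedBall z D ⊆ openCube d)
    (hbd : b ^ d = (1 - c) * (Fintype.card ι + 1)) :
    |∫ y in {y : ι → Vec d | (knnRadius k Finset.univ y z : ℝ) ≤ D},
        localError k q μ z y ∂(Measure.pi fun _ : ι => μ)|
      ≤ (2 ^ (k + 1) * d / (1 - c) ^ k + 1 / (1 - c)) * ((k + 1) / b) := by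
  have := h.isProb
  have hc1 : 0 < 1 - c := sub_pos.2 h.lt_one
  obtain ⟨hρint, hρle⟩ := h.integral_knnRadius_le (ι := ι) hd hk hkn hz hb hbd
  set P := Measure.pi fun _ : ι => μ
  set ρ : (ι → Vec d) → ℝ := fun y => knnRadius k Finset.univ y z with hρdef
  have hρm : Measurable ρ :=
    (measurable_knnRadius k _ measurable_id measurable_const).coe_nnreal_real
  set S := {y : ι → Vec d | ρ y ≤ D} with hSdef
  have hS : MeasurableSet S := measurableSet_le hρm measurable_const
  set err : (ι → Vec d) → ℝ := fun y =>
    Real.log (ballMass μ z (ρ y)) - (Real.log (q z) + d * Real.log (2 * ρ y)) with herr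
  have hae := h.ae_halfWidth_pos (ι := ι) hd hk hkn hz
  have herrm : Measurable err := by
    have := (ballMass_mono μ z).measurable.comp hρm
    exact (Real.measurable_log.comp this).sub (measurable_const.add
      (measurable_const.mul (Real.measurable_log.comp (measurable_const.mul hρm))))
  have hpos : ∀ᵐ y ∂P, 0 < ρ y := by
    filter_upwards [hae] with y hy using (hy.2.1 ⟨0, hd⟩).trans_le (hy.2.2.1 ⟨0, hd⟩)
  have herrle : ∀ᵐ y ∂P.restrict S, |err y| ≤ (1 / (1 - c)) * ρ y := by
    filter_upwards [ae_restrict_mem hS, ae_restrict_of_ae hpos] with y hy hpos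
    rw [one_div_mul_eq_div]
    exact h.abs_log_ballMass_sub_le hpos
      ((Metric.closedBall_subset_closedBall hy).trans hzD)
  have herrint : IntegrableOn err S P :=
    Integrable.mono' (hρint.integrableOn.const_mul _) herrm.aestronglyMeasurable herrle
  have hG : IntegrableOn (localError k q μ z) S P :=
    (h.integrable_localError (ι := ι) hd hk hkn hz).integrableOn
  have hdecomp : ∀ᵐ y ∂P.restrict S,
      cellRatio k y z - ((d : ℝ) - 1) / k = -localError k q μ z y - err y := by
    filter_upwards [ae_restrict_mem hS, ae_restrict_of_ae hpos, ae_restrict_of_ae hae]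
      with y hyS hpos hy
    have htr : ∀ j, truncatedLength (z j) (halfWidth k Finset.univ y z j)
        = 2 * halfWidth k Finset.univ y z j := fun j => by
      have hm : (halfWidth k Finset.univ y z j : ℝ) ≤ D := (hy.2.2.1 j).trans hyS
      -- The two corners `z ± D` of the ball lie in the cube, so neither end of any side of the cell
      -- is truncated.
      have h1 : (fun i => z i + D) ∈ openCube d := hzD ((dist_pi_le_iff hD).2 fun i => by
        simp [abs_of_nonneg hD])
      have h2 : (fun i => z i - D) ∈ openCube d := hzD ((dist_pi_le_iff hD).2 fun i => by
        simp [abs_of_nonneg hD])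
      have h3 := (h1 j).2
      have h4 := (h2 j).1
      simp only at h3 h4
      rw [truncatedLength, min_eq_left (by linarith), max_eq_left (by linarith)]
      ring
    have hsum : logCell k Finset.univ y z = d * Real.log (2 * ρ y) - cellRatio k y z := by
      have : (d : ℝ) * Real.log (2 * ρ y) = ∑ _j : Fin d, Real.log (2 * ρ y) := by simp
      rw [this, logCell, cellRatio, ← Finset.sum_sub_distrib]
      refine Finset.sum_congr rfl fun j _ => ?_
      have hj := hy.2.1 j
      rw [htr j, Real.log_mul two_ne_zero hj.ne', Real.log_mul two_ne_zero hpos.ne',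
        Real.log_div hpos.ne' hj.ne']
      ring
    simp only [localError, herr, hsum]
    ring
  have hcint : IntegrableOn (fun y => cellRatio k y z - ((d : ℝ) - 1) / k) S P :=
    (hG.neg.sub herrint).congr (hdecomp.mono fun y hy => hy.symm)
  have hmain := h.abs_setIntegral_cellRatio_sub_le (ι := ι) hd hk hkn hD hzD hcint
  have hρS : ∫ y in S, ρ y ∂P ≤ (k + 1) / b :=
    (setIntegral_le_integral hρint (Eventually.of_forall fun _ => NNReal.zero_le_coe)).trans hρle
  have heq : ∫ y in S, localError k q μ z y ∂P
      = -∫ y in S, (cellRatio k y z - ((d : ℝ) - 1) / k) ∂P - ∫ y in S, err y ∂P := by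
    have hn : IntegrableOn (fun y => -localError k q μ z y) S P := hG.neg
    rw [integral_congr_ae hdecomp, integral_sub hn herrint, integral_neg]
    ring
  have herrI : |∫ y in S, err y ∂P| ≤ (1 / (1 - c)) * ∫ y in S, ρ y ∂P := by
    rw [← integral_const_mul]
    exact abs_integral_le_integral_abs.trans
      (integral_mono_ae herrint.abs (hρint.integrableOn.const_mul _) herrle)
  rw [heq]
  calc |-∫ y in S, (cellRatio k y z - ((d : ℝ) - 1) / k) ∂P - ∫ y in S, err y ∂P|
      ≤ |∫ y in S, (cellRatio k y z - ((d : ℝ) - 1) / k) ∂P| + |∫ y in S, err y ∂P| := by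
        refine (abs_sub _ _).trans ?_
        rw [abs_neg]
    _ ≤ 2 ^ (k + 1) * d / (1 - c) ^ k * ∫ y in S, ρ y ∂P + (1 / (1 - c)) * ∫ y in S, ρ y ∂P :=
        add_le_add hmain herrI
    _ = (2 ^ (k + 1) * d / (1 - c) ^ k + 1 / (1 - c)) * ∫ y in S, ρ y ∂P := by ring
    _ ≤ _ := by gcongr

omit hd hk hkn in
lemma abs_log_density_le : |Real.log (q z)| ≤ -Real.log (1 - c) + 1 := by
  have hc1 : 0 < 1 - c := sub_pos.2 h.lt_one
  have h1 := Real.log_le_log hc1 (h.lower z hz)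
  have h2 := Real.log_le_sub_one_of_pos (h.pos hz)
  have h3 := Real.log_nonpos hc1.le (by linarith [h.nonneg])
  have h4 := h.upper_two hz
  rw [abs_le]
  constructor <;> linarith

/-- Every logarithm in the local error is bounded by a constant depending on `s` plus a damped
inverse square root sum. The constant is multiplied by the small probability of the event; the
damped sum is integrated over the whole space. -/
lemma setIntegral_localError_far_le {b D s : ℝ} (hb : 0 < b) (hD : 0 < D) (hs : 0 ≤ s)
    (hbd : b ^ d = (1 - c) * (Fintype.card ι + 1)) :
    |∫ y in {y : ι → Vec d | (knnRadius k Finset.univ y z : ℝ) ≤ D}ᶜ,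
        localError k q μ z y ∂(Measure.pi fun _ : ι => μ)|
      ≤ (2 * d * s - 2 * Real.log (1 - c) + 1 + d)
          * (2 * (1 + k * (k + 1)) * (1 + (b * D) ^ 2)⁻¹)
        + 2 * (1 + d) * Real.exp (-s / 2) * (8 * d * Fintype.card ι) := by
  have := h.isProb
  have hc1 : 0 < 1 - c := sub_pos.2 h.lt_one
  have hlc := Real.log_nonpos hc1.le (by linarith [h.nonneg])
  have hk' : (1 : ℝ) ≤ k := by exact_mod_cast hk
  have hd' : (1 : ℝ) ≤ d := by exact_mod_cast hd
  obtain ⟨hI, hIle⟩ := h.integral_invSqrtSum (ι := ι) hz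
  have htail := h.measure_lt_knnRadius_le (ι := ι) hd hk hkn hz hb hD hbd
  have hae := h.ae_halfWidth_pos (ι := ι) hd hk hkn hz
  set P := Measure.pi fun _ : ι => μ
  have hρm : Measurable fun y : ι → Vec d => (knnRadius k Finset.univ y z : ℝ) :=
    (measurable_knnRadius k _ measurable_id measurable_const).coe_nnreal_real
  set S := {y : ι → Vec d | (knnRadius k Finset.univ y z : ℝ) ≤ D} with hSdef
  have hS : MeasurableSet S := measurableSet_le hρm measurable_const
  have hSc : Sᶜ = {y | D < (knnRadius k Finset.univ y z : ℝ)} := by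
    ext y; simp [hSdef]
  set a := 2 * d * s - 2 * Real.log (1 - c) + 1 + d with ha
  set e := 2 * (1 + d) * Real.exp (-s / 2) with he
  have ha0 : 0 ≤ a := by
    have : 0 ≤ (d : ℝ) * s := by positivity
    rw [ha]; linarith
  have he0 : 0 ≤ e := by positivity
  have hbound : ∀ᵐ y ∂P, |localError k q μ z y| ≤ a + e * invSqrtSum Finset.univ y z := by
    filter_upwards [hae] with y hy
    obtain ⟨hyc, hw, hwρ, hρ1⟩ := hy
    set ρ := (knnRadius k Finset.univ y z : ℝ) with hρdef
    have hw0 := hw ⟨0, hd⟩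
    have hρ0 : 0 < ρ := hw0.trans_le (hwρ ⟨0, hd⟩)
    have h1 := abs_logCell_le (k := k) (J := Finset.univ) hz (fun l _ => hyc l) hs
    have h2 : |Real.log ρ| ≤ s + 2 * Real.exp (-s / 2) * invSqrtSum Finset.univ y z := by
      refine (abs_log_le_of_le_one hρ0.le hρ1 hs).trans ?_
      gcongr
      calc ρ ^ (-(1 / 2) : ℝ) ≤ (halfWidth k Finset.univ y z ⟨0, hd⟩ : ℝ) ^ (-(1 / 2) : ℝ) :=
            Real.rpow_le_rpow_of_nonpos hw0 (hwρ _) (by norm_num)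
        _ ≤ ∑ l, |y l ⟨0, hd⟩ - z ⟨0, hd⟩| ^ (-(1 / 2) : ℝ) := rpow_halfWidth_le _
        _ ≤ invSqrtSum Finset.univ y z := Finset.single_le_sum
            (f := fun j : Fin d => ∑ l, |y l j - z j| ^ (-(1 / 2) : ℝ))
            (fun _ _ => Finset.sum_nonneg fun _ _ => Real.rpow_nonneg (abs_nonneg _) _)
            (Finset.mem_univ _)
    -- Since the mass is at most 1, only a lower bound is needed to control its logarithm, and this
    -- one also holds near the boundary.
    have hUlow : (1 - c) * ρ ^ d ≤ ballMass μ z ρ := h.pow_le_ballMass hz hρ0.le hρ1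
    have hU0 : 0 < (1 - c) * ρ ^ d := by positivity
    have h3 : |Real.log (ballMass μ z ρ)| ≤ -Real.log (1 - c) + d * |Real.log ρ| := by
      rw [abs_of_nonpos (Real.log_nonpos (hU0.le.trans hUlow) (ballMass_le_one _)),
        abs_of_nonpos (Real.log_nonpos hρ0.le hρ1)]
      have := Real.log_le_log hU0 hUlow
      rw [Real.log_mul hc1.ne' (by positivity), Real.log_pow] at this
      linarith
    have h4 := h.abs_log_density_le hz
    have h5 : |((d : ℝ) - 1) / k| ≤ d := by
      rw [abs_of_nonneg (div_nonneg (by linarith) (by linarith)), div_le_iff₀ (by linarith)]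
      nlinarith
    have h6 : (d : ℝ) * |Real.log ρ|
        ≤ d * (s + 2 * Real.exp (-s / 2) * invSqrtSum Finset.univ y z) := by gcongr
    calc |localError k q μ z y|
        ≤ |logCell k Finset.univ y z| + |Real.log (ballMass μ z ρ)| + |Real.log (q z)|
          + |((d : ℝ) - 1) / k| := by
          refine (abs_add_le _ _).trans (add_le_add ((abs_add_le _ _).trans
            (add_le_add (abs_sub _ _) le_rfl)) le_rfl)
      _ ≤ a + e * invSqrtSum Finset.univ y z := by
          have e1 : a + e * invSqrtSum Finset.univ y z
              = (d * s + 2 * Real.exp (-s / 2) * invSqrtSum Finset.univ y z)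
                + (-Real.log (1 - c)
                  + d * (s + 2 * Real.exp (-s / 2) * invSqrtSum Finset.univ y z))
                + (-Real.log (1 - c) + 1) + d := by
            rw [ha, he]; ring
          rw [e1]
          linarith
  have hG : IntegrableOn (localError k q μ z) Sᶜ P :=
    (h.integrable_localError (ι := ι) hd hk hkn hz).integrableOn
  have hconst : IntegrableOn (fun _ : ι → Vec d => a) Sᶜ P := (integrable_const a).integrableOn
  calc |∫ y in Sᶜ, localError k q μ z y ∂P|
      ≤ ∫ y in Sᶜ, |localError k q μ z y| ∂P := abs_integral_le_integral_abs
    _ ≤ ∫ y in Sᶜ, (a + e * invSqrtSum Finset.univ y z) ∂P :=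
        integral_mono_ae hG.abs (hconst.add (hI.integrableOn.const_mul e))
          (ae_restrict_of_ae hbound)
    _ = a * P.real Sᶜ + e * ∫ y in Sᶜ, invSqrtSum Finset.univ y z ∂P := by
        rw [integral_add hconst (hI.integrableOn.const_mul e), integral_const_mul,
          setIntegral_const, smul_eq_mul, mul_comm]
    _ ≤ _ := by
        have h7 : ∫ y in Sᶜ, invSqrtSum Finset.univ y z ∂P ≤ 8 * d * Fintype.card ι :=
          (setIntegral_le_integral hI
            (Eventually.of_forall fun _ => invSqrtSum_nonneg)).trans hIle
        rw [hSc] at h7 ⊢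
        gcongr

lemma abs_integral_localError_le {b D s : ℝ} (hb : 0 < b) (hD : 0 < D) (hs : 0 ≤ s)
    (hzD : Metric.closedBall z D ⊆ openCube d)
    (hbd : b ^ d = (1 - c) * (Fintype.card ι + 1)) :
    |∫ y, localError k q μ z y ∂(Measure.pi fun _ : ι => μ)|
      ≤ (2 ^ (k + 1) * d / (1 - c) ^ k + 1 / (1 - c)) * ((k + 1) / b)
        + ((2 * d * s - 2 * Real.log (1 - c) + 1 + d)
          * (2 * (1 + k * (k + 1)) * (1 + (b * D) ^ 2)⁻¹)
        + 2 * (1 + d) * Real.exp (-s / 2) * (8 * d * Fintype.card ι)) := by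
  have hρm : Measurable fun y : ι → Vec d => (knnRadius k Finset.univ y z : ℝ) :=
    (measurable_knnRadius k _ measurable_id measurable_const).coe_nnreal_real
  rw [← integral_add_compl (measurableSet_le hρm measurable_const)
    (h.integrable_localError (ι := ι) hd hk hkn hz)]
  exact (abs_add_le _ _).trans (add_le_add
    (h.setIntegral_localError_near_le hd hk hkn hz hb hD.le hzD hbd)
    (h.setIntegral_localError_far_le hd hk hkn hz hb hD hs hbd))

end

end NearUniform

/-! ### Separating one sample point from the others -/

section Peeling

variable {d k n : ℕ}

lemma univ_erase_eq_map_succAboveEmb (i : Fin (n + 1)) :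
    (Finset.univ.erase i) = (Finset.univ : Finset (Fin n)).map i.succAboveEmb := by
  ext j
  simp only [Finset.mem_erase, Finset.mem_univ, and_true, Finset.mem_map, true_and,
    Fin.succAboveEmb_apply]
  exact (Fin.exists_succAbove_eq_iff).symm

lemma logCell_erase_eq (i : Fin (n + 1)) (x : Fin (n + 1) → Vec d) (z : Vec d) :
    logCell k (Finset.univ.erase i) x z
      = logCell k Finset.univ (fun j => x (i.succAbove j)) z := by
  rw [univ_erase_eq_map_succAboveEmb, logCell_map]
  rfl

lemma invSqrtSum_erase_eq (i : Fin (n + 1)) (x : Fin (n + 1) → Vec d) (z : Vec d) :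
    invSqrtSum (Finset.univ.erase i) x z
      = invSqrtSum Finset.univ (fun j => x (i.succAbove j)) z := by
  simp [invSqrtSum, univ_erase_eq_map_succAboveEmb, Finset.sum_map]

lemma nearest_erase_eq (i : Fin (n + 1)) (x : Fin (n + 1) → Vec d) (z : Vec d) :
    nearest k (Finset.univ.erase i) x z
      = (nearest k Finset.univ (fun j => x (i.succAbove j)) z).map i.succAboveEmb := by
  rw [univ_erase_eq_map_succAboveEmb, nearest_map]
  rfl

/-- Separating the `i`-th of independent points from the others. -/
lemma measurePreserving_peel {X : Type*} [MeasurableSpace X] (μ : Measure X) [SigmaFinite μ]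
    (i : Fin (n + 1)) :
    MeasurePreserving (fun x : Fin (n + 1) → X => (x i, fun j => x (i.succAbove j)))
      (Measure.pi fun _ => μ) (μ.prod (Measure.pi fun _ => μ)) :=
  measurePreserving_piFinSuccAbove (fun _ => μ) i

lemma ae_pi_of_peel {X : Type*} [MeasurableSpace X] {μ : Measure X} [IsProbabilityMeasure μ]
    (i : Fin (n + 1)) {p : X → (Fin n → X) → Prop}
    (hp : MeasurableSet {w : X × (Fin n → X) | p w.1 w.2})
    (h : ∀ᵐ z ∂μ, ∀ᵐ y ∂(Measure.pi fun _ : Fin n => μ), p z y) :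
    ∀ᵐ x ∂(Measure.pi fun _ : Fin (n + 1) => μ), p (x i) fun j => x (i.succAbove j) :=
  (measurePreserving_peel μ i).quasiMeasurePreserving.ae
    (p := fun w : X × (Fin n → X) => p w.1 w.2) ((Measure.ae_prod_iff_ae_ae hp).2 h)

end Peeling

namespace NearUniform

variable {d k n : ℕ} {c : ℝ} {q : Vec d → ℝ} {μ : Measure (Vec d)}

lemma integral_invSqrtSum_erase (h : NearUniform c q μ) (i : Fin (n + 1)) :
    Integrable (fun x : Fin (n + 1) → Vec d => invSqrtSum (Finset.univ.erase i) x (x i))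
      (Measure.pi fun _ => μ) ∧
    ∫ x : Fin (n + 1) → Vec d, invSqrtSum (Finset.univ.erase i) x (x i)
      ∂(Measure.pi fun _ => μ) ≤ 8 * d * n := by
  have := h.isProb
  set F : Vec d × (Fin n → Vec d) → ℝ := fun w => invSqrtSum Finset.univ w.2 w.1 with hF
  have hm : Measurable F := by
    simp only [hF, invSqrtSum]
    fun_prop
  have hle : ∀ᵐ z ∂μ, ∫ y, F (z, y) ∂(Measure.pi fun _ : Fin n => μ) ≤ 8 * d * n := by
    filter_upwards [h.ae_mem] with z hz
    simpa using (h.integral_invSqrtSum (ι := Fin n) hz).2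
  have h0 : ∀ z, 0 ≤ ∫ y, F (z, y) ∂(Measure.pi fun _ : Fin n => μ) := fun z =>
    integral_nonneg fun y => invSqrtSum_nonneg
  have hint : Integrable F (μ.prod (Measure.pi fun _ => μ)) := by
    rw [integrable_prod_iff hm.aestronglyMeasurable]
    constructor
    · filter_upwards [h.ae_mem] with z hz
      exact (h.integral_invSqrtSum (ι := Fin n) hz).1
    · have hn : ∀ w, ‖F w‖ = F w := fun w => Real.norm_of_nonneg invSqrtSum_nonneg
      simp_rw [hn]
      refine Integrable.mono' (integrable_const (8 * d * n : ℝ))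
        hm.stronglyMeasurable.integral_prod_right.aestronglyMeasurable ?_
      filter_upwards [hle] with z hz
      rw [Real.norm_of_nonneg (h0 z)]
      exact hz
  have hmp := measurePreserving_peel μ i
  have hcongr : ∀ x : Fin (n + 1) → Vec d, invSqrtSum (Finset.univ.erase i) x (x i)
      = F (x i, fun j => x (i.succAbove j)) := fun x => invSqrtSum_erase_eq i x (x i)
  simp_rw [hcongr]
  refine ⟨hmp.integrable_comp_of_integrable hint, ?_⟩
  have e := integral_map (μ := Measure.pi fun _ : Fin (n + 1) => μ) hmp.measurable.aemeasurable
    (f := F) hm.aestronglyMeasurable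
  rw [hmp.map_eq] at e
  rw [← e, integral_prod _ hint]
  calc ∫ z, ∫ y, F (z, y) ∂(Measure.pi fun _ : Fin n => μ) ∂μ ≤ ∫ _z, (8 * d * n : ℝ) ∂μ :=
        integral_mono_ae hint.integral_prod_left (integrable_const _) hle
    _ = _ := by simp

/-- The inverse square root majorant gives joint integrability, after which Fubini turns the mean of
the `i`-th summand into an average over its centre `z`. The result is the same for all `i`. -/
lemma integral_logCell_erase (h : NearUniform c q μ) (i : Fin (n + 1)) :
    Integrable (fun x : Fin (n + 1) → Vec d => logCell k (Finset.univ.erase i) x (x i))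
      (Measure.pi fun _ => μ) ∧
    Integrable (fun z => ∫ y, logCell k Finset.univ y z ∂(Measure.pi fun _ : Fin n => μ)) μ ∧
    ∫ x : Fin (n + 1) → Vec d, logCell k (Finset.univ.erase i) x (x i)
      ∂(Measure.pi fun _ => μ)
      = ∫ z, ∫ y, logCell k Finset.univ y z ∂(Measure.pi fun _ : Fin n => μ) ∂μ := by
  have := h.isProb
  set F : Vec d × (Fin n → Vec d) → ℝ := fun w => logCell k Finset.univ w.2 w.1 with hF
  have hm : Measurable F := measurable_logCell k _ measurable_snd measurable_fst
  have hmp := measurePreserving_peel (n := n) μ i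
  have hcongr : ∀ x : Fin (n + 1) → Vec d, logCell k (Finset.univ.erase i) x (x i)
      = F (x i, fun j => x (i.succAbove j)) := fun x => logCell_erase_eq i x (x i)
  have hintx : Integrable (fun x : Fin (n + 1) → Vec d =>
      logCell k (Finset.univ.erase i) x (x i)) (Measure.pi fun _ => μ) := by
    refine Integrable.mono' ((h.integral_invSqrtSum_erase i).1.const_mul 2)
      (measurable_logCell k _ measurable_id (measurable_pi_apply i)).aestronglyMeasurable ?_
    filter_upwards [h.ae_forall_mem] with x hx
    have := abs_logCell_le (k := k) (J := Finset.univ.erase i) (hx i) (fun l _ => hx l) le_rfl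
    simpa using this
  have hint : Integrable F (μ.prod (Measure.pi fun _ => μ)) := by
    rw [← hmp.map_eq, integrable_map_measure hm.aestronglyMeasurable hmp.measurable.aemeasurable]
    exact hintx.congr (Eventually.of_forall hcongr)
  refine ⟨hintx, hint.integral_prod_left, ?_⟩
  simp_rw [hcongr]
  have e := integral_map (μ := Measure.pi fun _ : Fin (n + 1) => μ) hmp.measurable.aemeasurable
    (f := F) hm.aestronglyMeasurable
  rw [hmp.map_eq] at e
  rw [← e, integral_prod _ hint]

end NearUniform

/-! ### Averaging the boundary effect -/

section Boundary

variable {d : ℕ}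

/-- A weight concentrated near the boundary of the cube. -/
def boundaryWeight (b : ℝ) (z : Vec d) : ℝ :=
  ∑ j, ((1 + (b / 2 * z j) ^ 2)⁻¹ + (1 + (b / 2 * (1 - z j)) ^ 2)⁻¹)

/-- `D` is half the distance to the nearest face; the half keeps the closed ball inside the open
cube and explains `b / 2` in the weight. The term of that face is exactly the left-hand side, so the
sum over all faces dominates it. -/
lemma exists_closedBall_subset_openCube (hd : 1 ≤ d) {z : Vec d} (hz : z ∈ openCube d) {b : ℝ} :
    ∃ D, 0 < D ∧ Metric.closedBall z D ⊆ openCube d ∧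
      (1 + (b * D) ^ 2)⁻¹ ≤ boundaryWeight b z := by
  obtain ⟨j, -, hj⟩ := Finset.exists_min_image (Finset.univ : Finset (Fin d))
    (fun j => min (z j) (1 - z j)) ⟨⟨0, hd⟩, Finset.mem_univ _⟩
  have hpos : ∀ i, 0 < min (z i) (1 - z i) := fun i => lt_min (hz i).1 (by linarith [(hz i).2])
  refine ⟨min (z j) (1 - z j) / 2, half_pos (hpos j), fun w hw i => ?_, ?_⟩
  · have h1 : |w i - z i| ≤ min (z j) (1 - z j) / 2 := by
      rw [← Real.dist_eq]
      exact (dist_le_pi_dist w z i).trans hw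
    have h2 := hj i (Finset.mem_univ i)
    have h3 := hpos i
    have h4 := min_le_left (z i) (1 - z i)
    have h5 := min_le_right (z i) (1 - z i)
    rw [abs_le] at h1
    constructor <;> linarith [h1.1, h1.2]
  · have hnn : ∀ i : Fin d, 0 ≤ (1 + (b / 2 * z i) ^ 2)⁻¹ + (1 + (b / 2 * (1 - z i)) ^ 2)⁻¹ :=
      fun i => by positivity
    refine le_trans ?_ (Finset.single_le_sum (fun i _ => hnn i) (Finset.mem_univ j))
    rcases min_choice (z j) (1 - z j) with h | h <;> rw [h]
    · refine le_trans (le_of_eq ?_) (le_add_of_nonneg_right (by positivity))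
      ring
    · refine le_trans (le_of_eq ?_) (le_add_of_nonneg_left (by positivity))
      ring

lemma integral_Ioo_inv_one_add_sq_le {a : ℝ} (ha : 0 < a) :
    ∫ t in Set.Ioo (0 : ℝ) 1, (1 + (a * t) ^ 2)⁻¹ ≤ 2 / a := by
  rw [← integral_Ioc_eq_integral_Ioo, ← intervalIntegral.integral_of_le zero_le_one,
    intervalIntegral.integral_comp_mul_left (fun t => (1 + t ^ 2)⁻¹) ha.ne',
    integral_inv_one_add_sq, smul_eq_mul, mul_zero, Real.arctan_zero, sub_zero, inv_mul_eq_div]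
  gcongr
  linarith [Real.arctan_lt_pi_div_two (a * 1), Real.pi_le_four]

lemma integral_Ioo_inv_one_add_sq_reflect_le {a : ℝ} (ha : 0 < a) :
    ∫ t in Set.Ioo (0 : ℝ) 1, (1 + (a * (1 - t)) ^ 2)⁻¹ ≤ 2 / a := by
  refine le_trans (le_of_eq ?_) (integral_Ioo_inv_one_add_sq_le ha)
  rw [← integral_Ioc_eq_integral_Ioo, ← intervalIntegral.integral_of_le zero_le_one,
    ← integral_Ioc_eq_integral_Ioo, ← intervalIntegral.integral_of_le zero_le_one,
    intervalIntegral.integral_comp_sub_left (fun t => (1 + (a * t) ^ 2)⁻¹)]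
  simp

variable {c : ℝ} {q : Vec d → ℝ} {μ : Measure (Vec d)}

lemma NearUniform.integral_coord_le (h : NearUniform c q μ) (j : Fin d) {f : ℝ → ℝ}
    (hf : Measurable f) (hf0 : ∀ t, 0 ≤ f t) (hf1 : ∀ t, f t ≤ 1) :
    Integrable (fun z : Vec d => f (z j)) μ ∧
      ∫ z, f (z j) ∂μ ≤ 2 * ∫ t in Set.Ioo (0 : ℝ) 1, f t := by
  have := h.isProb
  have hpi : volume.restrict (openCube d)
      = Measure.pi fun _ : Fin d => volume.restrict (Set.Ioo (0 : ℝ) 1) := by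
    rw [openCube_eq_pi, volume_pi, Measure.restrict_pi_pi]
  have : IsProbabilityMeasure (volume.restrict (Set.Ioo (0 : ℝ) 1)) := ⟨by simp⟩
  have hm : Measurable fun z : Vec d => f (z j) := hf.comp (measurable_pi_apply j)
  have hint : ∀ {Y : Type} [MeasurableSpace Y] (ν : Measure Y) [IsProbabilityMeasure ν] {g : Y → ℝ},
      Measurable g → Integrable (fun y => f (g y)) ν := fun ν _ g hg =>
    Integrable.mono' (integrable_const (1 : ℝ)) (hf.comp hg).aestronglyMeasurable
      (Eventually.of_forall fun y => by rw [Real.norm_of_nonneg (hf0 _)]; exact hf1 _)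
  refine ⟨hint μ (measurable_pi_apply j), ?_⟩
  have h1 := h.lintegral_le fun z => ENNReal.ofReal (f (z j))
  rw [hpi, (measurePreserving_eval (fun _ : Fin d => volume.restrict (Set.Ioo (0 : ℝ) 1))
    j).lintegral_comp (f := fun t => ENNReal.ofReal (f t)) hf.ennreal_ofReal,
    ← ofReal_integral_eq_lintegral_ofReal (hint μ (measurable_pi_apply j))
      (Eventually.of_forall fun z => hf0 _),
    ← ofReal_integral_eq_lintegral_ofReal (f := f) (hint _ measurable_id)
      (Eventually.of_forall fun z => hf0 _), ← ENNReal.ofReal_ofNat 2,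
    ← ENNReal.ofReal_mul zero_le_two] at h1
  exact (ENNReal.ofReal_le_ofReal_iff
    (mul_nonneg zero_le_two (integral_nonneg fun t => hf0 _))).1 h1

/-- The density is at most 2 and the arctangent integral at most `2 / (b / 2)`, so each of the `2 *
d` faces contributes at most `8 / b`. -/
lemma NearUniform.integral_boundaryWeight_le (h : NearUniform c q μ) {b : ℝ} (hb : 0 < b) :
    Integrable (boundaryWeight (d := d) b) μ ∧
      ∫ z, boundaryWeight b z ∂μ ≤ 16 * d / b := by
  have h1 := fun j : Fin d => h.integral_coord_le j (f := fun t => (1 + (b / 2 * t) ^ 2)⁻¹)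
    (by fun_prop) (fun t => by positivity)
    fun t => inv_le_one_of_one_le₀ (by nlinarith [sq_nonneg (b / 2 * t)])
  have h2 := fun j : Fin d => h.integral_coord_le j (f := fun t => (1 + (b / 2 * (1 - t)) ^ 2)⁻¹)
    (by fun_prop) (fun t => by positivity)
    fun t => inv_le_one_of_one_le₀ (by nlinarith [sq_nonneg (b / 2 * (1 - t))])
  have hi : ∀ j : Fin d, Integrable (fun z : Vec d => (1 + (b / 2 * z j) ^ 2)⁻¹
      + (1 + (b / 2 * (1 - z j)) ^ 2)⁻¹) μ := fun j => (h1 j).1.add (h2 j).1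
  refine ⟨integrable_finsetSum _ fun j _ => hi j, ?_⟩
  unfold boundaryWeight
  rw [integral_finsetSum _ fun j _ => hi j]
  have h3 : ∀ j : Fin d, ∫ z : Vec d, ((1 + (b / 2 * z j) ^ 2)⁻¹
      + (1 + (b / 2 * (1 - z j)) ^ 2)⁻¹) ∂μ ≤ 16 / b := fun j => by
    rw [integral_add (h1 j).1 (h2 j).1]
    have e1 := (h1 j).2.trans (mul_le_mul_of_nonneg_left
      (integral_Ioo_inv_one_add_sq_le (half_pos hb)) zero_le_two)
    have e2 := (h2 j).2.trans (mul_le_mul_of_nonneg_left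
      (integral_Ioo_inv_one_add_sq_reflect_le (half_pos hb)) zero_le_two)
    have e3 : 2 * (2 / (b / 2)) + 2 * (2 / (b / 2)) = 16 / b := by field_simp; norm_num
    linarith
  refine (Finset.sum_le_sum fun j _ => h3 j).trans_eq ?_
  simp
  ring

end Boundary

/-! ### Bias of the truncated estimator -/

namespace NearUniform

variable {d k n : ℕ} {c : ℝ} {q : Vec d → ℝ} {μ : Measure (Vec d)}

lemma integrable_log_density (h : NearUniform c q μ) : Integrable (fun z => Real.log (q z)) μ := by
  have := h.isProb
  refine Integrable.mono' (integrable_const (-Real.log (1 - c) + 1))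
    (Real.measurable_log.comp h.measurable).aestronglyMeasurable ?_
  filter_upwards [h.ae_mem] with z hz using h.abs_log_density_le hz

lemma tKSG_eq (x : Fin (n + 1) → Vec d) :
    tKSG k x = -psi k + psi ((n : ℝ) + 1) + ((d : ℝ) - 1) / k
      + (1 / ((n : ℝ) + 1)) * ∑ i, logCell k (Finset.univ.erase i) x (x i) := by
  rw [tKSG]
  simp only [log_zetaRect_sum]
  push_cast
  ring

lemma integral_tKSG (h : NearUniform c q μ) :
    Integrable (fun x : Fin (n + 1) → Vec d => tKSG k x) (Measure.pi fun _ => μ) ∧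
    ∫ x : Fin (n + 1) → Vec d, tKSG k x ∂(Measure.pi fun _ => μ)
      = -psi k + psi ((n : ℝ) + 1) + ((d : ℝ) - 1) / k
        + ∫ z, ∫ y, logCell k Finset.univ y z ∂(Measure.pi fun _ : Fin n => μ) ∂μ := by
  have := h.isProb
  have hi := fun i : Fin (n + 1) => h.integral_logCell_erase (k := k) i
  have hs : Integrable (fun x : Fin (n + 1) → Vec d =>
      ∑ i, logCell k (Finset.univ.erase i) x (x i)) (Measure.pi fun _ => μ) :=
    integrable_finsetSum _ fun i _ => (hi i).1
  simp_rw [tKSG_eq]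
  refine ⟨(integrable_const _).add (hs.const_mul _), ?_⟩
  rw [integral_add (integrable_const _) (hs.const_mul _), integral_const_mul,
    integral_finsetSum _ fun i _ => (hi i).1]
  simp only [(hi _).2.2]
  have : (n : ℝ) + 1 ≠ 0 := by positivity
  simp
  field_simp

/-- The bias of the truncated estimator. -/
lemma abs_integral_tKSG_add_le (h : NearUniform c q μ) (hd : 1 ≤ d) (hk : 1 ≤ k) (hkn : k ≤ n)
    {b s : ℝ} (hb : 0 < b) (hs : 0 ≤ s) (hbd : b ^ d = (1 - c) * (n + 1)) :
    |∫ x : Fin (n + 1) → Vec d, tKSG k x ∂(Measure.pi fun _ => μ) + ∫ z, Real.log (q z) ∂μ|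
      ≤ (2 ^ (k + 1) * d / (1 - c) ^ k + 1 / (1 - c)) * ((k + 1) / b)
        + ((2 * d * s - 2 * Real.log (1 - c) + 1 + d)
          * (2 * (1 + k * (k + 1)) * (16 * d / b))
        + 2 * (1 + d) * Real.exp (-s / 2) * (8 * d * n)) := by
  have := h.isProb
  have hc1 : 0 < 1 - c := sub_pos.2 h.lt_one
  have hlc := Real.log_nonpos hc1.le (by linarith [h.nonneg])
  obtain ⟨hw, hwle⟩ := h.integral_boundaryWeight_le hb
  have hlq := h.integrable_log_density
  have hI := (h.integral_logCell_erase (k := k) (0 : Fin (n + 1))).2.1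
  have hkn' : k ≤ Fintype.card (Fin n) := by simpa using hkn
  -- The digamma terms and `(d - 1)/k` in the estimator are those of the mean local error, so the
  -- bias is the averaged local error without remainder.
  have heq : ∫ x : Fin (n + 1) → Vec d, tKSG k x ∂(Measure.pi fun _ => μ) + ∫ z, Real.log (q z) ∂μ
      = ∫ z, ∫ y, localError k q μ z y ∂(Measure.pi fun _ : Fin n => μ) ∂μ := by
    have h1 : ∫ z, ∫ y, localError k q μ z y ∂(Measure.pi fun _ : Fin n => μ) ∂μ
        = ∫ z, (((∫ y, logCell k Finset.univ y z ∂(Measure.pi fun _ : Fin n => μ))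
          + Real.log (q z)) + (-psi k + psi ((n : ℝ) + 1) + ((d : ℝ) - 1) / k)) ∂μ := by
      refine integral_congr_ae ?_
      filter_upwards [h.ae_mem] with z hz
      rw [h.integral_localError hd hk hkn' hz, Fintype.card_fin]
      ring
    have h2 : Integrable (fun z => (∫ y, logCell k Finset.univ y z
        ∂(Measure.pi fun _ : Fin n => μ)) + Real.log (q z)) μ := hI.add hlq
    rw [h1, integral_add h2 (integrable_const _), integral_add hI hlq, h.integral_tKSG.2,
      integral_const]
    simp
    ring
  set A := (2 ^ (k + 1) * d / (1 - c) ^ k + 1 / (1 - c)) * ((k + 1) / b)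
  set B := (2 * d * s - 2 * Real.log (1 - c) + 1 + d) * (2 * (1 + k * (k + 1)))
  set E := 2 * (1 + d) * Real.exp (-s / 2) * (8 * d * n)
  have hB0 : 0 ≤ B := by
    have : 0 ≤ 2 * d * s - 2 * Real.log (1 - c) + 1 + d := by
      have : 0 ≤ (d : ℝ) * s := by positivity
      have : (0 : ℝ) ≤ d := Nat.cast_nonneg d
      linarith
    positivity
  have hpt : ∀ᵐ z ∂μ, ‖∫ y, localError k q μ z y ∂(Measure.pi fun _ : Fin n => μ)‖
      ≤ (A + E) + B * boundaryWeight b z := by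
    filter_upwards [h.ae_mem] with z hz
    -- The splitting radius may depend on `z`: only the tail factor sees it, and that factor is
    -- replaced by the boundary weight before integrating.
    obtain ⟨D, hD, hzD, hDw⟩ := exists_closedBall_subset_openCube hd hz (b := b)
    have h3 := h.abs_integral_localError_le hd hk hkn' hz hb hD hs hzD
      (by rw [hbd, Fintype.card_fin])
    rw [Fintype.card_fin, ← mul_assoc (2 * (d : ℝ) * s - _ + _ + _)] at h3
    have h4 := mul_le_mul_of_nonneg_left hDw hB0
    rw [Real.norm_eq_abs]
    linarith
  have hmaj : Integrable (fun z => (A + E) + B * boundaryWeight b z) μ :=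
    (integrable_const _).add (hw.const_mul _)
  rw [heq]
  calc |∫ z, ∫ y, localError k q μ z y ∂(Measure.pi fun _ : Fin n => μ) ∂μ|
      ≤ ∫ z, ((A + E) + B * boundaryWeight b z) ∂μ := norm_integral_le_of_norm_le hmaj hpt
    _ = (A + E) + B * ∫ z, boundaryWeight b z ∂μ := by
        rw [integral_add (integrable_const _) (hw.const_mul _), integral_const_mul, integral_const]
        simp
    _ ≤ (A + E) + B * (16 * d / b) := by gcongr
    _ = _ := by ring

end NearUniform

/-! ### The Efron–Stein inequality -/

section EfronStein

variable {X Y : Type*} [MeasurableSpace X] [MeasurableSpace Y]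

lemma integral_sub_const_sq {ν : Measure Y} [IsProbabilityMeasure ν] {φ : Y → ℝ}
    (hφ : MemLp φ 2 ν) (a : ℝ) :
    ∫ y, (φ y - a) ^ 2 ∂ν = ∫ y, (φ y - ∫ y, φ y ∂ν) ^ 2 ∂ν + (∫ y, φ y ∂ν - a) ^ 2 := by
  set m := ∫ y, φ y ∂ν with hm
  have h1 : Integrable φ ν := hφ.integrable one_le_two
  have h2 : Integrable (fun y => (φ y - m) ^ 2) ν := (hφ.sub (memLp_const m)).integrable_sq
  have h3 : Integrable (fun y => 2 * (m - a) * (φ y - m)) ν :=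
    (h1.sub (integrable_const m)).const_mul _
  have h4 : Integrable (fun y => 2 * (m - a) * (φ y - m) + (m - a) ^ 2) ν :=
    h3.add (integrable_const _)
  have e : ∀ y, (φ y - a) ^ 2 = (φ y - m) ^ 2 + (2 * (m - a) * (φ y - m) + (m - a) ^ 2) :=
    fun y => by ring
  simp_rw [e]
  rw [integral_add h2 h4, integral_add h3 (integrable_const _), integral_const_mul,
    integral_sub h1 (integrable_const m), ← hm]
  simp

lemma sq_integral_le_integral_sq {ν : Measure Y} [IsProbabilityMeasure ν] {φ : Y → ℝ}
    (hφ : MemLp φ 2 ν) : (∫ y, φ y ∂ν) ^ 2 ≤ ∫ y, φ y ^ 2 ∂ν := by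
  have h := integral_sub_const_sq hφ 0
  simp only [sub_zero] at h
  rw [h]
  exact le_add_of_nonneg_left (integral_nonneg fun y => sq_nonneg _)

lemma MeasureTheory.MemLp.prodMk_left_ae {μ : Measure X} {ν : Measure Y} [IsProbabilityMeasure μ]
    [IsProbabilityMeasure ν] {f : X × Y → ℝ} (hm : Measurable f) (hf : MemLp f 2 (μ.prod ν)) :
    ∀ᵐ x ∂μ, MemLp (fun y => f (x, y)) 2 ν := by
  filter_upwards [hf.integrable_sq.prod_right_ae] with x hx
  exact (memLp_two_iff_integrable_sq (hm.comp measurable_prodMk_left).aestronglyMeasurable).2 hx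

/-- The **Efron–Stein inequality**. -/
lemma efronStein (μ : Measure X) [IsProbabilityMeasure μ] (n : ℕ) (f : (Fin n → X) → ℝ)
    (g : Fin n → (Fin n → X) → ℝ) (hfm : Measurable f) (hgm : ∀ i, Measurable (g i))
    (hf : MemLp f 2 (Measure.pi fun _ => μ)) (hg : ∀ i, MemLp (g i) 2 (Measure.pi fun _ => μ))
    (hupd : ∀ i x a, g i (Function.update x i a) = g i x) :
    ∫ x, (f x - ∫ x, f x ∂(Measure.pi fun _ => μ)) ^ 2 ∂(Measure.pi fun _ => μ)
      ≤ ∑ i, ∫ x, (f x - g i x) ^ 2 ∂(Measure.pi fun _ => μ) := by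
  induction n with
  | zero =>
    have hs : ∀ x : Fin 0 → X, f x = f default := fun x => congrArg f (Subsingleton.elim _ _)
    simp [hs]
  | succ n ih =>
    set P := Measure.pi fun _ : Fin n => μ
    let cons : X × (Fin n → X) → (Fin (n + 1) → X) := fun w => Fin.cons w.1 w.2
    have hcons : MeasurePreserving cons (μ.prod P) (Measure.pi fun _ => μ) := by
      have := (measurePreserving_piFinSuccAbove (fun _ : Fin (n + 1) => μ) 0).symm
      convert this using 1
      ext w i
      simp [cons, MeasurableEquiv.piFinSuccAbove, Fin.insertNthEquiv]
    have hint : ∀ {φ : (Fin (n + 1) → X) → ℝ}, Measurable φ →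
        ∫ x, φ x ∂(Measure.pi fun _ => μ) = ∫ w, φ (cons w) ∂(μ.prod P) := fun hφ => by
      rw [← hcons.map_eq, integral_map hcons.measurable.aemeasurable hφ.aestronglyMeasurable]
    set F : X × (Fin n → X) → ℝ := fun w => f (cons w)
    set G : Fin (n + 1) → X × (Fin n → X) → ℝ := fun i w => g i (cons w)
    have hFm : Measurable F := hfm.comp hcons.measurable
    have hGm : ∀ i, Measurable (G i) := fun i => (hgm i).comp hcons.measurable
    have hF : MemLp F 2 (μ.prod P) := hf.comp_measurePreserving hcons
    have hG : ∀ i, MemLp (G i) 2 (μ.prod P) := fun i => (hg i).comp_measurePreserving hcons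
    have hFG : ∀ i, Integrable (fun w => (F w - G i w) ^ 2) (μ.prod P) := fun i =>
      (hF.sub (hG i)).integrable_sq
    rw [hint ((hfm.sub_const _).pow_const 2)]
    have hsum : ∑ i, ∫ x, (f x - g i x) ^ 2 ∂(Measure.pi fun _ => μ)
        = ∑ i, ∫ w, (F w - G i w) ^ 2 ∂(μ.prod P) :=
      Finset.sum_congr rfl fun i _ => hint ((hfm.sub (hgm i)).pow_const 2)
    rw [hsum, hint hfm]
    change ∫ w, (F w - ∫ w, F w ∂(μ.prod P)) ^ 2 ∂(μ.prod P) ≤ _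
    set m := ∫ w, F w ∂(μ.prod P) with hm
    -- `M` is the conditional mean given the first coordinate. The variance is the mean of the
    -- conditional variances, handled by induction, plus the variance of `M`.
    set M : X → ℝ := fun x => ∫ y, F (x, y) ∂P with hMdef
    have hMm : Measurable M := hFm.stronglyMeasurable.integral_prod_right.measurable
    have hF1 : Integrable F (μ.prod P) := hF.integrable one_le_two
    have hMint : ∫ x, M x ∂μ = m := (integral_prod F hF1).symm
    have hMsq : MemLp M 2 μ := by
      rw [memLp_two_iff_integrable_sq hMm.aestronglyMeasurable]
      refine Integrable.mono' hF.integrable_sq.integral_prod_left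
        (hMm.pow_const 2).aestronglyMeasurable ?_
      filter_upwards [hF.prodMk_left_ae hFm] with x hx
      rw [Real.norm_of_nonneg (sq_nonneg _)]
      exact sq_integral_le_integral_sq hx
    have hstep : ∀ᵐ x ∂μ, ∫ y, (F (x, y) - m) ^ 2 ∂P
        ≤ (∑ i : Fin n, ∫ y, (F (x, y) - G i.succ (x, y)) ^ 2 ∂P) + (M x - m) ^ 2 := by
      filter_upwards [hF.prodMk_left_ae hFm,
        ae_all_iff.2 fun i : Fin n => (hG i.succ).prodMk_left_ae (hGm i.succ)] with x hFx hGx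
      rw [integral_sub_const_sq hFx]
      gcongr
      refine ih (fun y => F (x, y)) (fun i y => G i.succ (x, y))
        (hFm.comp measurable_prodMk_left) (fun i => (hGm _).comp measurable_prodMk_left) hFx hGx ?_
      intro i y a
      have : (Fin.cons x (Function.update y i a) : Fin (n + 1) → X)
          = Function.update (Fin.cons x y) i.succ a := Fin.cons_update ..
      simp only [G, cons]
      rw [this, hupd]
    have hzero : ∫ x, (M x - m) ^ 2 ∂μ ≤ ∫ w, (F w - G 0 w) ^ 2 ∂(μ.prod P) := by
      -- `G 0` ignores the first coordinate, so its mean over the others is a constant `a`, computed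
      -- at an arbitrary `x0`. The variance of `M` is at most its mean squared distance to `a`, and
      -- Jensen bounds that by the term of index 0.
      obtain ⟨x0⟩ : Nonempty X := μ.nonempty_of_neZero
      have hGx : ∀ x y, G 0 (x, y) = G 0 (x0, y) := fun x y => by
        have : (Fin.cons x y : Fin (n + 1) → X) = Function.update (Fin.cons x0 y) 0 x := by simp
        simp only [G, cons]
        rw [this, hupd]
      set a := ∫ y, G 0 (x0, y) ∂P
      have h1 := integral_sub_const_sq hMsq a
      rw [hMint] at h1
      have h2 : ∫ x, (M x - m) ^ 2 ∂μ ≤ ∫ x, (M x - a) ^ 2 ∂μ := by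
        rw [h1]
        exact le_add_of_nonneg_right (sq_nonneg _)
      refine h2.trans ?_
      rw [integral_prod _ (hFG 0)]
      refine integral_mono_ae (hMsq.sub (memLp_const a)).integrable_sq
        (hFG 0).integral_prod_left ?_
      filter_upwards [hF.prodMk_left_ae hFm, (hG 0).prodMk_left_ae (hGm 0)] with x hFx hGx'
      have h3 : M x - a = ∫ y, (F (x, y) - G 0 (x, y)) ∂P := by
        rw [integral_sub (hFx.integrable one_le_two) (hGx'.integrable one_le_two)]
        simp only [hGx x]
        rfl
      change (M x - a) ^ 2 ≤ _
      rw [h3]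
      exact sq_integral_le_integral_sq (hFx.sub hGx')
    have hI1 : Integrable (fun w => (F w - m) ^ 2) (μ.prod P) :=
      (hF.sub (memLp_const m)).integrable_sq
    have hI2 : Integrable (fun x => (M x - m) ^ 2) μ := (hMsq.sub (memLp_const m)).integrable_sq
    have hI3 : ∀ i : Fin n, Integrable
        (fun x => ∫ y, (F (x, y) - G i.succ (x, y)) ^ 2 ∂P) μ := fun i =>
      (hFG i.succ).integral_prod_left
    rw [integral_prod _ hI1, Fin.sum_univ_succ, add_comm]
    calc ∫ x, ∫ y, (F (x, y) - m) ^ 2 ∂P ∂μ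
        ≤ ∫ x, ((∑ i : Fin n, ∫ y, (F (x, y) - G i.succ (x, y)) ^ 2 ∂P) + (M x - m) ^ 2) ∂μ :=
          integral_mono_ae hI1.integral_prod_left
            ((integrable_finsetSum _ fun i _ => hI3 i).add hI2) hstep
      _ = (∑ i : Fin n, ∫ w, (F w - G i.succ w) ^ 2 ∂(μ.prod P)) + ∫ x, (M x - m) ^ 2 ∂μ := by
          rw [integral_add (integrable_finsetSum _ fun i _ => hI3 i) hI2,
            integral_finsetSum _ fun i _ => hI3 i]
          congr 1
          exact Finset.sum_congr rfl fun i _ => (integral_prod _ (hFG i.succ)).symm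
      _ ≤ _ := by gcongr

end EfronStein

/-! ### How often a point is a nearest neighbour -/

section ReverseNeighbours

variable {ι : Type*} [Fintype ι] [DecidableEq ι] {d k : ℕ} {x : ι → Vec d}

/-- A point is among the `k` nearest neighbours of at most `k * 2 ^ d` other points. -/
lemma card_reverse_nearest_le (hd : 1 ≤ d) (l : ι) (hx : ∀ i, i ≠ l → ∀ j, x i j ≠ x l j) :
    (Finset.univ.filter fun i => l ∈ nearest k (Finset.univ.erase i) x (x i)).card
      ≤ k * 2 ^ d := by
  classical
  set R := Finset.univ.filter fun i => l ∈ nearest k (Finset.univ.erase i) x (x i) with hR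
  -- The orthant around `x l` that contains `x i`; there are `2 ^ d` of them, and at most `k`
  -- reverse neighbours lie in each.
  let o : ι → Fin d → Bool := fun i j => decide (x l j < x i j)
  have hRl : ∀ i ∈ R, i ≠ l := fun i hi => by
    have := (mem_nearest.1 (Finset.mem_filter.1 hi).2).1
    exact (Finset.ne_of_mem_erase this).symm
  have hfib : ∀ a ∈ R.image o, (R.filter fun i => o i = a).card ≤ k := by
    intro a ha
    set Q := R.filter fun i => o i = a with hQ
    have hQne : Q.Nonempty := by
      obtain ⟨i, hi, hia⟩ := Finset.mem_image.1 ha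
      exact ⟨i, Finset.mem_filter.2 ⟨hi, hia⟩⟩
    -- Take the point `i` of the orthant farthest from `x l`. Every other reverse neighbour in the
    -- orthant is strictly closer to `x i` than `x l` is, and fewer than `k` points can be.
    obtain ⟨i, hi, hmax⟩ := Finset.exists_max_image Q (fun i => dist (x l) (x i)) hQne
    obtain ⟨hiR, hia⟩ := Finset.mem_filter.1 hi
    have hil := hRl i hiR
    have hcard := (mem_nearest.1 (Finset.mem_filter.1 hiR).2).2
    have hsub : Q.erase i ⊆
        (Finset.univ.erase i).filter fun m => dist (x m) (x i) < dist (x l) (x i) := by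
      intro m hm
      obtain ⟨hmi, hmQ⟩ := Finset.mem_erase.1 hm
      obtain ⟨hmR, hma⟩ := Finset.mem_filter.1 hmQ
      have hml := hRl m hmR
      refine Finset.mem_filter.2 ⟨Finset.mem_erase.2 ⟨hmi, Finset.mem_univ _⟩, ?_⟩
      have hpos : 0 < dist (x l) (x i) := dist_pos.2 fun e => hx i hil ⟨0, hd⟩ (by rw [e])
      refine (dist_pi_lt_iff hpos).2 fun j => ?_
      have hi1 := dist_le_pi_dist (x l) (x i) j
      have hm1 := (dist_le_pi_dist (x l) (x m) j).trans (hmax m hmQ)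
      have hij := hx i hil j
      have hmj := hx m hml j
      have hs : (x l j < x i j) ↔ (x l j < x m j) := by
        have := congrFun (hia.trans hma.symm) j
        simpa [o] using this
      rw [Real.dist_eq, abs_le] at hi1 hm1
      rw [Real.dist_eq, abs_lt]
      -- In each coordinate the offsets of both points from `x l` have the same sign and size in
      -- `(0, r]`, where `r` is the distance from `x l` to `x i`; hence they differ by less than
      -- `r`.
      rcases lt_or_gt_of_ne hij with h1 | h1
      · have h2 : x m j < x l j := by
          rcases lt_or_gt_of_ne hmj with h2 | h2
          · exact h2
          · exact absurd (hs.2 h2) (not_lt.2 h1.le)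
        constructor <;> linarith [hi1.2, hm1.2]
      · have h2 := hs.1 h1
        constructor <;> linarith [hi1.1, hm1.1]
    have h1 := Finset.card_le_card hsub
    rw [Finset.card_erase_of_mem hi] at h1
    omega
  refine (Finset.card_le_mul_card_image R k hfib).trans (Nat.mul_le_mul_left k ?_)
  refine (Finset.card_le_univ _).trans_eq ?_
  simp

end ReverseNeighbours

lemma logCell_congr {ι : Type*} {d k : ℕ} {J : Finset ι} {x y : ι → Vec d} {z : Vec d}
    (h : ∀ l ∈ J, x l = y l) : logCell k J x z = logCell k J y z := by
  have h1 : nearest k J x z = nearest k J y z := by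
    refine Finset.filter_congr fun l hl => ?_
    rw [Finset.filter_congr fun m hm => by rw [h l hl, h m hm]]
  have h2 : ∀ j, halfWidth k J x z j = halfWidth k J y z j := fun j => by
    rw [halfWidth, halfWidth, h1]
    exact Finset.sup_congr rfl fun l hl => by rw [h l (mem_nearest.1 hl).1]
  simp [logCell, h2]

lemma memLp_two_of_sq_le {X : Type*} [MeasurableSpace X] {ν : Measure X} {φ E : X → ℝ}
    (hφ : Measurable φ) (hE : Integrable E ν) (h : ∀ᵐ x ∂ν, φ x ^ 2 ≤ E x) : MemLp φ 2 ν := by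
  rw [memLp_two_iff_integrable_sq hφ.aestronglyMeasurable]
  refine Integrable.mono' hE (hφ.pow_const 2).aestronglyMeasurable ?_
  filter_upwards [h] with x hx
  rwa [Real.norm_of_nonneg (sq_nonneg _)]

/-- Cauchy–Schwarz, first for three summands and then for the at most `K` terms indexed by `R l`,
followed by double counting: each `i` belongs to at most `k` of the sets `R l`. The constant 12 is
`3 * 4`. -/
lemma sum_sq_add_add_sum_le {ι : Type*} [Fintype ι] [DecidableEq ι] (R : ι → Finset ι) {K k : ℕ}
    (hR : ∀ l, (R l).card ≤ K) (hk : ∀ i, (Finset.univ.filter fun l => i ∈ R l).card ≤ k)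
    {φ g E : ι → ℝ} {δ : ι → ι → ℝ} (hφ : ∀ l, φ l ^ 2 ≤ E l) (hδ : ∀ i l, δ i l ^ 2 ≤ 4 * E i) :
    ∑ l, (φ l + g l + ∑ i ∈ R l, δ i l) ^ 2
      ≤ (3 + 12 * K * k) * ∑ i, E i + 3 * ∑ i, g i ^ 2 := by
  have hE : ∀ i, 0 ≤ E i := fun i => (sq_nonneg _).trans (hφ i)
  have h1 : ∀ l, (∑ i ∈ R l, δ i l) ^ 2 ≤ K * ∑ i ∈ R l, 4 * E i := fun l => by
    refine sq_sum_le_card_mul_sum_sq.trans ?_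
    have h2 : ∑ i ∈ R l, δ i l ^ 2 ≤ ∑ i ∈ R l, 4 * E i := Finset.sum_le_sum fun i _ => hδ i l
    have h3 : ((R l).card : ℝ) ≤ K := by exact_mod_cast hR l
    exact mul_le_mul h3 h2 (Finset.sum_nonneg fun i _ => sq_nonneg _) (Nat.cast_nonneg K)
  have h2 : ∀ l, (φ l + g l + ∑ i ∈ R l, δ i l) ^ 2
      ≤ 3 * E l + 3 * g l ^ 2 + 12 * K * ∑ i ∈ R l, E i := fun l => by
    have h3 := h1 l
    rw [← Finset.mul_sum] at h3
    set t := ∑ i ∈ R l, δ i l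
    have := hφ l
    nlinarith [sq_nonneg (φ l - g l), sq_nonneg (φ l - t), sq_nonneg (g l - t)]
  have h3 : ∑ l, ∑ i ∈ R l, E i ≤ k * ∑ i, E i := by
    have : ∀ l, ∑ i ∈ R l, E i = ∑ i, if i ∈ R l then E i else 0 := fun l => by
      rw [Finset.sum_ite_mem, Finset.univ_inter]
    simp_rw [this]
    rw [Finset.sum_comm, Finset.mul_sum]
    refine Finset.sum_le_sum fun i _ => ?_
    rw [← Finset.sum_filter, Finset.sum_const, nsmul_eq_mul]
    have : ((Finset.univ.filter fun l => i ∈ R l).card : ℝ) ≤ k := by exact_mod_cast hk i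
    exact mul_le_mul_of_nonneg_right this (hE i)
  refine (Finset.sum_le_sum fun l _ => h2 l).trans ?_
  rw [Finset.sum_add_distrib, Finset.sum_add_distrib, ← Finset.mul_sum, ← Finset.mul_sum,
    ← Finset.mul_sum]
  have : (12 : ℝ) * K * ∑ l, ∑ i ∈ R l, E i ≤ 12 * K * (k * ∑ i, E i) := by gcongr
  linarith

/-! ### Variance of the estimator -/

namespace NearUniform

variable {d k n : ℕ} {c : ℝ} {q : Vec d → ℝ} {μ : Measure (Vec d)}

lemma ae_coord_ne (h : NearUniform c q μ) :
    ∀ᵐ x ∂(Measure.pi fun _ : Fin (n + 1) => μ), ∀ l i, i ≠ l → ∀ j, x i j ≠ x l j := by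
  have := h.isProb
  refine ae_all_iff.2 fun l => ?_
  have := ae_pi_of_peel (n := n) (μ := μ) (p := fun z y => ∀ m j, y m j ≠ z j) l ?_
    (Eventually.of_forall fun z => h.ae_forall_ne z)
  · filter_upwards [this] with x hx i hi
    obtain ⟨m, rfl⟩ := Fin.exists_succAbove_eq hi
    exact hx m
  · have : {w : Vec d × (Fin n → Vec d) | ∀ m j, w.2 m j ≠ w.1 j}
        = ⋂ m, ⋂ j, {w | w.2 m j = w.1 j}ᶜ := by
      ext w
      simp
    rw [this]
    refine MeasurableSet.iInter fun m => MeasurableSet.iInter fun j => MeasurableSet.compl ?_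
    exact measurableSet_eq_fun (by fun_prop) (by fun_prop)

lemma ae_card_nearest_erase (h : NearUniform c q μ) (hd : 1 ≤ d) (hk : 1 ≤ k) (hkn : k ≤ n) :
    ∀ᵐ x ∂(Measure.pi fun _ : Fin (n + 1) => μ),
      ∀ i, (nearest k (Finset.univ.erase i) x (x i)).card = k := by
  have := h.isProb
  refine ae_all_iff.2 fun i => ?_
  have := ae_pi_of_peel (n := n) (μ := μ)
    (p := fun z y => (nearest k Finset.univ y z).card = k) i ?_ ?_
  · filter_upwards [this] with x hx
    rw [nearest_erase_eq, Finset.card_map, hx]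
  · have hm : Measurable fun w : Vec d × (Fin n → Vec d) =>
        (nearest k Finset.univ w.2 w.1).card := by
      have : ∀ w : Vec d × (Fin n → Vec d), (nearest k Finset.univ w.2 w.1).card
          = ∑ l, if l ∈ nearest k Finset.univ w.2 w.1 then 1 else 0 := fun w => by
        rw [Finset.sum_ite_mem, Finset.univ_inter, Finset.card_eq_sum_ones]
      simp_rw [this]
      exact Finset.measurable_sum _ fun l _ => Measurable.ite
        (measurableSet_mem_nearest k _ measurable_snd measurable_fst l)
        measurable_const measurable_const
    exact hm (measurableSet_singleton k)
  · filter_upwards [h.ae_mem] with z hz using h.ae_card_nearest hd hk (by simpa using hkn) hz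

/-- The variance of the truncated estimator with an additive correction. -/
lemma variance_tKSG_add_le (h : NearUniform c q μ) (hd : 1 ≤ d) (hk : 1 ≤ k) (hkn : k ≤ n)
    {s : ℝ} (hs : 0 ≤ s) {g : Vec d → ℝ} (hgm : Measurable g)
    (hg : Integrable (fun z => g z ^ 2) μ) {T : (Fin (n + 1) → Vec d) → ℝ}
    (hT : ∀ x, T x = tKSG k x + 1 / ((n : ℝ) + 1) * ∑ i, g (x i)) :
    MemLp T 2 (Measure.pi fun _ => μ) ∧
    ∫ x, (T x - ∫ x, T x ∂(Measure.pi fun _ => μ)) ^ 2 ∂(Measure.pi fun _ => μ)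
      ≤ 1 / ((n : ℝ) + 1) * ((3 + 12 * (k * 2 ^ d) * k)
        * (d * (2 * d * s ^ 2 + 32 * Real.exp (-s / 2) * (8 * d * n)))
        + 3 * ∫ z, g z ^ 2 ∂μ) := by
  have := h.isProb
  set ν := Measure.pi fun _ : Fin (n + 1) => μ with hν
  set N : ℝ := (n : ℝ) + 1 with hN
  have hN0 : 0 < N := by positivity
  let E : Fin (n + 1) → (Fin (n + 1) → Vec d) → ℝ := fun i x =>
    d * (2 * d * s ^ 2 + 32 * Real.exp (-s / 2) * invSqrtSum (Finset.univ.erase i) x (x i))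
  let φ : Fin (n + 1) → (Fin (n + 1) → Vec d) → ℝ := fun i x =>
    logCell k (Finset.univ.erase i) x (x i)
  let ψ : Fin (n + 1) → Fin (n + 1) → (Fin (n + 1) → Vec d) → ℝ := fun i l x =>
    logCell k ((Finset.univ.erase i).erase l) x (x i)
  let c0 : ℝ := -psi k + psi ((n : ℝ) + 1) + ((d : ℝ) - 1) / k
  -- The sample point `l` is deleted both as a centre and as a possible neighbour, while the
  -- constant and the normalisation `1 / N` stay those of the full sample.
  let T' : Fin (n + 1) → (Fin (n + 1) → Vec d) → ℝ := fun l x =>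
    c0 + 1 / N * ∑ i ∈ Finset.univ.erase l, (ψ i l x + g (x i))
  have hI := fun i : Fin (n + 1) => h.integral_invSqrtSum_erase i
  have hEi : ∀ i, Integrable (E i) ν := fun i =>
    ((integrable_const _).add ((hI i).1.const_mul _)).const_mul _
  have hEint : ∀ i, ∫ x, E i x ∂ν
      ≤ d * (2 * d * s ^ 2 + 32 * Real.exp (-s / 2) * (8 * d * n)) := fun i => by
    simp only [E]
    rw [integral_const_mul, integral_add (integrable_const _) ((hI i).1.const_mul _),
      integral_const, integral_const_mul]
    simp only [probReal_univ, one_smul]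
    have := (hI i).2
    refine mul_le_mul_of_nonneg_left (add_le_add le_rfl ?_) (Nat.cast_nonneg d)
    exact mul_le_mul_of_nonneg_left this (by positivity)
  have hφm : ∀ i, Measurable (φ i) := fun i =>
    measurable_logCell k _ measurable_id (measurable_pi_apply i)
  have hψm : ∀ i l, Measurable (ψ i l) := fun i l =>
    measurable_logCell k _ measurable_id (measurable_pi_apply i)
  have hgim : ∀ i, Measurable fun x : Fin (n + 1) → Vec d => g (x i) := fun i =>
    hgm.comp (measurable_pi_apply i)
  have hφE : ∀ᵐ x ∂ν, ∀ i, φ i x ^ 2 ≤ E i x := by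
    filter_upwards [h.ae_forall_mem] with x hx i
    exact sq_logCell_le (hx i) (fun l _ => hx l) hs
  have hψE : ∀ᵐ x ∂ν, ∀ i l, ψ i l x ^ 2 ≤ E i x := by
    filter_upwards [h.ae_forall_mem] with x hx i l
    refine (sq_logCell_le (hx i) (fun l _ => hx l) hs).trans ?_
    have : invSqrtSum ((Finset.univ.erase i).erase l) x (x i)
        ≤ invSqrtSum (Finset.univ.erase i) x (x i) := invSqrtSum_mono (Finset.erase_subset _ _)
    simp only [E]
    gcongr
  have hφL : ∀ i, MemLp (φ i) 2 ν := fun i =>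
    memLp_two_of_sq_le (hφm i) (hEi i) (hφE.mono fun x hx => hx i)
  have hψL : ∀ i l, MemLp (ψ i l) 2 ν := fun i l =>
    memLp_two_of_sq_le (hψm i l) (hEi i) (hψE.mono fun x hx => hx i l)
  have hev := fun i : Fin (n + 1) => measurePreserving_eval (fun _ : Fin (n + 1) => μ) i
  have hgL : ∀ i, MemLp (fun x : Fin (n + 1) → Vec d => g (x i)) 2 ν := fun i =>
    ((memLp_two_iff_integrable_sq hgm.aestronglyMeasurable).2 hg).comp_measurePreserving (hev i)
  have hgint : ∀ i, ∫ x, g (x i) ^ 2 ∂ν = ∫ z, g z ^ 2 ∂μ := fun i => by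
    have e := integral_map (μ := ν) (hev i).measurable.aemeasurable
      (f := fun z => g z ^ 2) (hgm.pow_const 2).aestronglyMeasurable
    rw [(hev i).map_eq] at e
    exact e.symm
  have hTeq : ∀ x, T x = c0 + 1 / N * ∑ i, (φ i x + g (x i)) := fun x => by
    rw [hT, tKSG_eq, Finset.sum_add_distrib]
    simp only [φ, c0]
    ring
  have hTf : T = fun x => c0 + 1 / N * ∑ i, (φ i x + g (x i)) := funext hTeq
  have hTm : Measurable T := by
    rw [hTf]
    exact measurable_const.add (measurable_const.mul
      (Finset.measurable_sum _ fun i _ => (hφm i).add (hgim i)))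
  have hT'm : ∀ l, Measurable (T' l) := fun l =>
    measurable_const.add (measurable_const.mul
      (Finset.measurable_sum _ fun i _ => (hψm i l).add (hgim i)))
  have hTL : MemLp T 2 ν := by
    rw [hTf]
    exact (memLp_const c0).add ((memLp_finsetSum _ fun i _ => (hφL i).add (hgL i)).const_mul _)
  have hT'L : ∀ l, MemLp (T' l) 2 ν := fun l =>
    (memLp_const c0).add ((memLp_finsetSum _ fun i _ => (hψL i l).add (hgL i)).const_mul _)
  refine ⟨hTL, ?_⟩
  have hupd : ∀ l x a, T' l (Function.update x l a) = T' l x := fun l x a => by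
    simp only [T', ψ]
    congr 2
    refine Finset.sum_congr rfl fun i hi => ?_
    have hil := Finset.ne_of_mem_erase hi
    rw [Function.update_of_ne hil, logCell_congr (y := x) fun m hm =>
      Function.update_of_ne (Finset.ne_of_mem_erase hm) a x]
  refine (efronStein μ (n + 1) T T' hTm hT'm hTL hT'L hupd).trans ?_
  have hsq : ∀ l, Integrable (fun x => (T x - T' l x) ^ 2) (Measure.pi fun _ => μ) := fun l =>
    (hTL.sub (hT'L l)).integrable_sq
  rw [← integral_finsetSum _ fun l _ => hsq l]
  have hpt : ∀ᵐ x ∂ν, ∑ l, (T x - T' l x) ^ 2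
      ≤ (1 / N) ^ 2 * ((3 + 12 * (k * 2 ^ d) * k) * ∑ i, E i x + 3 * ∑ i, g (x i) ^ 2) := by
    filter_upwards [hφE, hψE, h.ae_coord_ne, h.ae_card_nearest_erase hd hk hkn] with x h1 h2 h3 h4
    let R : Fin (n + 1) → Finset (Fin (n + 1)) := fun l =>
      Finset.univ.filter fun i => l ∈ nearest k (Finset.univ.erase i) x (x i)
    -- The difference is the `l`-th summand itself plus the changes of those cells that have `l`
    -- among their neighbours; all other cells cancel.
    have h5 : ∀ l, T x - T' l x = 1 / N * (φ l x + g (x l) + ∑ i ∈ R l, (φ i x - ψ i l x)) := by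
      intro l
      have h6 : ∑ i ∈ R l, (φ i x - ψ i l x)
          = ∑ i ∈ Finset.univ.erase l, (φ i x - ψ i l x) := by
        refine Finset.sum_subset (fun i hi => ?_) fun i _ hi => ?_
        · have := (mem_nearest.1 (Finset.mem_filter.1 hi).2).1
          exact Finset.mem_erase.2 ⟨(Finset.ne_of_mem_erase this).symm, Finset.mem_univ i⟩
        · have : l ∉ nearest k (Finset.univ.erase i) x (x i) := fun hl =>
            hi (Finset.mem_filter.2 ⟨Finset.mem_univ i, hl⟩)
          exact sub_eq_zero.2 (logCell_erase this).symm
      rw [hTeq, h6, ← Finset.add_sum_erase _ _ (Finset.mem_univ l)]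
      simp only [T', Finset.sum_add_distrib, Finset.sum_sub_distrib]
      ring
    simp only [h5, mul_pow]
    rw [← Finset.mul_sum]
    gcongr
    have := sum_sq_add_add_sum_le R (K := k * 2 ^ d) (k := k) (φ := fun l => φ l x)
      (g := fun l => g (x l)) (E := fun l => E l x) (δ := fun i l => φ i x - ψ i l x)
      (fun l => card_reverse_nearest_le hd l (h3 l)) (fun i => ?_) h1 fun i l => ?_
    · exact_mod_cast this
    · refine (Finset.card_le_card (t := nearest k (Finset.univ.erase i) x (x i)) ?_).trans
        (h4 i).le
      intro l hl
      exact (Finset.mem_filter.1 (Finset.mem_filter.1 hl).2).2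
    · nlinarith [h1 i, h2 i l, sq_nonneg (φ i x + ψ i l x)]
  have hS1 : Integrable (fun x => ∑ i, E i x) ν := integrable_finsetSum _ fun i _ => hEi i
  have hS2 : Integrable (fun x => ∑ i, g (x i) ^ 2) ν :=
    integrable_finsetSum _ fun i _ => (hgL i).integrable_sq
  have hS3 : Integrable (fun x => (1 / N) ^ 2 * ((3 + 12 * (k * 2 ^ d) * k) * ∑ i, E i x
      + 3 * ∑ i, g (x i) ^ 2)) ν := ((hS1.const_mul _).add (hS2.const_mul _)).const_mul _
  refine (integral_mono_ae (integrable_finsetSum _ fun l _ => hsq l) hS3 hpt).trans ?_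
  rw [integral_const_mul, integral_add (hS1.const_mul _) (hS2.const_mul _), integral_const_mul,
    integral_const_mul, integral_finsetSum _ fun i _ => hEi i,
    integral_finsetSum _ fun i _ => (hgL i).integrable_sq]
  simp only [hgint]
  have h7 : ∑ i, ∫ x, E i x ∂ν
      ≤ N * (d * (2 * d * s ^ 2 + 32 * Real.exp (-s / 2) * (8 * d * n))) := by
    refine (Finset.sum_le_sum fun i _ => hEint i).trans_eq ?_
    simp [hN]
  have h8 : ∑ _i : Fin (n + 1), ∫ z, g z ^ 2 ∂μ = N * ∫ z, g z ^ 2 ∂μ := by simp [hN]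
  rw [h8]
  calc (1 / N) ^ 2 * ((3 + 12 * (k * 2 ^ d) * k) * ∑ i, ∫ x, E i x ∂ν
        + 3 * (N * ∫ z, g z ^ 2 ∂μ))
      ≤ (1 / N) ^ 2 * ((3 + 12 * (k * 2 ^ d) * k)
        * (N * (d * (2 * d * s ^ 2 + 32 * Real.exp (-s / 2) * (8 * d * n))))
        + 3 * (N * ∫ z, g z ^ 2 ∂μ)) := by gcongr
    _ = _ := by field_simp

end NearUniform

/-! ### Choice of parameters and explicit constants -/

/-- The constant of the bias bound. -/
def biasConst (d k : ℕ) : ℝ :=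
  (2 * (2 ^ (k + 1) * d + 1) * (k + 1) + (10 * d + 6) * (32 * d * (1 + k * (k + 1)))
    + 32 * d * (1 + d)) * 2 ^ (k + 1)

/-- The bound of the bias of the estimator from `N` samples. -/
def biasBound (d k N : ℕ) (c : ℝ) : ℝ :=
  biasConst d k * umFactor d k c * (Real.log N ^ (k + 2) / (N : ℝ) ^ ((1 : ℝ) / d))

/-- The part of the variance bound that does not depend on the density. -/
def varianceConst (d k : ℕ) : ℝ := (3 + 12 * (k * 2 ^ d) * k) * (1056 * d ^ 2)

lemma biasConst_pos (d k : ℕ) : 0 < biasConst d k := by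
  unfold biasConst
  positivity

lemma varianceConst_nonneg (d k : ℕ) : 0 ≤ varianceConst d k := by
  unfold varianceConst
  positivity

/-- The analysis only needs the power of `1 / (1 - c)`; the numerator of the factor is at least 1.
-/
lemma inv_pow_le_umFactor (d k : ℕ) {c : ℝ} (hc0 : 0 ≤ c) (hc1 : c < 1) :
    (1 / (1 - c)) ^ (k + 1) ≤ umFactor d k c := by
  have h1 : 0 < 1 - c := sub_pos.2 hc1
  rw [umFactor, div_pow, one_pow]
  gcongr
  have : 0 ≤ (1 + c) ^ d := by positivity
  nlinarith

lemma biasBound_sq (d k N : ℕ) (c : ℝ) :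
    biasBound d k N c ^ 2 = (biasConst d k * umFactor d k c) ^ 2
      * (Real.log N ^ (2 * (k + 2)) / (N : ℝ) ^ ((2 : ℝ) / d)) := by
  have h : (N : ℝ) ^ ((2 : ℝ) / d) = ((N : ℝ) ^ ((1 : ℝ) / d)) ^ 2 := by
    rw [← Real.rpow_natCast ((N : ℝ) ^ ((1 : ℝ) / d)) 2, ← Real.rpow_mul (Nat.cast_nonneg N)]
    congr 1
    push_cast
    ring
  rw [biasBound, h, mul_pow, div_pow, ← pow_mul]
  ring

lemma half_lt_log {N : ℝ} (hN : 2 ≤ N) : 1 / 2 < Real.log N := by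
  have := Real.log_le_log two_pos hN
  linarith [Real.log_two_gt_d9]

/-- The choice `s = 4 log N` gives `exp (-s/2) = N^(-2)`, which beats the factor `n` in the singular
term. From `log N > 1/2`, which needs `N ≥ 2`, constants are absorbed through `1 ≤ 2 log N`; raising
a single `log N` to the power `k + 2` in this way costs the factor `2 ^ (k + 1)` in `biasConst`. -/
lemma bias_arith {d k n : ℕ} (hd : 1 ≤ d) (hk : 1 ≤ k) (hn : 1 ≤ n) {c : ℝ} (hc0 : 0 ≤ c)
    (hc1 : c < 1) :
    ∃ b : ℝ, 0 < b ∧ b ^ d = (1 - c) * (n + 1) ∧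
      (2 ^ (k + 1) * d / (1 - c) ^ k + 1 / (1 - c)) * ((k + 1) / b)
        + ((2 * d * (4 * Real.log (n + 1)) - 2 * Real.log (1 - c) + 1 + d)
          * (2 * (1 + k * (k + 1)) * (16 * d / b))
        + 2 * (1 + d) * Real.exp (-(4 * Real.log (n + 1)) / 2) * (8 * d * n))
      ≤ biasBound d k (n + 1) c := by
  have h1c : 0 < 1 - c := sub_pos.2 hc1
  have hd0 : (d : ℝ) ≠ 0 := by positivity
  have hd1 : (1 : ℝ) ≤ d := by exact_mod_cast hd
  have hn1 : (1 : ℝ) ≤ n := by exact_mod_cast hn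
  have hexp : (1 : ℝ) / d ≤ 1 := by rw [div_le_one (by linarith)]; exact hd1
  have hexp0 : (0 : ℝ) < 1 / d := by positivity
  set N : ℝ := (n : ℝ) + 1 with hN
  have hN0 : 0 < N := by positivity
  have hL := half_lt_log (N := N) (by linarith)
  set L := Real.log N with hLdef
  set u := 1 / (1 - c) with hu
  have hu1 : 1 ≤ u := by rw [hu, le_div_iff₀ h1c]; linarith
  set r := 1 / N ^ ((1 : ℝ) / d) with hr
  have hNp : 0 < N ^ ((1 : ℝ) / d) := Real.rpow_pos_of_pos hN0 _
  have hr0 : 0 < r := by positivity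
  set b := ((1 - c) * N) ^ ((1 : ℝ) / d) with hb
  have hb0 : 0 < b := Real.rpow_pos_of_pos (by positivity) _
  refine ⟨b, hb0, ?_, ?_⟩
  · rw [hb, ← Real.rpow_natCast, ← Real.rpow_mul (by positivity), one_div_mul_cancel hd0,
      Real.rpow_one]
  -- As `1 - c ≤ 1` and `1/d ≤ 1`, the root `(1 - c)^(1/d)` is at least `1 - c`. This loses one
  -- factor `u`, which together with `u ^ k` gives the power `k + 1`.
  have hbu : 1 / b ≤ u * r := by
    rw [hb, Real.mul_rpow h1c.le hN0.le, hu, hr, ← one_div_mul_one_div]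
    gcongr
    calc (1 - c) = (1 - c) ^ (1 : ℝ) := (Real.rpow_one _).symm
      _ ≤ _ := Real.rpow_le_rpow_of_exponent_ge h1c (by linarith) hexp
  have hNr : 1 / N ≤ r := by
    rw [hr]
    gcongr
    calc N ^ ((1 : ℝ) / d) ≤ N ^ (1 : ℝ) :=
          Real.rpow_le_rpow_of_exponent_le (by linarith) hexp
      _ = N := Real.rpow_one _
  have hlog : -Real.log (1 - c) ≤ u := by
    have : Real.log u = -Real.log (1 - c) := by rw [hu, one_div, Real.log_inv]
    rw [← this]
    linarith [Real.log_le_sub_one_of_pos (lt_of_lt_of_le one_pos hu1)]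
  have hexpo : Real.exp (-(4 * L) / 2) = 1 / N ^ 2 := by
    rw [show -(4 * L) / 2 = -(L + L) by ring, Real.exp_neg, Real.exp_add, hLdef, Real.exp_log hN0]
    field_simp
  have huk : u ≤ u ^ k := le_self_pow₀ hu1 (by omega)
  have hu2 : u ^ 2 ≤ u ^ (k + 1) := pow_le_pow_right₀ hu1 (by omega)
  have huk1 : 1 ≤ u ^ (k + 1) := one_le_pow₀ hu1
  have hA : (2 ^ (k + 1) * d / (1 - c) ^ k + 1 / (1 - c)) * ((k + 1) / b)
      ≤ (2 * (2 ^ (k + 1) * d + 1) * (k + 1)) * (u ^ (k + 1) * r * L) := by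
    have e1 : (2 ^ (k + 1) * d / (1 - c) ^ k + 1 / (1 - c)) = 2 ^ (k + 1) * d * u ^ k + u := by
      rw [hu, div_pow, one_pow]
      ring
    rw [e1, show ((k : ℝ) + 1) / b = (k + 1) * (1 / b) by ring]
    calc (2 ^ (k + 1) * d * u ^ k + u) * ((k + 1) * (1 / b))
        ≤ (2 ^ (k + 1) * d * u ^ k + u ^ k) * ((k + 1) * (u * r)) := by gcongr
      _ = (2 ^ (k + 1) * d + 1) * (k + 1) * (u ^ (k + 1) * r) * 1 := by ring
      _ ≤ (2 ^ (k + 1) * d + 1) * (k + 1) * (u ^ (k + 1) * r) * (2 * L) := by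
          gcongr
          linarith
      _ = _ := by ring
  have hB : (2 * d * (4 * L) - 2 * Real.log (1 - c) + 1 + d)
        * (2 * (1 + k * (k + 1)) * (16 * d / b))
      ≤ ((10 * d + 6) * (32 * d * (1 + k * (k + 1)))) * (u ^ (k + 1) * r * L) := by
    have e1 : 2 * d * (4 * L) - 2 * Real.log (1 - c) + 1 + d ≤ u * L * (10 * d + 6) := by
      have h1 : (d : ℝ) * L ≤ u * (d * L) := le_mul_of_one_le_left (by positivity) hu1
      have h2 : (d : ℝ) ≤ u * (2 * d * L) := by
        have : (d : ℝ) ≤ 2 * d * L := by nlinarith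
        exact this.trans (le_mul_of_one_le_left (by positivity) hu1)
      have h3 : u ≤ u * (2 * L) := le_mul_of_one_le_right (by positivity) (by linarith)
      nlinarith
    rw [show 16 * (d : ℝ) / b = 16 * d * (1 / b) by ring]
    calc (2 * d * (4 * L) - 2 * Real.log (1 - c) + 1 + d)
          * (2 * (1 + k * (k + 1)) * (16 * d * (1 / b)))
        ≤ (u * L * (10 * d + 6)) * (2 * (1 + k * (k + 1)) * (16 * d * (u * r))) := by gcongr
      _ = ((10 * d + 6) * (32 * d * (1 + k * (k + 1)))) * (u ^ 2 * r * L) := by ring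
      _ ≤ _ := by gcongr
  have hE : 2 * (1 + d) * Real.exp (-(4 * L) / 2) * (8 * d * n)
      ≤ (32 * d * (1 + d)) * (u ^ (k + 1) * r * L) := by
    have e1 : 1 / N ^ 2 * n ≤ 1 / N := by
      rw [div_mul_eq_mul_div, one_mul, div_le_div_iff₀ (by positivity) hN0]
      nlinarith
    have e2 : (1 : ℝ) ≤ u ^ (k + 1) * (2 * L) := one_le_mul_of_one_le_of_one_le huk1 (by linarith)
    rw [hexpo]
    calc 2 * (1 + (d : ℝ)) * (1 / N ^ 2) * (8 * d * n) = 16 * d * (1 + d) * (1 / N ^ 2 * n) := by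
          ring
      _ ≤ 16 * d * (1 + d) * (r * 1) := by
          rw [mul_one]
          gcongr
          exact e1.trans hNr
      _ ≤ 16 * d * (1 + d) * (r * (u ^ (k + 1) * (2 * L))) := by gcongr
      _ = _ := by ring
  have hfin : u ^ (k + 1) * r * L
      ≤ 2 ^ (k + 1) * (umFactor d k c * (L ^ (k + 2) / N ^ ((1 : ℝ) / d))) := by
    have e1 : (1 : ℝ) ≤ (2 * L) ^ (k + 1) := one_le_pow₀ (by linarith)
    have e2 := inv_pow_le_umFactor d k hc0 hc1
    have e3 : 0 ≤ umFactor d k c := le_trans (by positivity) e2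
    calc u ^ (k + 1) * r * L ≤ umFactor d k c * r * (L * (2 * L) ^ (k + 1)) := by
          gcongr
          exact le_mul_of_one_le_right (by linarith) e1
      _ = _ := by rw [hr]; ring
  rw [biasBound, biasConst]
  push_cast
  rw [← hN, ← hLdef]
  have hC : 0 ≤ 2 * (2 ^ (k + 1) * (d : ℝ) + 1) * (k + 1)
      + (10 * d + 6) * (32 * d * (1 + k * (k + 1))) + 32 * d * (1 + d) := by positivity
  have := mul_le_mul_of_nonneg_left hfin hC
  linarith

lemma variance_arith (d : ℕ) {k n : ℕ} (hn : 1 ≤ n) {G : ℝ} (hG : 0 ≤ G) :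
    1 / ((n : ℝ) + 1) * ((3 + 12 * (k * 2 ^ d) * k)
        * (d * (2 * d * (4 * Real.log (n + 1)) ^ 2
          + 32 * Real.exp (-(4 * Real.log (n + 1)) / 2) * (8 * d * n))) + 3 * G)
      ≤ 2 ^ k * (varianceConst d k + 12 * G)
        * (Real.log (n + 1 : ℕ) ^ (k + 2) / (n + 1 : ℕ)) := by
  have hn1 : (1 : ℝ) ≤ n := by exact_mod_cast hn
  push_cast
  set N : ℝ := (n : ℝ) + 1 with hN
  have hN0 : 0 < N := by positivity
  have hL := half_lt_log (N := N) (by linarith)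
  set L := Real.log N with hLdef
  have hexpo : Real.exp (-(4 * L) / 2) = 1 / N ^ 2 := by
    rw [show -(4 * L) / 2 = -(L + L) by ring, Real.exp_neg, Real.exp_add, hLdef, Real.exp_log hN0]
    field_simp
  have h1 : 1 / N ^ 2 * n ≤ 1 := by
    rw [div_mul_eq_mul_div, one_mul, div_le_one (by positivity)]
    nlinarith
  have h4 : (1 : ℝ) ≤ 4 * L ^ 2 := by nlinarith
  have h2 : (d : ℝ) * (2 * d * (4 * L) ^ 2 + 32 * (1 / N ^ 2) * (8 * d * n))
      -- `1056 = 32 + 4 * 256`, the second part from `1 ≤ 4 * L ^ 2`.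
      ≤ 1056 * d ^ 2 * L ^ 2 := by
    calc (d : ℝ) * (2 * d * (4 * L) ^ 2 + 32 * (1 / N ^ 2) * (8 * d * n))
        = d ^ 2 * (32 * L ^ 2 + 256 * (1 / N ^ 2 * n)) := by ring
      _ ≤ d ^ 2 * (32 * L ^ 2 + 256 * (4 * L ^ 2)) := by
          refine mul_le_mul_of_nonneg_left ?_ (sq_nonneg _)
          linarith
      _ = _ := by ring
  have h3 : 3 * G ≤ 12 * G * L ^ 2 := by nlinarith
  have h5 : L ^ 2 ≤ 2 ^ k * L ^ (k + 2) := by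
    have e1 : (1 : ℝ) ≤ (2 * L) ^ k := one_le_pow₀ (by linarith)
    calc L ^ 2 ≤ (2 * L) ^ k * L ^ 2 := le_mul_of_one_le_left (by positivity) e1
      _ = _ := by ring
  rw [hexpo]
  have hV := varianceConst_nonneg d k
  calc 1 / N * ((3 + 12 * (k * 2 ^ d) * k)
        * (d * (2 * d * (4 * L) ^ 2 + 32 * (1 / N ^ 2) * (8 * d * n))) + 3 * G)
      ≤ 1 / N * ((3 + 12 * (k * 2 ^ d) * k) * (1056 * d ^ 2 * L ^ 2) + 12 * G * L ^ 2) := by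
        gcongr
    _ = (varianceConst d k + 12 * G) * L ^ 2 / N := by rw [varianceConst]; ring
    _ ≤ (varianceConst d k + 12 * G) * (2 ^ k * L ^ (k + 2)) / N := by gcongr
    _ = _ := by ring

/-! ### The estimator with an additive correction -/

namespace NearUniform

variable {d k n : ℕ} {c : ℝ} {q : Vec d → ℝ} {μ : Measure (Vec d)}

/-- The last bound is crude in `n`. Its purpose is that, with `n` fixed, it depends on the
correction only through its first absolute moment, which makes it uniform over the maps when the
training sample is averaged. -/
lemma integral_corrected (h : NearUniform c q μ) {g : Vec d → ℝ} (hgi : Integrable g μ)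
    {T : (Fin (n + 1) → Vec d) → ℝ}
    (hT : ∀ x, T x = tKSG k x + 1 / ((n : ℝ) + 1) * ∑ i, g (x i)) :
    Integrable T (Measure.pi fun _ => μ) ∧
    ∫ x, T x ∂(Measure.pi fun _ => μ)
      = ∫ x : Fin (n + 1) → Vec d, tKSG k x ∂(Measure.pi fun _ => μ) + ∫ z, g z ∂μ ∧
    ∫ x, |T x| ∂(Measure.pi fun _ => μ)
      ≤ |-psi k + psi ((n : ℝ) + 1) + ((d : ℝ) - 1) / k| + 16 * d * n + ∫ z, |g z| ∂μ := by
  have := h.isProb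
  have hN0 : (0 : ℝ) < (n : ℝ) + 1 := by positivity
  have hTf : T = fun x => tKSG k x + 1 / ((n : ℝ) + 1) * ∑ i, g (x i) := funext hT
  have hev := fun i : Fin (n + 1) => measurePreserving_eval (fun _ : Fin (n + 1) => μ) i
  have hgi' : ∀ i : Fin (n + 1), Integrable (fun x : Fin (n + 1) → Vec d => g (x i))
      (Measure.pi fun _ => μ) := fun i => (hev i).integrable_comp_of_integrable hgi
  have hint : ∀ {φ : Vec d → ℝ}, AEStronglyMeasurable φ μ → ∀ i : Fin (n + 1),
      ∫ x : Fin (n + 1) → Vec d, φ (x i) ∂(Measure.pi fun _ => μ) = ∫ z, φ z ∂μ := by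
    intro φ hφ i
    have e := integral_map (μ := Measure.pi fun _ : Fin (n + 1) => μ)
      (hev i).measurable.aemeasurable (f := φ) (by rw [(hev i).map_eq]; exact hφ)
    rw [(hev i).map_eq] at e
    exact e.symm
  have hs : Integrable (fun x : Fin (n + 1) → Vec d => 1 / ((n : ℝ) + 1) * ∑ i, g (x i))
      (Measure.pi fun _ => μ) := (integrable_finsetSum _ fun i _ => hgi' i).const_mul _
  have hTi : Integrable T (Measure.pi fun _ => μ) := by
    rw [hTf]
    exact h.integral_tKSG.1.add hs
  refine ⟨hTi, ?_, ?_⟩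
  · rw [hTf, integral_add h.integral_tKSG.1 hs, integral_const_mul,
      integral_finsetSum _ fun i _ => hgi' i]
    simp only [hint hgi.aestronglyMeasurable]
    congr 1
    simp
    field_simp
  · set c0 := |-psi k + psi ((n : ℝ) + 1) + ((d : ℝ) - 1) / k|
    have hI := fun i : Fin (n + 1) => h.integral_invSqrtSum_erase i
    have hga : ∀ i : Fin (n + 1), Integrable (fun x : Fin (n + 1) → Vec d => |g (x i)|)
        (Measure.pi fun _ => μ) := fun i => (hgi' i).abs
    have hsum : ∀ i : Fin (n + 1), Integrable (fun x : Fin (n + 1) → Vec d =>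
        2 * invSqrtSum (Finset.univ.erase i) x (x i) + |g (x i)|) (Measure.pi fun _ => μ) :=
      fun i => ((hI i).1.const_mul 2).add (hga i)
    have hmaj : Integrable (fun x : Fin (n + 1) → Vec d => 1 / ((n : ℝ) + 1) *
        ∑ i, (2 * invSqrtSum (Finset.univ.erase i) x (x i) + |g (x i)|))
        (Measure.pi fun _ => μ) := (integrable_finsetSum _ fun i _ => hsum i).const_mul _
    have hpt : ∀ᵐ x ∂(Measure.pi fun _ : Fin (n + 1) => μ), |T x| ≤ c0 + 1 / ((n : ℝ) + 1) *
        ∑ i, (2 * invSqrtSum (Finset.univ.erase i) x (x i) + |g (x i)|) := by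
      filter_upwards [h.ae_forall_mem] with x hx
      have e : T x = (-psi k + psi ((n : ℝ) + 1) + ((d : ℝ) - 1) / k) + 1 / ((n : ℝ) + 1) *
          ∑ i, (logCell k (Finset.univ.erase i) x (x i) + g (x i)) := by
        rw [hT, tKSG_eq, Finset.sum_add_distrib]
        ring
      rw [e]
      refine (abs_add_le _ _).trans ?_
      rw [abs_mul, abs_of_nonneg (by positivity : 0 ≤ 1 / ((n : ℝ) + 1))]
      gcongr
      refine (Finset.abs_sum_le_sum_abs _ _).trans (Finset.sum_le_sum fun i _ => ?_)
      refine (abs_add_le _ _).trans ?_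
      gcongr
      have := abs_logCell_le (k := k) (J := Finset.univ.erase i) (hx i) (fun l _ => hx l) le_rfl
      simpa using this
    refine (integral_mono_ae hTi.abs ((integrable_const c0).add hmaj) hpt).trans ?_
    rw [integral_add' (integrable_const c0) hmaj, integral_const, integral_const_mul,
      integral_finsetSum _ fun i _ => hsum i]
    have hi : ∀ i : Fin (n + 1), ∫ x : Fin (n + 1) → Vec d,
        (2 * invSqrtSum (Finset.univ.erase i) x (x i) + |g (x i)|) ∂(Measure.pi fun _ => μ)
        ≤ 16 * d * n + ∫ z, |g z| ∂μ := fun i => by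
      rw [integral_add ((hI i).1.const_mul 2) (hga i), integral_const_mul,
        hint (φ := fun z => |g z|) hgi.abs.aestronglyMeasurable]
      linarith [(hI i).2]
    have hle : 1 / ((n : ℝ) + 1) * ∑ i : Fin (n + 1), ∫ x : Fin (n + 1) → Vec d,
        (2 * invSqrtSum (Finset.univ.erase i) x (x i) + |g (x i)|) ∂(Measure.pi fun _ => μ)
        ≤ 16 * d * n + ∫ z, |g z| ∂μ := by
      calc _ ≤ 1 / ((n : ℝ) + 1) * ∑ _i : Fin (n + 1), (16 * d * n + ∫ z, |g z| ∂μ) := by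
            gcongr with i
            exact hi i
        _ = _ := by
            simp
            field_simp
    simp only [probReal_univ, one_smul]
    linarith

/-- The bias of the corrected estimator. -/
lemma abs_integral_corrected_sub_le (h : NearUniform c q μ) (hd : 1 ≤ d) (hk : 1 ≤ k)
    (hkn : k ≤ n) {g : Vec d → ℝ} (hgi : Integrable g μ) {T : (Fin (n + 1) → Vec d) → ℝ}
    (hT : ∀ x, T x = tKSG k x + 1 / ((n : ℝ) + 1) * ∑ i, g (x i)) {H : ℝ}
    (hH : H = ∫ z, g z ∂μ - ∫ z, Real.log (q z) ∂μ) :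
    |∫ x, T x ∂(Measure.pi fun _ => μ) - H| ≤ biasBound d k (n + 1) c := by
  obtain ⟨b, hb, hbd, hle⟩ := bias_arith hd hk (hk.trans hkn) h.nonneg h.lt_one
  have hs : 0 ≤ 4 * Real.log ((n : ℝ) + 1) :=
    mul_nonneg (by norm_num) (Real.log_nonneg (by linarith [Nat.cast_nonneg (α := ℝ) n]))
  rw [(h.integral_corrected hgi hT).2.1, hH]
  refine le_trans (le_of_eq ?_) ((h.abs_integral_tKSG_add_le hd hk hkn hb hs hbd).trans hle)
  congr 1
  ring

/-- The mean squared error of the corrected estimator. -/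
lemma integral_corrected_sub_sq_le (h : NearUniform c q μ) (hd : 1 ≤ d) (hk : 1 ≤ k)
    (hkn : k ≤ n) {g : Vec d → ℝ} (hgm : Measurable g) (hg : Integrable (fun z => g z ^ 2) μ)
    {T : (Fin (n + 1) → Vec d) → ℝ}
    (hT : ∀ x, T x = tKSG k x + 1 / ((n : ℝ) + 1) * ∑ i, g (x i)) {H : ℝ}
    (hH : H = ∫ z, g z ∂μ - ∫ z, Real.log (q z) ∂μ) :
    Integrable (fun x => (T x - H) ^ 2) (Measure.pi fun _ => μ) ∧
    ∫ x, (T x - H) ^ 2 ∂(Measure.pi fun _ => μ)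
      ≤ 2 ^ k * (varianceConst d k + 12 * ∫ z, g z ^ 2 ∂μ)
        * (Real.log (n + 1 : ℕ) ^ (k + 2) / (n + 1 : ℕ)) + biasBound d k (n + 1) c ^ 2 := by
  have := h.isProb
  have hs : 0 ≤ 4 * Real.log ((n : ℝ) + 1) :=
    mul_nonneg (by norm_num) (Real.log_nonneg (by linarith [Nat.cast_nonneg (α := ℝ) n]))
  have hgi : Integrable g μ :=
    ((memLp_two_iff_integrable_sq hgm.aestronglyMeasurable).2 hg).integrable one_le_two
  obtain ⟨hTL, hvar⟩ := h.variance_tKSG_add_le hd hk hkn hs hgm hg hT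
  refine ⟨(hTL.sub (memLp_const H)).integrable_sq, ?_⟩
  rw [integral_sub_const_sq hTL]
  refine add_le_add (hvar.trans (variance_arith d (hk.trans hkn)
    (integral_nonneg fun z => sq_nonneg _))) ?_
  exact sq_le_sq.2 ((h.abs_integral_corrected_sub_le hd hk hkn hgi hT hH).trans (le_abs_self _))

end NearUniform

/-! ### Integrals against a density -/

section DensityMeasure

variable {d : ℕ} {p : Vec d → ℝ} (hp : IsProbDensity p)
include hp

lemma IsProbDensity.isProbabilityMeasure : IsProbabilityMeasure (densityMeasure p) :=
  ⟨by
    rw [densityMeasure, withDensity_apply _ MeasurableSet.univ, setLIntegral_univ,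
      ← ofReal_integral_eq_lintegral_ofReal hp.integrable (Eventually.of_forall hp.nonneg),
      hp.integral_eq_one, ENNReal.ofReal_one]⟩

lemma IsProbDensity.integral_densityMeasure (φ : Vec d → ℝ) :
    ∫ x, φ x ∂(densityMeasure p) = ∫ x, φ x * p x := by
  rw [densityMeasure, integral_withDensity_eq_integral_toReal_smul hp.measurable.ennreal_ofReal
    (Eventually.of_forall fun x => ENNReal.ofReal_lt_top)]
  refine integral_congr_ae (Eventually.of_forall fun x => ?_)
  simp only [ENNReal.toReal_ofReal (hp.nonneg x), smul_eq_mul, mul_comm]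

lemma IsProbDensity.integrable_densityMeasure_iff {φ : Vec d → ℝ} :
    Integrable φ (densityMeasure p) ↔ Integrable fun x => φ x * p x := by
  rw [densityMeasure, integrable_withDensity_iff hp.measurable.ennreal_ofReal
    (Eventually.of_forall fun x => ENNReal.ofReal_lt_top)]
  simp only [ENNReal.toReal_ofReal (hp.nonneg _)]

end DensityMeasure

/-! ### Transport to the cube by a fixed map -/

namespace UniformizingMap

variable {d k n : ℕ} (f : UniformizingMap d) {p : Vec d → ℝ} {c : ℝ}

/-- The density of `f(X)` at `f x`. -/
def ratio (p : Vec d → ℝ) (x : Vec d) : ℝ := p x / |(fderiv ℝ f.toFun x).det|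

lemma density_toFun (x : Vec d) : f.density p (f.toFun x) = f.ratio p x := by
  rw [density, ratio, f.left_inv]

lemma ratio_inv (z : Vec d) : f.ratio p (f.inv z) = f.density p z := rfl

lemma injective : Function.Injective f.toFun := Function.LeftInverse.injective f.left_inv

lemma image_univ : f.toFun '' Set.univ = openCube d := by
  ext z
  constructor
  · rintro ⟨x, -, rfl⟩
    exact f.mapsTo x
  · exact fun hz => ⟨f.inv z, trivial, f.right_inv z hz⟩

lemma det_inv_mul_det (x : Vec d) :
    (fderiv ℝ f.inv (f.toFun x)).det * (fderiv ℝ f.toFun x).det = 1 := by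
  have h1 : HasFDerivAt f.inv (fderiv ℝ f.inv (f.toFun x)) (f.toFun x) :=
    (f.differentiableOn_inv.differentiableAt ((isOpen_openCube d).mem_nhds (f.mapsTo x))).hasFDerivAt
  have h2 : HasFDerivAt f.toFun (fderiv ℝ f.toFun x) x := (f.differentiable x).hasFDerivAt
  have h3 : HasFDerivAt (fun y => f.inv (f.toFun y)) _ x := h1.comp x h2
  simp only [f.left_inv] at h3
  have h4 := h3.unique (hasFDerivAt_id x)
  have h5 := congrArg ContinuousLinearMap.det h4
  simpa [ContinuousLinearMap.det, LinearMap.det_comp] using h5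

lemma det_ne_zero (x : Vec d) : (fderiv ℝ f.toFun x).det ≠ 0 :=
  right_ne_zero_of_mul_eq_one (f.det_inv_mul_det x)

lemma log_det_inv (x : Vec d) :
    Real.log |(fderiv ℝ f.inv (f.toFun x)).det| = -Real.log |(fderiv ℝ f.toFun x).det| := by
  rw [eq_inv_of_mul_eq_one_left (f.det_inv_mul_det x), abs_inv, Real.log_inv]

lemma continuous_ratio (hp : Continuous p) : Continuous (f.ratio p) :=
  hp.div f.differentiable_jac.continuous fun x => abs_ne_zero.2 (f.det_ne_zero x)

lemma differentiableAt_density (hp : Differentiable ℝ p) {z : Vec d} (hz : z ∈ openCube d) :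
    DifferentiableAt ℝ (f.density p) z := by
  have hi : DifferentiableAt ℝ f.inv z :=
    f.differentiableOn_inv.differentiableAt ((isOpen_openCube d).mem_nhds hz)
  have h1 : DifferentiableAt ℝ (fun w => p (f.inv w)) z := (hp _).comp z hi
  have h2 : DifferentiableAt ℝ (fun w => |(fderiv ℝ f.toFun (f.inv w)).det|) z :=
    DifferentiableAt.comp (g := fun x => |(fderiv ℝ f.toFun x).det|) z (f.differentiable_jac _) hi
  exact (h1.fun_mul (h2.fun_inv (abs_ne_zero.2 (f.det_ne_zero _)))).congr_of_eventuallyEq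
    (Eventually.of_forall fun w => div_eq_mul_inv _ _)

/-- The 1-norm of the gradient bounds its operator norm for the maximum norm, and the cube is
convex, so the mean value inequality applies. The conclusion is phrased through points of `ℝ^d`,
where both sides are continuous; this form is shown below to be measurable in the map. -/
lemma abs_ratio_sub_le_of_gradSup_le (hp : Differentiable ℝ p) (hc : 0 ≤ c)
    (h : gradSup (f.density p) ≤ ENNReal.ofReal c) (x y : Vec d) :
    |f.ratio p x - f.ratio p y| ≤ c * dist (f.toFun x) (f.toFun y) := by
  have h1 : ∀ z ∈ openCube d, ‖fderiv ℝ (f.density p) z‖ ≤ c := fun z hz => by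
    have h2 : ∑ j, |fderiv ℝ (f.density p) z (Pi.single j 1)| ≤ c :=
      (ENNReal.ofReal_le_ofReal_iff hc).1 ((le_iSup₂ (f := fun z (_ : z ∈ openCube d) =>
        ENNReal.ofReal (∑ j, |fderiv ℝ (f.density p) z (Pi.single j 1)|)) z hz).trans h)
    refine ContinuousLinearMap.opNorm_le_bound _ hc fun v => ?_
    have h3 : fderiv ℝ (f.density p) z v
        = ∑ j, v j * fderiv ℝ (f.density p) z (Pi.single j 1) := by
      conv_lhs => rw [pi_eq_sum_univ' v, map_sum]
      refine Finset.sum_congr rfl fun j _ => ?_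
      rw [map_smul, smul_eq_mul]
    rw [h3]
    calc ‖∑ j, v j * fderiv ℝ (f.density p) z (Pi.single j 1)‖
        ≤ ∑ j, ‖v j * fderiv ℝ (f.density p) z (Pi.single j 1)‖ := norm_sum_le _ _
      _ ≤ ∑ j, ‖v‖ * |fderiv ℝ (f.density p) z (Pi.single j 1)| := by
          refine Finset.sum_le_sum fun j _ => ?_
          rw [norm_mul, Real.norm_eq_abs (fderiv ℝ (f.density p) z _)]
          gcongr
          exact norm_le_pi_norm v j
      _ = ‖v‖ * ∑ j, |fderiv ℝ (f.density p) z (Pi.single j 1)| := by rw [Finset.mul_sum]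
      _ ≤ ‖v‖ * c := by gcongr
      _ = c * ‖v‖ := mul_comm _ _
  have h2 := (convex_openCube d).norm_image_sub_le_of_norm_fderiv_le
    (fun z hz => f.differentiableAt_density hp hz) h1 (f.mapsTo y) (f.mapsTo x)
  rwa [density_toFun, density_toFun, Real.norm_eq_abs, ← dist_eq_norm] at h2

/-- The density of `f(X)`, extended by zero outside of the cube. -/
def cubeDensity (p : Vec d → ℝ) : Vec d → ℝ := (openCube d).indicator (f.density p)

lemma cubeDensity_toFun (x : Vec d) : f.cubeDensity p (f.toFun x) = f.ratio p x := by
  rw [cubeDensity, Set.indicator_of_mem (f.mapsTo x), density_toFun]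

lemma abs_det_mul_ratio (x : Vec d) : |(fderiv ℝ f.toFun x).det| * f.ratio p x = p x :=
  mul_div_cancel₀ _ (abs_ne_zero.2 (f.det_ne_zero x))

lemma measurable_cubeDensity (h : ContinuousOn (f.density p) (openCube d)) :
    Measurable (f.cubeDensity p) := by
  classical
  have : f.cubeDensity p = (openCube d).piecewise (f.density p) 0 :=
    (Set.piecewise_eq_indicator).symm
  rw [this]
  exact h.measurable_piecewise continuousOn_const (measurableSet_openCube d)

lemma map_densityMeasure :
    (densityMeasure p).map f.toFun
      = (volume.restrict (openCube d)).withDensity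
          fun z => ENNReal.ofReal (f.cubeDensity p z) := by
  have hf : Measurable f.toFun := f.differentiable.continuous.measurable
  ext A hA
  rw [Measure.map_apply hf hA, densityMeasure, withDensity_apply _ (hf hA),
    withDensity_apply _ hA, ← lintegral_indicator (hf hA), ← lintegral_indicator hA,
    ← f.image_univ, lintegral_image_eq_lintegral_abs_det_fderiv_mul volume MeasurableSet.univ
      (fun x _ => (f.differentiable x).hasFDerivAt.hasFDerivWithinAt) f.injective.injOn,
    setLIntegral_univ]
  refine lintegral_congr fun x => ?_
  by_cases hx : f.toFun x ∈ A
  · rw [Set.indicator_of_mem (show x ∈ f.toFun ⁻¹' A from hx), Set.indicator_of_mem hx,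
      cubeDensity_toFun, ← ENNReal.ofReal_mul (abs_nonneg _), abs_det_mul_ratio]
  · rw [Set.indicator_of_notMem (show x ∉ f.toFun ⁻¹' A from hx), Set.indicator_of_notMem hx,
      mul_zero]

/-- The cube has diameter 1, so the density oscillates by at most `c`. If it were below `1 - c` or
above `1 + c` somewhere, it would stay strictly on one side of 1 everywhere, although its integral
over a set of volume 1 equals 1. -/
lemma nearUniform (hp : IsProbDensity p) (hc0 : 0 ≤ c) (hc1 : c < 1)
    (h : ∀ x y, |f.ratio p x - f.ratio p y| ≤ c * dist (f.toFun x) (f.toFun y)) :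
    NearUniform c (f.cubeDensity p) ((densityMeasure p).map f.toFun) := by
  have := hp.isProbabilityMeasure
  have hf : Measurable f.toFun := f.differentiable.continuous.measurable
  have hprob : IsProbabilityMeasure ((densityMeasure p).map f.toFun) :=
    Measure.isProbabilityMeasure_map hf.aemeasurable
  have hlip : ∀ z ∈ openCube d, ∀ w ∈ openCube d,
      |f.density p z - f.density p w| ≤ c * dist z w := fun z hz w hw => by
    have := h (f.inv z) (f.inv w)
    rwa [f.right_inv z hz, f.right_inv w hw, ratio_inv, ratio_inv] at this
  have hq : ∀ z ∈ openCube d, f.cubeDensity p z = f.density p z := fun z hz =>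
    Set.indicator_of_mem hz _
  have hcont : ContinuousOn (f.density p) (openCube d) :=
    (LipschitzOnWith.of_dist_le_mul (K := ⟨c, hc0⟩) fun z hz w hw => hlip z hz w hw).continuousOn
  have hm := f.measurable_cubeDensity hcont
  have hmap := f.map_densityMeasure (p := p)
  have hone : ∫⁻ z in openCube d, ENNReal.ofReal (f.cubeDensity p z) = 1 := by
    have h1 : ((densityMeasure p).map f.toFun) Set.univ = 1 := measure_univ
    rwa [hmap, withDensity_apply _ MeasurableSet.univ, setLIntegral_univ] at h1
  have hvol : ∀ a : ℝ, ∫⁻ _z in openCube d, ENNReal.ofReal a = ENNReal.ofReal a := fun a => by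
    rw [setLIntegral_const, volume_openCube, mul_one]
  have hdist : ∀ z ∈ openCube d, ∀ w ∈ openCube d,
      |f.cubeDensity p z - f.cubeDensity p w| ≤ c := fun z hz w hw => by
    rw [hq z hz, hq w hw]
    exact (hlip z hz w hw).trans
      (mul_le_of_le_one_right hc0 (dist_le_one_of_mem_openCube hw hz))
  refine ⟨hc0, hc1, hm, hprob, hmap, fun z hz w hw => ?_, fun z hz => ?_, fun z hz => ?_⟩
  · rw [hq z hz, hq w hw]
    exact hlip z hz w hw
  · by_contra! hlt
    have h1 : ∫⁻ w in openCube d, ENNReal.ofReal (f.cubeDensity p w)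
        ≤ ENNReal.ofReal (f.cubeDensity p z + c) := by
      rw [← hvol]
      refine setLIntegral_mono measurable_const fun w hw => ENNReal.ofReal_le_ofReal ?_
      linarith [(abs_le.1 (hdist z hz w hw)).1]
    rw [hone, ENNReal.one_le_ofReal] at h1
    linarith
  · by_contra! hlt
    have h1 : ENNReal.ofReal (f.cubeDensity p z - c)
        ≤ ∫⁻ w in openCube d, ENNReal.ofReal (f.cubeDensity p w) := by
      rw [← hvol]
      refine setLIntegral_mono hm.ennreal_ofReal fun w hw => ENNReal.ofReal_le_ofReal ?_
      linarith [(abs_le.1 (hdist z hz w hw)).2]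
    rw [hone, ENNReal.ofReal_le_one] at h1
    linarith

/-- The correction added to the estimator in the cube. -/
def logJacobian (z : Vec d) : ℝ := Real.log |(fderiv ℝ f.inv z).det|

lemma measurable_logJacobian : Measurable f.logJacobian := by
  have h1 : Measurable fun z => (fderiv ℝ f.inv z).det :=
    ContinuousLinearMap.continuous_det.measurable.comp (measurable_fderiv ℝ f.inv)
  exact Real.measurable_log.comp h1.abs

variable (h : NearUniform c (f.cubeDensity p) ((densityMeasure p).map f.toFun))
include h

/-- Positivity of the transformed density forces `p x ≠ 0`, so the logarithm of the quotient of `p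
x` by the Jacobian splits. -/
lemma logJacobian_toFun (x : Vec d) :
    f.logJacobian (f.toFun x) = Real.log (f.cubeDensity p (f.toFun x)) - Real.log (p x) := by
  have h1 : 0 < f.ratio p x := f.cubeDensity_toFun (p := p) x ▸ h.pos (f.mapsTo x)
  have h2 : p x ≠ 0 := fun h0 => by simp [ratio, h0] at h1
  rw [logJacobian, log_det_inv, cubeDensity_toFun, ratio,
    Real.log_div h2 (abs_ne_zero.2 (f.det_ne_zero x))]
  ring

lemma abs_logJacobian_toFun_le (x : Vec d) :
    |f.logJacobian (f.toFun x)| ≤ (-Real.log (1 - c) + 1) + |Real.log (p x)| := by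
  rw [f.logJacobian_toFun h]
  refine (abs_sub _ _).trans ?_
  gcongr
  exact h.abs_log_density_le (f.mapsTo x)

/-- The entropy formula is the previous identity averaged over `p`. Since `log q` is bounded, the
log-Jacobian inherits its integrability from `log p`, with a bound that depends on the map only
through `c`. -/
lemma integrable_logJacobian (hp : IsProbDensity p)
    (hH : Integrable fun x => Real.log (p x) * p x) :
    Integrable f.logJacobian ((densityMeasure p).map f.toFun) ∧
    diffEntropy p = ∫ z, f.logJacobian z ∂((densityMeasure p).map f.toFun)
      - ∫ z, Real.log (f.cubeDensity p z) ∂((densityMeasure p).map f.toFun) ∧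
    ∫ z, |f.logJacobian z| ∂((densityMeasure p).map f.toFun)
      ≤ (-Real.log (1 - c) + 1) + ∫ x, |Real.log (p x)| * p x := by
  have := hp.isProbabilityMeasure
  have := h.isProb
  have hf : Measurable f.toFun := f.differentiable.continuous.measurable
  have hgm := f.measurable_logJacobian
  have hlm : Measurable fun z => Real.log (f.cubeDensity p z) :=
    Real.measurable_log.comp h.measurable
  have hl : Integrable (fun x => Real.log (p x)) (densityMeasure p) :=
    hp.integrable_densityMeasure_iff.2 hH
  have hmaj : Integrable (fun x => (-Real.log (1 - c) + 1) + |Real.log (p x)|)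
      (densityMeasure p) := (integrable_const _).add hl.abs
  have hg : Integrable f.logJacobian ((densityMeasure p).map f.toFun) := by
    rw [integrable_map_measure hgm.aestronglyMeasurable hf.aemeasurable]
    exact Integrable.mono' hmaj (hgm.comp hf).aestronglyMeasurable
      (Eventually.of_forall fun x => f.abs_logJacobian_toFun_le h x)
  refine ⟨hg, ?_, ?_⟩
  · have hq := h.integrable_log_density
    rw [← integral_sub hg hq, integral_map (f := fun z => f.logJacobian z - Real.log (f.cubeDensity p z))
      hf.aemeasurable (hgm.sub hlm).aestronglyMeasurable]
    have e : ∀ x, f.logJacobian (f.toFun x) - Real.log (f.cubeDensity p (f.toFun x))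
        = -Real.log (p x) := fun x => by
      rw [f.logJacobian_toFun h]
      ring
    simp_rw [e]
    rw [integral_neg, hp.integral_densityMeasure, diffEntropy]
  · rw [integral_map hf.aemeasurable hgm.abs.aestronglyMeasurable]
    refine (integral_mono ((integrable_map_measure hgm.aestronglyMeasurable hf.aemeasurable).1
      hg).abs hmaj fun x => f.abs_logJacobian_toFun_le h x).trans_eq ?_
    rw [integral_add (integrable_const _) hl.abs, integral_const, hp.integral_densityMeasure]
    simp

lemma integrable_sq_logJacobian (hp : IsProbDensity p)
    (hH : Integrable fun x => Real.log (p x) ^ 2 * p x) :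
    Integrable (fun z => f.logJacobian z ^ 2) ((densityMeasure p).map f.toFun) ∧
    ∫ z, f.logJacobian z ^ 2 ∂((densityMeasure p).map f.toFun)
      ≤ 2 * (-Real.log (1 - c) + 1) ^ 2 + 2 * ∫ x, Real.log (p x) ^ 2 * p x := by
  have := hp.isProbabilityMeasure
  have hf : Measurable f.toFun := f.differentiable.continuous.measurable
  have hgm := f.measurable_logJacobian.pow_const 2
  have hl : Integrable (fun x => Real.log (p x) ^ 2) (densityMeasure p) :=
    hp.integrable_densityMeasure_iff.2 hH
  have hmaj : Integrable (fun x => 2 * (-Real.log (1 - c) + 1) ^ 2 + 2 * Real.log (p x) ^ 2)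
      (densityMeasure p) := (integrable_const _).add (hl.const_mul 2)
  have hle : ∀ x, f.logJacobian (f.toFun x) ^ 2
      ≤ 2 * (-Real.log (1 - c) + 1) ^ 2 + 2 * Real.log (p x) ^ 2 := fun x => by
    have h1 := pow_le_pow_left₀ (abs_nonneg _) (f.abs_logJacobian_toFun_le h x) 2
    rw [sq_abs] at h1
    have h2 := sq_abs (Real.log (p x))
    nlinarith [sq_nonneg ((-Real.log (1 - c) + 1) - |Real.log (p x)|)]
  have hg : Integrable (fun x => f.logJacobian (f.toFun x) ^ 2) (densityMeasure p) :=
    Integrable.mono' hmaj (hgm.comp hf).aestronglyMeasurable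
      (Eventually.of_forall fun x => by
        rw [Real.norm_of_nonneg (sq_nonneg _)]
        exact hle x)
  refine ⟨(integrable_map_measure hgm.aestronglyMeasurable hf.aemeasurable).2 hg, ?_⟩
  rw [integral_map hf.aemeasurable hgm.aestronglyMeasurable]
  refine (integral_mono hg hmaj hle).trans_eq ?_
  rw [integral_add (integrable_const _) (hl.const_mul 2), integral_const, integral_const_mul,
    hp.integral_densityMeasure]
  simp

end UniformizingMap

/-! ### The estimator for fixed and for random maps -/

namespace UniformizingMap

section Estimator

variable {d k n : ℕ} (f : UniformizingMap d) {p : Vec d → ℝ} {c : ℝ}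

lemma measurePreserving_sample (hp : IsProbDensity p) :
    MeasurePreserving (fun (x : Fin n → Vec d) i => f.toFun (x i))
      (Measure.pi fun _ => densityMeasure p)
      (Measure.pi fun _ => (densityMeasure p).map f.toFun) := by
  have := hp.isProbabilityMeasure
  have hf : Measurable f.toFun := f.differentiable.continuous.measurable
  have : IsProbabilityMeasure ((densityMeasure p).map f.toFun) :=
    Measure.isProbabilityMeasure_map hf.aemeasurable
  exact measurePreserving_pi _ _ fun _ => ⟨hf, rfl⟩

/-- The estimator as a function of the uniformized sample. -/
def cubeEstimator (k : ℕ) (z : Fin (n + 1) → Vec d) : ℝ :=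
  tKSG k z + 1 / ((n : ℝ) + 1) * ∑ i, f.logJacobian (z i)

lemma umTKSG_eq (x : Fin (n + 1) → Vec d) :
    umTKSG k f x = f.cubeEstimator k fun i => f.toFun (x i) := by
  rw [umTKSG, cubeEstimator]
  push_cast
  rfl

variable (hp : IsProbDensity p)
  (h : NearUniform c (f.cubeDensity p) ((densityMeasure p).map f.toFun))
  (hH : Integrable fun x => Real.log (p x) * p x)
include hp h hH

lemma integrable_umTKSG :
    Integrable (fun x : Fin (n + 1) → Vec d => umTKSG k f x)
      (Measure.pi fun _ => densityMeasure p) ∧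
    ∫ x : Fin (n + 1) → Vec d, |umTKSG k f x| ∂(Measure.pi fun _ => densityMeasure p)
      ≤ |-psi k + psi ((n : ℝ) + 1) + ((d : ℝ) - 1) / k| + 16 * d * n
        + ((-Real.log (1 - c) + 1) + ∫ x, |Real.log (p x)| * p x) := by
  obtain ⟨hg, -, hgle⟩ := f.integrable_logJacobian h hp hH
  have hmp := f.measurePreserving_sample (n := n + 1) hp
  obtain ⟨h1, -, h2⟩ := h.integral_corrected (n := n) hg (T := f.cubeEstimator k) fun x => rfl
  simp_rw [umTKSG_eq]
  refine ⟨hmp.integrable_comp_of_integrable h1, ?_⟩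
  have e := integral_map hmp.measurable.aemeasurable
    (f := fun z => |f.cubeEstimator k z|) (by rw [hmp.map_eq]; exact h1.abs.aestronglyMeasurable)
  rw [← e, hmp.map_eq]
  linarith

lemma abs_integral_umTKSG_sub_le (hd : 1 ≤ d) (hk : 1 ≤ k) (hkn : k ≤ n) :
    |∫ x : Fin (n + 1) → Vec d, umTKSG k f x ∂(Measure.pi fun _ => densityMeasure p)
      - diffEntropy p| ≤ biasBound d k (n + 1) c := by
  obtain ⟨hg, hHeq, -⟩ := f.integrable_logJacobian h hp hH
  have hmp := f.measurePreserving_sample (n := n + 1) hp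
  obtain ⟨h1, -, -⟩ := h.integral_corrected (n := n) hg (T := f.cubeEstimator k) fun x => rfl
  simp_rw [umTKSG_eq]
  have e := integral_map hmp.measurable.aemeasurable
    (f := f.cubeEstimator k) (by rw [hmp.map_eq]; exact h1.aestronglyMeasurable)
  rw [← e, hmp.map_eq]
  exact h.abs_integral_corrected_sub_le hd hk hkn hg (fun x => rfl) hHeq

lemma integral_umTKSG_sub_sq_le (hd : 1 ≤ d) (hk : 1 ≤ k) (hkn : k ≤ n)
    (hH2 : Integrable fun x => Real.log (p x) ^ 2 * p x) :
    Integrable (fun x : Fin (n + 1) → Vec d => (umTKSG k f x - diffEntropy p) ^ 2)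
      (Measure.pi fun _ => densityMeasure p) ∧
    ∫ x : Fin (n + 1) → Vec d, (umTKSG k f x - diffEntropy p) ^ 2
        ∂(Measure.pi fun _ => densityMeasure p)
      ≤ 2 ^ k * (varianceConst d k + 12 * (2 * (-Real.log (1 - c) + 1) ^ 2
          + 2 * ∫ x, Real.log (p x) ^ 2 * p x))
        * (Real.log (n + 1 : ℕ) ^ (k + 2) / (n + 1 : ℕ)) + biasBound d k (n + 1) c ^ 2 := by
  obtain ⟨hg, hHeq, -⟩ := f.integrable_logJacobian h hp hH
  obtain ⟨hg2, hg2le⟩ := f.integrable_sq_logJacobian h hp hH2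
  have hmp := f.measurePreserving_sample (n := n + 1) hp
  obtain ⟨h1, h2⟩ := h.integral_corrected_sub_sq_le hd hk hkn f.measurable_logJacobian hg2
    (T := f.cubeEstimator k) (fun x => rfl) hHeq
  simp_rw [umTKSG_eq]
  refine ⟨hmp.integrable_comp_of_integrable h1, ?_⟩
  have e := integral_map hmp.measurable.aemeasurable
    (f := fun z => (f.cubeEstimator k z - diffEntropy p) ^ 2)
    (by rw [hmp.map_eq]; exact h1.aestronglyMeasurable)
  rw [← e, hmp.map_eq]
  refine h2.trans ?_
  have : 0 ≤ Real.log (n + 1 : ℕ) := Real.log_natCast_nonneg _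
  gcongr

end Estimator

section Family

variable {d k N : ℕ} {Θ : Type*} [MeasurableSpace Θ] {F : Θ → UniformizingMap d}
  (hF : Measurable fun w : Θ × Vec d => (F w.1).toFun w.2)
include hF

/-- The directional derivative is the pointwise limit of the difference quotients with step `1/m`,
each of which is jointly measurable in the parameter and the point. -/
lemma measurable_fderiv_family (v : Vec d) :
    Measurable fun w : Θ × Vec d => fderiv ℝ (F w.1).toFun w.2 v := by
  refine measurable_of_tendsto_metrizable (f := fun (m : ℕ) (w : Θ × Vec d) =>
    (m : ℝ) • ((F w.1).toFun (w.2 + (m : ℝ)⁻¹ • v) - (F w.1).toFun w.2)) (fun m => ?_) ?_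
  · have h1 : Measurable fun w : Θ × Vec d => (w.1, w.2 + (m : ℝ)⁻¹ • v) := by fun_prop
    have h2 : Measurable fun w : Θ × Vec d =>
        (F w.1).toFun (w.2 + (m : ℝ)⁻¹ • v) - (F w.1).toFun w.2 := (hF.comp h1).sub hF
    exact h2.const_smul (m : ℝ)
  · refine tendsto_pi_nhds.2 fun w => ?_
    refine ((F w.1).differentiable w.2).hasFDerivAt.lim v ?_
    simpa using tendsto_natCast_atTop_atTop

lemma measurable_det_family :
    Measurable fun w : Θ × Vec d => (fderiv ℝ (F w.1).toFun w.2).det := by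
  have h : ∀ w : Θ × Vec d, (fderiv ℝ (F w.1).toFun w.2).det
      = ∑ σ : Equiv.Perm (Fin d), ((Equiv.Perm.sign σ : ℤ) : ℝ)
        * ∏ i, fderiv ℝ (F w.1).toFun w.2 (Pi.single i 1) (σ i) := fun w => by
    rw [ContinuousLinearMap.det, ← LinearMap.det_toMatrix', Matrix.det_apply']
    simp [LinearMap.toMatrix'_apply]
  simp_rw [h]
  refine Finset.measurable_sum _ fun σ _ => measurable_const.mul
    (Finset.measurable_prod _ fun i _ => ?_)
  exact (measurable_pi_apply (σ i)).comp (measurable_fderiv_family hF _)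

/-- The Jacobian of the inverse is rewritten as the reciprocal of the forward one, so measurability
of the inverse in the training sample is never needed. -/
lemma measurable_umTKSG_family :
    Measurable fun w : Θ × (Fin N → Vec d) => umTKSG k (F w.1) w.2 := by
  have hpt : ∀ i : Fin N, Measurable fun w : Θ × (Fin N → Vec d) => (w.1, w.2 i) := by fun_prop
  have h1 : Measurable fun (w : Θ × (Fin N → Vec d)) (i : Fin N) => (F w.1).toFun (w.2 i) :=
    measurable_pi_lambda _ fun i => hF.comp (hpt i)
  have h2 : ∀ i : Fin N, Measurable fun w : Θ × (Fin N → Vec d) =>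
      Real.log |(fderiv ℝ (F w.1).inv ((F w.1).toFun (w.2 i))).det| := fun i => by
    simp_rw [log_det_inv]
    exact (Real.measurable_log.comp ((measurable_det_family hF).comp (hpt i)).abs).neg
  simp only [umTKSG, tKSG, log_zetaRect_sum]
  refine (measurable_const.add (measurable_const.mul
    (Finset.measurable_sum _ fun i _ => ?_))).add
    (measurable_const.mul (Finset.measurable_sum _ fun i _ => h2 i))
  exact measurable_logCell k _ h1 ((measurable_pi_apply i).comp h1)

/-- By continuity in `x` and `y` it is enough to test a countable dense set of points. This
circumvents the measurability of the supremum of the gradient in the parameter. -/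
lemma measurableSet_lipschitz_family {p : Vec d → ℝ} (hp : Continuous p) (c : ℝ) :
    MeasurableSet {θ | ∀ x y, |(F θ).ratio p x - (F θ).ratio p y|
      ≤ c * dist ((F θ).toFun x) ((F θ).toFun y)} := by
  have h : {θ | ∀ x y, |(F θ).ratio p x - (F θ).ratio p y|
      ≤ c * dist ((F θ).toFun x) ((F θ).toFun y)}
      = ⋂ i, ⋂ j, {θ | |(F θ).ratio p (TopologicalSpace.denseSeq (Vec d) i)
          - (F θ).ratio p (TopologicalSpace.denseSeq (Vec d) j)|
        ≤ c * dist ((F θ).toFun (TopologicalSpace.denseSeq (Vec d) i))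
          ((F θ).toFun (TopologicalSpace.denseSeq (Vec d) j))} := by
    ext θ
    simp only [Set.mem_ofPred_eq, Set.mem_iInter]
    refine ⟨fun h i j => h _ _, fun h => ?_⟩
    have hc := (F θ).differentiable.continuous
    have hr := (F θ).continuous_ratio hp
    exact (TopologicalSpace.denseRange_denseSeq (Vec d)).induction_on₂
      (p := fun x y => |(F θ).ratio p x - (F θ).ratio p y|
        ≤ c * dist ((F θ).toFun x) ((F θ).toFun y))
      (isClosed_le (by fun_prop) (by fun_prop)) h
  rw [h]
  refine MeasurableSet.iInter fun i => MeasurableSet.iInter fun j => ?_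
  have h1 : ∀ x, Measurable fun θ => (F θ).toFun x := fun x =>
    hF.comp (measurable_id.prodMk measurable_const)
  have h2 : ∀ x, Measurable fun θ => (F θ).ratio p x := fun x =>
    measurable_const.div ((measurable_det_family hF).comp
      (measurable_id.prodMk measurable_const)).abs
  exact measurableSet_le ((h2 _).sub (h2 _)).abs (((h1 _).dist (h1 _)).const_mul c)

end Family

end UniformizingMap

/-! ### Averaging over the training sample -/

section Mixture

variable {Θ Y : Type*} [MeasurableSpace Θ] [MeasurableSpace Y] {κ : Measure Θ} {ν : Measure Y}
  [IsProbabilityMeasure κ] [IsProbabilityMeasure ν] {G : Θ × Y → ℝ} {A : ℝ}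

lemma integrable_prod_of_ae_integral_abs_le (hG : Measurable G)
    (h : ∀ᵐ θ ∂κ, Integrable (fun y => G (θ, y)) ν ∧ ∫ y, |G (θ, y)| ∂ν ≤ A) :
    Integrable G (κ.prod ν) := by
  rw [integrable_prod_iff hG.aestronglyMeasurable]
  refine ⟨h.mono fun θ hθ => hθ.1, ?_⟩
  refine Integrable.mono' (integrable_const A)
    hG.norm.stronglyMeasurable.integral_prod_right.aestronglyMeasurable ?_
  filter_upwards [h] with θ hθ
  rw [Real.norm_of_nonneg (integral_nonneg fun y => norm_nonneg _)]
  exact hθ.2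

lemma abs_integral_prod_sub_le (hG : Integrable G (κ.prod ν)) {H B : ℝ}
    (h : ∀ᵐ θ ∂κ, |∫ y, G (θ, y) ∂ν - H| ≤ B) : |∫ w, G w ∂(κ.prod ν) - H| ≤ B := by
  have e : ∫ w, G w ∂(κ.prod ν) - H = ∫ θ, (∫ y, G (θ, y) ∂ν - H) ∂κ := by
    rw [integral_sub hG.integral_prod_left (integrable_const H), integral_prod _ hG]
    simp
  rw [e]
  have := norm_integral_le_of_norm_le_const (μ := κ) (f := fun θ => ∫ y, G (θ, y) ∂ν - H) h
  simpa using this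

lemma integral_prod_le (hG : Integrable G (κ.prod ν)) {B : ℝ}
    (h : ∀ᵐ θ ∂κ, ∫ y, G (θ, y) ∂ν ≤ B) : ∫ w, G w ∂(κ.prod ν) ≤ B := by
  rw [integral_prod _ hG]
  refine (integral_mono_ae hG.integral_prod_left (integrable_const B) h).trans_eq ?_
  simp

end Mixture

lemma ProbabilityTheory.iIndepFun.measurePreserving_sumElim {Ω X : Type*} [MeasurableSpace Ω]
    [MeasurableSpace X] {P : Measure Ω} [IsProbabilityMeasure P] {ρ : Measure X}
    [IsProbabilityMeasure ρ] {S T : ℕ → Ω → X} (hS : ∀ i, Measurable (S i))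
    (hT : ∀ i, Measurable (T i)) (hSρ : ∀ i, P.map (S i) = ρ) (hTρ : ∀ i, P.map (T i) = ρ)
    (h : iIndepFun (Sum.elim S T) P) (N : ℕ) :
    MeasurePreserving (fun ω => ((fun i : Fin N => S i ω), fun i : Fin N => T i ω)) P
      ((Measure.pi fun _ => ρ).prod (Measure.pi fun _ => ρ)) := by
  let e : Fin N ⊕ Fin N → ℕ ⊕ ℕ := Sum.map Fin.val Fin.val
  have he : Function.Injective e := Sum.map_injective.2 ⟨Fin.val_injective, Fin.val_injective⟩
  have hm : ∀ i, Measurable (Sum.elim S T (e i)) := by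
    rintro (i | i)
    · exact hS i
    · exact hT i
  have hρ : ∀ i, P.map (Sum.elim S T (e i)) = ρ := by
    rintro (i | i)
    · exact hSρ i
    · exact hTρ i
  have h1 := (iIndepFun_iff_map_fun_eq_pi_map fun i => (hm i).aemeasurable).1 (h.precomp he)
  simp only [hρ] at h1
  have h2 : MeasurePreserving (fun ω i => Sum.elim S T (e i) ω) P
      (Measure.pi fun _ : Fin N ⊕ Fin N => ρ) := ⟨measurable_pi_lambda _ hm, h1⟩
  exact (measurePreserving_sumPiEquivProdPi fun _ : Fin N ⊕ Fin N => ρ).comp h2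

end

/-! ### The final estimate -/

theorem corollary3 (d k : ℕ) (hd : 1 ≤ d) (hk : 1 ≤ k) :
    -- the constant `C` depends on `d` and `k` only
    ∃ C : ℝ, 0 < C ∧
      ∀ (p : Vec d → ℝ), IsProbDensity p → Differentiable ℝ p →
        -- the entropy `H(X)` is finite
        Integrable (fun x => Real.log (p x) * p x) →
      ∀ Cbar : ℝ, 0 < Cbar → Cbar < 1 →
      -- the constant `C₂` depends on `d`, `k`, `p` and `Cbar` only
      ∃ C₂ : ℝ, 0 < C₂ ∧
        ∀ (Ω : Type*) [MeasurableSpace Ω] (P : Measure Ω) [IsProbabilityMeasure P]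
          -- training samples `S` and estimation samples `X`, all i.i.d. with density `p`
          (S X : ℕ → Ω → Vec d),
          (∀ i, Measurable (S i)) → (∀ i, Measurable (X i)) →
          (∀ i, P.map (S i) = densityMeasure p) → (∀ i, P.map (X i) = densityMeasure p) →
          iIndepFun (Sum.elim S X) P →
        -- the uniformizing map constructed from `N` training samples
        ∀ (UM : (N : ℕ) → (Fin N → Vec d) → UniformizingMap d),
          (∀ N, Measurable (fun q : (Fin N → Vec d) × Vec d => (UM N q.1).toFun q.2)) →
          -- the gradient bound tends to zero in probability
          TendstoInMeasure P
            (fun (N : ℕ) ω => gradSup ((UM N (fun i => S i ω)).density p)) atTop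
            (fun _ => (0 : ℝ≥0∞)) →
        ∀ M : ℕ, 0 < M →
          (∀ N, M < N → ∀ᵐ ω ∂P,
            gradSup ((UM N (fun i => S i ω)).density p) ≤ ENNReal.ofReal Cbar) →
        ∀ N : ℕ, M < N → k < N →
          -- the bias bound
          (Integrable (fun ω => umTKSG k (UM N (fun i => S i ω)) (fun i : Fin N => X i ω)) P ∧
            |∫ ω, umTKSG k (UM N (fun i => S i ω)) (fun i : Fin N => X i ω) ∂P - diffEntropy p|
              ≤ C * umFactor d k Cbar
                  * (Real.log N ^ (k + 2) / (N : ℝ) ^ ((1 : ℝ) / d))) ∧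
          -- the bound of the mean square error, if `log p(X)` has a finite second moment
          (Integrable (fun x => Real.log (p x) ^ 2 * p x) →
            Integrable (fun ω =>
              (umTKSG k (UM N (fun i => S i ω)) (fun i : Fin N => X i ω) - diffEntropy p) ^ 2) P ∧
            ∫ ω, (umTKSG k (UM N (fun i => S i ω)) (fun i : Fin N => X i ω)
                - diffEntropy p) ^ 2 ∂P
              ≤ C₂ * (Real.log N ^ (k + 2) / N)
                + (C * umFactor d k Cbar) ^ 2
                  * (Real.log N ^ (2 * (k + 2)) / (N : ℝ) ^ ((2 : ℝ) / d))) := by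
  refine ⟨biasConst d k, biasConst_pos d k, fun p hp hpd hH c hc0 hc1 => ?_⟩
  set B0 : ℝ := -Real.log (1 - c) + 1
  set I2 : ℝ := ∫ x, Real.log (p x) ^ 2 * p x with hI2
  have hI2n : 0 ≤ I2 := integral_nonneg fun x => mul_nonneg (sq_nonneg _) (hp.nonneg x)
  have hB0 : 1 ≤ B0 := by
    have := Real.log_nonpos (by linarith : 0 ≤ 1 - c) (by linarith)
    linarith
  -- `2 * B0 ^ 2 + 2 * I2` bounds the second moment of the log-Jacobian for every admissible map, so
  -- this constant does not see the training sample.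
  refine ⟨2 ^ k * (varianceConst d k + 12 * (2 * B0 ^ 2 + 2 * I2)), ?_, ?_⟩
  · have := varianceConst_nonneg d k
    have : 0 < B0 := by linarith
    positivity
  intro Ω _ P _ S X hS hX hSρ hXρ hind UM hUM _ M hM hgrad N hMN hkN
  obtain ⟨n, rfl⟩ : ∃ n, N = n + 1 := ⟨N - 1, by omega⟩
  have hkn : k ≤ n := by omega
  have := hp.isProbabilityMeasure
  set ν := Measure.pi fun _ : Fin (n + 1) => densityMeasure p with hν
  have hmp := hind.measurePreserving_sumElim hS hX hSρ hXρ (n + 1)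
  set W : Ω → (Fin (n + 1) → Vec d) × (Fin (n + 1) → Vec d) :=
    fun ω => ((fun i : Fin (n + 1) => S i ω), fun i : Fin (n + 1) => X i ω) with hW
  set G : (Fin (n + 1) → Vec d) × (Fin (n + 1) → Vec d) → ℝ :=
    fun w => umTKSG k (UM (n + 1) w.1) w.2 with hG
  have hGm : Measurable G := UniformizingMap.measurable_umTKSG_family (hUM (n + 1))
  -- The gradient bound is known almost surely on `Ω`. Its Lipschitz consequence describes a
  -- measurable set of training samples, and so it passes to almost every sample under the product
  -- law.
  have hgood : ∀ᵐ θ ∂ν, NearUniform c ((UM (n + 1) θ).cubeDensity p)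
      ((densityMeasure p).map (UM (n + 1) θ).toFun) := by
    have h1 : ∀ᵐ θ ∂ν, ∀ x y, |(UM (n + 1) θ).ratio p x - (UM (n + 1) θ).ratio p y|
        ≤ c * dist ((UM (n + 1) θ).toFun x) ((UM (n + 1) θ).toFun y) := by
      have h2 : MeasurePreserving (fun ω => fun i : Fin (n + 1) => S i ω) P ν :=
        measurePreserving_fst.comp hmp
      rw [← h2.map_eq, ae_map_iff h2.measurable.aemeasurable
        (UniformizingMap.measurableSet_lipschitz_family (hUM (n + 1)) hpd.continuous c)]
      filter_upwards [hgrad (n + 1) hMN] with ω hω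
      exact (UM (n + 1) _).abs_ratio_sub_le_of_gradSup_le hpd hc0.le hω
    filter_upwards [h1] with θ hθ using (UM (n + 1) θ).nearUniform hp hc0.le hc1 hθ
  have hGi : Integrable G (ν.prod ν) := by
    refine integrable_prod_of_ae_integral_abs_le
      (A := |-psi k + psi ((n : ℝ) + 1) + ((d : ℝ) - 1) / k| + 16 * d * n
        + (B0 + ∫ x, |Real.log (p x)| * p x)) hGm ?_
    filter_upwards [hgood] with θ hθ using (UM (n + 1) θ).integrable_umTKSG hp hθ hH
  have hGint : ∀ {φ : (Fin (n + 1) → Vec d) × (Fin (n + 1) → Vec d) → ℝ},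
      Integrable φ (ν.prod ν) → Integrable (fun ω => φ (W ω)) P ∧
        ∫ ω, φ (W ω) ∂P = ∫ w, φ w ∂(ν.prod ν) := fun {φ} hφ => by
    refine ⟨hmp.integrable_comp_of_integrable hφ, ?_⟩
    rw [← hmp.map_eq, integral_map hmp.measurable.aemeasurable]
    rw [hmp.map_eq]
    exact hφ.aestronglyMeasurable
  refine ⟨⟨(hGint hGi).1, ?_⟩, fun hH2 => ?_⟩
  · change |∫ ω, G (W ω) ∂P - diffEntropy p| ≤ biasBound d k (n + 1) c
    rw [(hGint hGi).2]
    refine abs_integral_prod_sub_le hGi ?_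
    filter_upwards [hgood] with θ hθ
    exact (UM (n + 1) θ).abs_integral_umTKSG_sub_le hp hθ hH hd hk hkn
  · have hb := hgood.mono fun θ hθ =>
      (UM (n + 1) θ).integral_umTKSG_sub_sq_le hp hθ hH hd hk hkn hH2
    -- The squared error is nonnegative, so its conditional mean bound serves twice: as the uniform
    -- bound for joint integrability and as the estimate itself.
    have hsq : Integrable (fun w => (G w - diffEntropy p) ^ 2) (ν.prod ν) := by
      refine integrable_prod_of_ae_integral_abs_le
        (A := 2 ^ k * (varianceConst d k + 12 * (2 * B0 ^ 2 + 2 * I2))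
          * (Real.log (n + 1 : ℕ) ^ (k + 2) / (n + 1 : ℕ)) + biasBound d k (n + 1) c ^ 2) ((hGm.sub_const _).pow_const 2) ?_
      filter_upwards [hb] with θ hθ
      simp only [abs_sq]
      exact hθ
    refine ⟨(hGint hsq).1, ?_⟩
    change ∫ ω, (G (W ω) - diffEntropy p) ^ 2 ∂P ≤ _
    rw [(hGint hsq).2, ← biasBound_sq]
    exact integral_prod_le hsq (hb.mono fun θ hθ => hθ.2)
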